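/- Let $T>0$, $\sigma>0$, let $f,g:\mathbb R\to\mathbb R$ be smooth with $g\ge 0$, and suppose that $f$ satisfies the non-explosion condition $x f(x)\le K(1+x^2)$ for some constant $K$ and all $x\in\mathbb R$. For $x\in\mathbb R$ and $t\in[0,T)$ consider the action functional $$F(\psi)=\frac1{2\sigma^2}\int_t^T\big(\dot\psi_s-f(\psi_s)\big)^2\,ds+g(\psi_T)$$ on absolutely continuous paths $\psi:[t,T]\to\mathbb R$ with square-integrable derivative and $\psi_t=x$. Assume that for every $x\in\mathbb R$ and $t\in[0,T)$ this functional has a unique global minimizer $s\mapsto\phi_s(x,t)$ (the optimal path), that this path is $C^2$ on $[t,T]$, and that it is a nondegenerate minimum: the second variation $$\frac1{\sigma^2}\int_t^T\Big[\big(\dot\eta-f'(\phi)\eta\big)^2-\big(\dot\phi-f(\phi)\big)f''(\phi)\,\eta^2\Big]ds+g''(\phi_T)\,\eta_T^2$$ is positive for every nonzero absolutely continuous $\eta$ on $[t,T]$ with square-integrable derivative and $\eta_t=0$. Write $\dot\phi_t(x,t)=\partial_s\phi_s(x,t)|_{s=t}$. For $N\ge1$ put $\Delta t=T/N$. For $0\le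 n<N$ and $x_n=x$ consider the discrete action $$F^{\Delta t}(x_{n+1},\dots,x_N)=\frac{\Delta t}{2\sigma^2}\sum_{k=n}^{N-1}\Big(\frac{x_{k+1}-x_k}{\Delta t}-f(x_k)\Big)^2+g(x_N).$$ A discrete optimal path from $x$ at step $n$ is a global minimizer $(\phi^{\Delta t}_{n+1}(x,n),\dots,\phi^{\Delta t}_N(x,n))$ of $F^{\Delta t}$; put $\phi^{\Delta t}_n(x,n)=x$. Let $H$ be the Hessian matrix of $F^{\Delta t}$ at the discrete optimal path and $\Sigma^{\Delta t}_{n+1}(x,n)=(H^{-1})_{1,1}/\Delta t$. (The dynamic linear map, DLM, with noise parameter $\varepsilon>0$ samples $X_{n+1}\sim\mathcal N\big(\phi^{\Delta t}_{n+1}(X_n,n),\,\Delta t\,\varepsilon\,\Sigma^{\Delta t}_{n+1}(X_n,n)\big)$.) Then for every $R$ there are a constant $C$ and an $N_0$ such that, for all $N\ge N_0$ (with $N\ge 1$), all $0\le n<N$ and all $|x|\le R$, a discrete optimal path from $x$ at step $n$ exists, and every such path satisfies (a) $\displaystyle\Big|\frac{\phi^{\Delta t}_{n+1}(x,n)-\phi^{\Delta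 t}_n(x,n)}{\Delta t}-\dot\phi_{n\Delta t}(x,n\Delta t)\Big|\le C\,\Delta t$; (b) $H$ is invertible and $\big|\Sigma^{\Delta t}_{n+1}(x,n)-\sigma^2\big|\le C\,\Delta t$. That is, the drift and variance factors of DLM agree up to $O(\Delta t)$, uniformly in $n$ and locally uniformly in $x$, with those of the SDE $dX_t=\dot\phi_t(X_t,t)\,dt+\sqrt\varepsilon\,\sigma\,dB_t$, which is the sense in which DLM is consistent with this SDE. -/

import Mathlib

open Set MeasureTheory
open scoped ContDiff

/-- Paths on `[t, T]` that may enter the action functional: absolutely continuous paths whose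
derivative (which exists almost everywhere) is square integrable.  Only the restriction of `x` to
`[t, T]` matters. -/
def IsActionPath (t T : ℝ) (x : ℝ → ℝ) : Prop :=
  AbsolutelyContinuousOnInterval x t T ∧
    IntervalIntegrable (fun s => (deriv x s) ^ 2) volume t T

/-- The action functional
`F(x_{t:T}) = (1 / (2 σ²)) ∫_t^T (ẋ_s - f(x_s))² ds + g(x_T)`. -/
noncomputable def action (f g : ℝ → ℝ) (σ t T : ℝ) (x : ℝ → ℝ) : ℝ :=
  1 / (2 * σ ^ 2) * (∫ s in t..T, (deriv x s - f (x s)) ^ 2) + g (x T)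

/-- `φ` is an optimal path from position `x₀` at time `t`: it minimizes the action among all
admissible paths on `[t, T]` that start at `x₀`. -/
def IsOptimalPath (f g : ℝ → ℝ) (σ T x₀ t : ℝ) (φ : ℝ → ℝ) : Prop :=
  IsActionPath t T φ ∧ φ t = x₀ ∧
    ∀ ψ : ℝ → ℝ, IsActionPath t T ψ → ψ t = x₀ → action f g σ t T φ ≤ action f g σ t T ψ

/-- `φ` is the unique optimal path from position `x₀` at time `t` (as a path on `[t, T]`). -/
def IsUniqueOptimalPath (f g : ℝ → ℝ) (σ T x₀ t : ℝ) (φ : ℝ → ℝ) : Prop :=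
  IsOptimalPath f g σ T x₀ t φ ∧
    ∀ ψ : ℝ → ℝ, IsOptimalPath f g σ T x₀ t ψ → EqOn ψ φ (Icc t T)

/-- The second variation of the action at `φ` in the direction `η`, that is, the second derivative
at `r = 0` of `r ↦ F(φ + r η)`:
`σ⁻² ∫_t^T [(η̇ - f'(φ) η)² - (φ̇ - f(φ)) f''(φ) η²] ds + g''(φ(T)) η(T)²`. -/
noncomputable def secondVariation (f g : ℝ → ℝ) (σ t T : ℝ) (φ η : ℝ → ℝ) : ℝ :=
  1 / σ ^ 2 *
      (∫ s in t..T, ((deriv η s - deriv f (φ s) * η s) ^ 2 -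
        (deriv φ s - f (φ s)) * deriv (deriv f) (φ s) * η s ^ 2)) +
    deriv (deriv g) (φ T) * η T ^ 2

/-- The minimum of the action at `φ` is nondegenerate: the second variation is positive in every
nonzero direction that keeps the initial point fixed. -/
def IsNondegeneratePath (f g : ℝ → ℝ) (σ t T : ℝ) (φ : ℝ → ℝ) : Prop :=
  ∀ η : ℝ → ℝ, IsActionPath t T η → η t = 0 → (∃ s ∈ Icc t T, η s ≠ 0) →
    0 < secondVariation f g σ t T φ η

/-- The discrete path `(x₀, y 0, …, y (M - 1))` with `M` steps that starts at `x₀`. -/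
def discretePath {M : ℕ} (x₀ : ℝ) (y : Fin M → ℝ) : Fin (M + 1) → ℝ :=
  Fin.cons x₀ y

/-- The discrete action with step size `h` (Euler discretization) of a path with `M` steps that
starts at `x₀`, as a function of the `M` free positions `y`:
`(h / (2 σ²)) ∑_k ((x_{k+1} - x_k) / h - f(x_k))² + g(x_M)`. -/
noncomputable def discreteAction (f g : ℝ → ℝ) (σ h : ℝ) {M : ℕ} (x₀ : ℝ) (y : Fin M → ℝ) : ℝ :=
  h / (2 * σ ^ 2) *
      (∑ k : Fin M, ((discretePath x₀ y k.succ - discretePath x₀ y k.castSucc) / h -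
        f (discretePath x₀ y k.castSucc)) ^ 2) +
    g (discretePath x₀ y (Fin.last M))

/-- `y` is (the free part of) a discrete optimal path with `M` steps from `x₀`. -/
def IsDiscreteOptimalPath (f g : ℝ → ℝ) (σ h : ℝ) {M : ℕ} (x₀ : ℝ) (y : Fin M → ℝ) : Prop :=
  ∀ z : Fin M → ℝ, discreteAction f g σ h x₀ y ≤ discreteAction f g σ h x₀ z

/-- The matrix of second partial derivatives of `F` at `y`. -/
noncomputable def hessianMatrix {M : ℕ} (F : (Fin M → ℝ) → ℝ) (y : Fin M → ℝ) :
    Matrix (Fin M) (Fin M) ℝ :=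
  Matrix.of fun i j =>
    fderiv ℝ (fun z => fderiv ℝ F z (Pi.single j 1)) y (Pi.single i 1)

/-- The variance factor `(H⁻¹)_{1,1} / h` of a step of the dynamic linear map, where `H` is the
Hessian of the discrete action at `y`. -/
noncomputable def dlmVariance (f g : ℝ → ℝ) (σ h : ℝ) {M : ℕ} (hM : 0 < M) (x₀ : ℝ)
    (y : Fin M → ℝ) : ℝ :=
  (hessianMatrix (discreteAction f g σ h x₀) y)⁻¹ ⟨0, hM⟩ ⟨0, hM⟩ / h

/-! Both minimization problems are solved by shooting backward from the end point. A continuous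
minimizer satisfies, with control `U = φ̇ - f(φ)`, the Hamiltonian system `φ̇ = f(φ) + U`, `U̇ =
-f'(φ) U`, with `U = -σ² g'(φ)` at time `T`. It is therefore determined by its end point `z`, and
the extremals form a family `X z r`, `U z r` in the time to go `r`, with linearization `η`, `ν` in
`z`. The discrete critical equations are a semi-implicit Euler scheme for the same system, so a
discrete minimizer is `O(h)`-close to the extremal with its own end point
(`IsExtremalField.exists_discretization_error`). The growth condition and `g ≥ 0` confine all
minimizers from `|x| ≤ R` to a fixed interval `[-ρ, ρ]`, so `f` may be replaced by a compactly
supported `F`.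

It remains to show that the discrete and continuous end points differ by `O(h)`, although the
extremals need not be globally injective in `z`. Comparison of actions shows that the discrete end
point is optimal up to an error `O(h)` (`IsExtremalField.exists_isNearlyOptimal`). At error zero,
near-optimality means being the unique minimizer (`IsExtremalField.eq_of_isNearlyOptimal_zero`), and
nondegeneracy excludes conjugate points, `η ≠ 0` (`IsExtremalField.η_ne_zero`). By compactness both
facts persist for small errors: nearly optimal end points lie close together, `|η|` is bounded below
there, and hence `z ↦ X z τ` is expanding between them
(`IsExtremalField.exists_uniform_nondegeneracy`). Since both extremals start within `O(h)` of `x`,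
their end points are `O(h)`-close, and so are the initial controls, which gives the drift.

For the variance, the Hessian is inverted on the first basis vector by the linearized discrete
extremal `(e, n)`. This yields the exact value `σ² (1 + h n₁ / (e₀ (1 + h f'(x₀))))`
(`hessianMatrix_discreteAction`). As `e₀` is `O(h)`-close to `η`, it stays away from zero, and the
correction is `O(h)`. -/

/-! ### Analytic tools: Gronwall estimates, flows, one-step schemes, Riemann sums. -/

theorem le_exp_of_le_one_add_mul {a b : ℕ → ℝ} {c : ℝ} {M : ℕ} (hc : 0 ≤ c)
    (hb : ∀ j, 0 ≤ b j) (h0 : 0 ≤ a 0) (h : ∀ j < M, a (j + 1) ≤ (1 + c) * a j + b j) :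
    ∀ j ≤ M, a j ≤ (a 0 + ∑ i ∈ Finset.range j, b i) * Real.exp (c * j) := by
  intro j
  induction j with
  | zero => simp
  | succ j ih =>
    intro hj
    have h1 := h j (by omega)
    have h2 := ih (by omega)
    have h3 : 1 + c ≤ Real.exp c := by linarith [Real.add_one_le_exp c]
    have h4 : 0 ≤ ∑ i ∈ Finset.range j, b i := Finset.sum_nonneg fun i _ => hb i
    have h5 : 1 ≤ Real.exp (c * (j + 1)) := Real.one_le_exp (by positivity)
    rw [Finset.sum_range_succ]
    have h6 : Real.exp (c * (j + 1)) = Real.exp c * Real.exp (c * j) := by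
      rw [← Real.exp_add]; ring_nf
    push_cast
    calc a (j + 1) ≤ (1 + c) * a j + b j := h1
      _ ≤ (1 + c) * ((a 0 + ∑ i ∈ Finset.range j, b i) * Real.exp (c * j)) + b j := by gcongr
      _ ≤ Real.exp c * ((a 0 + ∑ i ∈ Finset.range j, b i) * Real.exp (c * j))
            + b j * Real.exp (c * (j + 1)) := by
          gcongr
          exact le_mul_of_one_le_right (hb j) h5
      _ = _ := by rw [h6]; ring

/-- The mean value inequality is used twice, for `h'` and then for `h` minus its tangent. This loses
the factor 1/2 of Taylor's formula, which is immaterial here. -/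
theorem abs_sub_sub_mul_le {h h' h'' : ℝ → ℝ} {s : Set ℝ} (hs : Convex ℝ s) {L : ℝ}
    (h1 : ∀ x, HasDerivAt h (h' x) x) (h2 : ∀ x, HasDerivAt h' (h'' x) x)
    (hL : ∀ x ∈ s, |h'' x| ≤ L) {a b : ℝ} (ha : a ∈ s) (hb : b ∈ s) :
    |h b - h a - h' a * (b - a)| ≤ L * (b - a) ^ 2 := by
  have hab : segment ℝ a b ⊆ s := hs.segment_subset ha hb
  have key : ∀ x ∈ segment ℝ a b, ‖h' x - h' a‖ ≤ L * |b - a| := by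
    intro x hx
    have := (convex_segment a b).norm_image_sub_le_of_norm_hasDerivWithin_le (f := h') (f' := h'')
      (C := L) (fun y _ => (h2 y).hasDerivWithinAt) (fun y hy => hL y (hab hy))
      (left_mem_segment ℝ a b) hx
    refine this.trans ?_
    have hL0 : 0 ≤ L := (abs_nonneg _).trans (hL a ha)
    gcongr
    rw [Real.norm_eq_abs]
    rw [segment_eq_uIcc] at hx
    exact abs_sub_left_of_mem_uIcc hx
  have := (convex_segment a b).norm_image_sub_le_of_norm_hasDerivWithin_le
    (f := fun x => h x - h' a * x) (f' := fun x => h' x - h' a)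
      (C := L * |b - a|)
      (fun y _ => ((h1 y).sub (by simpa using (hasDerivAt_id y).const_mul (h' a))).hasDerivWithinAt)
      key (left_mem_segment ℝ a b) (right_mem_segment ℝ a b)
  calc |h b - h a - h' a * (b - a)| = ‖h b - h' a * b - (h a - h' a * a)‖ := by
        rw [Real.norm_eq_abs]; ring_nf
    _ ≤ L * |b - a| * ‖b - a‖ := this
    _ = L * (b - a) ^ 2 := by rw [Real.norm_eq_abs, mul_assoc, ← sq, sq_abs]

theorem exists_flow_of_hasCompactSupport {E : Type*} [NormedAddCommGroup E] [NormedSpace ℝ E]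
    [CompleteSpace E] {w : E → E} (hw : ContDiff ℝ 1 w) (hc : HasCompactSupport w)
    {r : ℝ} (hr : 0 ≤ r) {T : ℝ} (hT : 0 < T) :
    ∃ α : E → ℝ → E,
      ContinuousOn (Function.uncurry α) (Metric.closedBall 0 r ×ˢ Icc (-1) (T + 1)) ∧
      ∀ y ∈ Metric.closedBall (0 : E) r, α y 0 = y ∧
        ∀ t ∈ Icc 0 T, HasDerivAt (α y) (w (α y t)) t := by
  obtain ⟨K, hK⟩ := hw.lipschitzWith_of_hasCompactSupport hc (by simp)
  obtain ⟨B, hB⟩ := hc.exists_bound_of_continuous hw.continuous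
  have hB0 : 0 ≤ B := (norm_nonneg _).trans (hB 0)
  -- The time interval exceeds `[0, T]` on both sides so that two-sided derivatives exist at the
  -- ends. With speed at most `B`, a solution from the ball of radius `r` cannot leave the ball of
  -- radius `B (T + 1) + r`.
  have hpl : IsPicardLindelof (fun _ => w) (tmin := -1) (tmax := T + 1) ⟨0, by simp; linarith⟩
      (0 : E) (B * (T + 1) + r).toNNReal r.toNNReal B.toNNReal K := by
    refine IsPicardLindelof.of_time_independent (fun x _ => ?_) hK.lipschitzOnWith ?_
    · rw [Real.coe_toNNReal _ hB0]; exact hB x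
    · have : max (T + 1) (1 : ℝ) = T + 1 := max_eq_left (by linarith)
      simp only [sub_zero, sub_neg_eq_add, zero_add]
      rw [Real.coe_toNNReal _ hB0, Real.coe_toNNReal _ hr,
        Real.coe_toNNReal _ (by positivity), this]
      simp
  obtain ⟨α, h1, h2⟩ := hpl.exists_forall_mem_closedBall_eq_hasDerivWithinAt_continuousOn
  rw [Real.coe_toNNReal _ hr] at h1 h2
  refine ⟨fun y t => α (y, t), h2, fun y hy => ⟨(h1 y hy).1, fun t ht => ?_⟩⟩
  exact ((h1 y hy).2 t ⟨by linarith [ht.1], by linarith [ht.2]⟩).hasDerivAt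
    (Icc_mem_nhds (by linarith [ht.1]) (by linarith [ht.2]))

/-- The first argument of `Φ` is the new value and the second the old one, so the scheme is
semi-implicit. The local error is `2 L B h²`; the implicit term is absorbed on the left because `L h
≤ 1/2`, and discrete Gronwall sums the errors. -/
theorem one_step_error {E : Type*} [NormedAddCommGroup E] [NormedSpace ℝ E]
    {Φ : E → E → E} {S : Set E} {L B T h : ℝ} {M : ℕ} {Y : ℝ → E} {y : ℕ → E}
    (hL0 : 0 ≤ L) (hB0 : 0 ≤ B) (hh : 0 ≤ h) (hLh : L * h ≤ 1 / 2) (hM : M * h ≤ T)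
    (hL : ∀ a ∈ S, ∀ b ∈ S, ∀ a' ∈ S, ∀ b' ∈ S, ‖Φ a b - Φ a' b'‖ ≤ L * (‖a - a'‖ + ‖b - b'‖))
    (hB : ∀ a ∈ S, ‖Φ a a‖ ≤ B)
    (hY : ∀ t ∈ Icc 0 T, HasDerivAt Y (Φ (Y t) (Y t)) t) (hYS : ∀ t ∈ Icc 0 T, Y t ∈ S)
    (hyS : ∀ j ≤ M, y j ∈ S) (hy : ∀ j < M, y (j + 1) = y j + h • Φ (y (j + 1)) (y j))
    (h0 : y 0 = Y 0) :
    ∀ j ≤ M, ‖y j - Y (j * h)‖ ≤ 4 * L * B * T * Real.exp (4 * L * T) * h := by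
  have mem : ∀ j : ℕ, j ≤ M → (j * h) ∈ Icc 0 T := fun j hj =>
    ⟨by positivity, le_trans (by gcongr) hM⟩
  have hlip : ∀ t ∈ Icc 0 T, ∀ s ∈ Icc 0 T, ‖Y t - Y s‖ ≤ B * |t - s| := fun t ht s hs =>
    (convex_Icc 0 T).norm_image_sub_le_of_norm_hasDerivWithin_le
      (fun r hr => (hY r hr).hasDerivWithinAt) (fun r hr => hB _ (hYS r hr)) hs ht
  have cons : ∀ j < M, ‖Y ((j + 1 : ℕ) * h) - Y (j * h)
      - h • Φ (Y ((j + 1 : ℕ) * h)) (Y (j * h))‖ ≤ 2 * L * B * h ^ 2 := by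
    intro j hj
    have m1 := mem (j + 1) (by omega)
    have m0 := mem j (by omega)
    have hle : (j : ℝ) * h ≤ (j + 1 : ℕ) * h := by push_cast; nlinarith
    have hsub : ((j + 1 : ℕ) : ℝ) * h - j * h = h := by push_cast; ring
    set c := Φ (Y ((j + 1 : ℕ) * h)) (Y (j * h))
    have := (convex_Icc (j * h) ((j + 1 : ℕ) * h)).norm_image_sub_le_of_norm_hasDerivWithin_le
      (f := fun s => Y s - s • c) (f' := fun s => Φ (Y s) (Y s) - c) (C := 2 * L * B * h)
      (fun s hs => ((hY s ⟨m0.1.trans hs.1, hs.2.trans m1.2⟩).sub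
        (by simpa using (hasDerivAt_id s).smul_const c)).hasDerivWithinAt)
      (fun s hs => by
        have ms : s ∈ Icc 0 T := ⟨m0.1.trans hs.1, hs.2.trans m1.2⟩
        refine (hL _ (hYS s ms) _ (hYS s ms) _ (hYS _ m1) _ (hYS _ m0)).trans ?_
        have e1 := hlip s ms _ m1
        have e2 := hlip s ms _ m0
        have e3 : |s - (j + 1 : ℕ) * h| ≤ h := by
          rw [abs_le]; constructor <;> linarith [hs.1, hs.2]
        have e4 : |s - j * h| ≤ h := by
          rw [abs_le]; constructor <;> linarith [hs.1, hs.2]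
        have e5 : B * |s - (j + 1 : ℕ) * h| ≤ B * h := by gcongr
        have e6 : B * |s - j * h| ≤ B * h := by gcongr
        calc _ ≤ L * (B * h + B * h) := by gcongr <;> linarith
          _ = _ := by ring)
      (left_mem_Icc.2 hle) (right_mem_Icc.2 hle)
    rw [hsub, Real.norm_of_nonneg hh] at this
    calc _ = ‖Y ((j + 1 : ℕ) * h) - ((j + 1 : ℕ) * h) • c - (Y (j * h) - (j * h) • c)‖ := by
          congr 1
          have : h • c = ((j + 1 : ℕ) * h) • c - (j * h) • c := by rw [← sub_smul, hsub]
          rw [this]; abel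
      _ ≤ _ := this
      _ = _ := by ring
  have step : ∀ j < M, ‖y (j + 1) - Y ((j + 1 : ℕ) * h)‖ ≤
      (1 + 4 * L * h) * ‖y j - Y (j * h)‖ + 4 * L * B * h ^ 2 := by
    intro j hj
    have m1 := mem (j + 1) (by omega)
    have m0 := mem j (by omega)
    have c := cons j hj
    set a := ‖y (j + 1) - Y ((j + 1 : ℕ) * h)‖
    set b := ‖y j - Y (j * h)‖
    have l := hL _ (hyS (j + 1) (by omega)) _ (hyS j (by omega)) _ (hYS _ m1) _ (hYS _ m0)
    have key : a ≤ b + h * (L * (a + b)) + 2 * L * B * h ^ 2 := by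
      calc a = ‖(y j - Y (j * h)) + h • (Φ (y (j + 1)) (y j)
              - Φ (Y ((j + 1 : ℕ) * h)) (Y (j * h)))
              - (Y ((j + 1 : ℕ) * h) - Y (j * h)
                - h • Φ (Y ((j + 1 : ℕ) * h)) (Y (j * h)))‖ := by
            simp only [a]
            congr 1
            nth_rw 1 [hy j hj]
            rw [smul_sub]; abel
        _ ≤ b + ‖h • (Φ (y (j + 1)) (y j) - Φ (Y ((j + 1 : ℕ) * h)) (Y (j * h)))‖
              + 2 * L * B * h ^ 2 := (norm_sub_le _ _).trans (add_le_add (norm_add_le _ _) c)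
        _ ≤ _ := by
            rw [norm_smul, Real.norm_of_nonneg hh]
            gcongr
    have ha : 0 ≤ a := norm_nonneg _
    have hb : 0 ≤ b := norm_nonneg _
    have hLh0 : 0 ≤ L * h := by positivity
    have h3 : 0 ≤ L * B * h ^ 2 := by positivity
    have k1 : a * (1 - L * h) ≤ b * (1 + L * h) + 2 * (L * B * h ^ 2) := by nlinarith
    -- For `0 ≤ θ ≤ 1/2` one has `1 + θ ≤ (1 + 4θ)(1 - θ)` and `2 ≤ 4 (1 - θ)`; here `θ = L h`.
    have k2 : (b * (1 + L * h) + 2 * (L * B * h ^ 2)) ≤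
        ((1 + 4 * L * h) * b + 4 * L * B * h ^ 2) * (1 - L * h) := by
      have q1 : 0 ≤ b * (L * h * (1 - 2 * (L * h))) :=
        mul_nonneg hb (mul_nonneg hLh0 (by linarith))
      have q2 : 0 ≤ (L * B * h ^ 2) * (1 - 2 * (L * h)) := mul_nonneg h3 (by linarith)
      nlinarith
    exact le_of_mul_le_mul_right (k1.trans k2) (by linarith)
  intro j hj
  have := le_exp_of_le_one_add_mul (a := fun j : ℕ => ‖y j - Y (j * h)‖)
    (b := fun _ => 4 * L * B * h ^ 2) (c := 4 * L * h) (by positivity) (fun _ => by positivity)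
    (norm_nonneg _) step j hj
  have m0 := mem j hj
  have hT : 0 ≤ T := m0.1.trans m0.2
  calc _ ≤ _ := this
    _ = (4 * L * B * h) * (j * h) * Real.exp (4 * L * (j * h)) := by simp [h0]; ring_nf
    _ ≤ (4 * L * B * h) * T * Real.exp (4 * L * T) := by
        gcongr
        · exact m0.2
        · exact m0.2
    _ = _ := by ring

/-- On each cell `a² - G² = (a + G)(a - G)`, whose factors are at most `2K` and `δ`. -/
theorem abs_sum_sub_integral_le {G : ℝ → ℝ} {a : ℕ → ℝ} {h δ K : ℝ} {M : ℕ} (hh : 0 ≤ h)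
    (hG : Continuous G) (hGK : ∀ r ∈ Icc 0 (M * h), |G r| ≤ K) (haK : ∀ j < M, |a j| ≤ K)
    (haG : ∀ j < M, ∀ r ∈ Icc (j * h) ((j + 1 : ℕ) * h), |a j - G r| ≤ δ) :
    |h * ∑ j ∈ Finset.range M, a j ^ 2 - ∫ r in (0 : ℝ)..M * h, G r ^ 2| ≤ 2 * K * δ * (M * h) := by
  have hint : ∀ c d, IntervalIntegrable (fun r => G r ^ 2) volume c d := fun c d =>
    (hG.pow 2).intervalIntegrable c d
  have hs := intervalIntegral.sum_integral_adjacent_intervals (f := fun r => G r ^ 2)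
    (μ := volume) (a := fun k : ℕ => (k : ℝ) * h) (n := M) (fun k _ => hint _ _)
  simp only [Nat.cast_zero, zero_mul] at hs
  rw [← hs, Finset.mul_sum, ← Finset.sum_sub_distrib]
  refine (Finset.abs_sum_le_sum_abs _ _).trans ?_
  calc _ ≤ ∑ j ∈ Finset.range M, 2 * K * δ * h := by
        refine Finset.sum_le_sum fun j hj => ?_
        have hj := Finset.mem_range.1 hj
        have hsub : ((j + 1 : ℕ) : ℝ) * h - j * h = h := by push_cast; ring
        have e : h * a j ^ 2 = ∫ _ in (j * h : ℝ)..(j + 1 : ℕ) * h, a j ^ 2 := by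
          rw [intervalIntegral.integral_const, hsub, smul_eq_mul]
        rw [e, ← intervalIntegral.integral_sub (by simp) (hint _ _)]
        have := intervalIntegral.norm_integral_le_of_norm_le_const (a := (j * h : ℝ))
          (b := (j + 1 : ℕ) * h) (f := fun r => a j ^ 2 - G r ^ 2) (C := 2 * K * δ) ?_
        · rwa [hsub, abs_of_nonneg hh] at this
        · intro r hr
          rw [uIoc_of_le (by linarith)] at hr
          have h1 := haG j hj r ⟨hr.1.le, hr.2⟩
          have h2 := hGK r ⟨le_trans (by positivity) hr.1.le, hr.2.trans (by gcongr; omega)⟩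
          have h3 := haK j hj
          have h4 : |a j + G r| ≤ 2 * K := (abs_add_le _ _).trans (by linarith)
          rw [Real.norm_eq_abs, sq_sub_sq, abs_mul]
          exact mul_le_mul h4 h1 (abs_nonneg _) ((abs_nonneg _).trans h4)
    _ = _ := by simp; ring

theorem exists_backward_recursion {α : Type*} (M : ℕ) (a : α) (G : ℕ → α → α) :
    ∃ s : ℕ → α, s M = a ∧ ∀ k < M, s k = G k (s (k + 1)) := by
  refine ⟨fun k => Nat.rec a (fun i v => G (M - (i + 1)) v) (M - k), by simp, fun k hk => ?_⟩
  obtain ⟨i, rfl⟩ : ∃ i, M = k + i + 1 := ⟨M - k - 1, by omega⟩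
  have h1 : k + i + 1 - k = i + 1 := by omega
  have h2 : k + i + 1 - (k + 1) = i := by omega
  have h3 : k + i + 1 - (i + 1) = k := by omega
  simp only [h1, h2, h3]

theorem norm_le_gronwallBound_of_hasDerivAt {E : Type*} [NormedAddCommGroup E] [NormedSpace ℝ E]
    {f f' : ℝ → E} {δ K ε T : ℝ} (hδ : 0 ≤ δ) (hK : 0 ≤ K) (hε : 0 ≤ ε)
    (hf : ∀ t ∈ Icc 0 T, HasDerivAt f (f' t) t) (h0 : ‖f 0‖ ≤ δ)
    (hb : ∀ t ∈ Icc 0 T, ‖f' t‖ ≤ K * ‖f t‖ + ε) :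
    ∀ t ∈ Icc 0 T, ‖f t‖ ≤ gronwallBound δ K ε T := by
  intro t ht
  refine (norm_le_gronwallBound_of_norm_deriv_right_le
    (fun s hs => (hf s hs).continuousAt.continuousWithinAt)
    (fun s hs => (hf s (Ico_subset_Icc_self hs)).hasDerivWithinAt) h0
    (fun s hs => hb s (Ico_subset_Icc_self hs)) t ht).trans ?_
  exact gronwallBound_mono hδ hε hK (by linarith [ht.2])

/-! ### The field of extremals and its dependence on the end point. -/

/-- The solutions `(X z, U z)`, parametrized by the end point `z` and the time to go, of the
Euler-Lagrange equations of the action, and the solutions `(η z, ν z)` of their linearization. -/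
structure IsExtremalField (F g : ℝ → ℝ) (σ ρ T : ℝ) (X U η ν : ℝ → ℝ → ℝ) : Prop where
  continuous_X : Continuous (Function.uncurry X)
  continuous_U : Continuous (Function.uncurry U)
  continuous_η : Continuous (Function.uncurry η)
  continuous_ν : Continuous (Function.uncurry ν)
  X_zero : ∀ z ∈ Icc (-ρ) ρ, X z 0 = z
  U_zero : ∀ z ∈ Icc (-ρ) ρ, U z 0 = -σ ^ 2 * deriv g z
  η_zero : ∀ z ∈ Icc (-ρ) ρ, η z 0 = 1
  ν_zero : ∀ z ∈ Icc (-ρ) ρ, ν z 0 = -σ ^ 2 * deriv (deriv g) z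
  hasDerivAt_X : ∀ z ∈ Icc (-ρ) ρ, ∀ t ∈ Icc 0 T, HasDerivAt (X z) (-(F (X z t) + U z t)) t
  hasDerivAt_U : ∀ z ∈ Icc (-ρ) ρ, ∀ t ∈ Icc 0 T,
    HasDerivAt (U z) (deriv F (X z t) * U z t) t
  hasDerivAt_η : ∀ z ∈ Icc (-ρ) ρ, ∀ t ∈ Icc 0 T,
    HasDerivAt (η z) (-(deriv F (X z t) * η z t + ν z t)) t
  hasDerivAt_ν : ∀ z ∈ Icc (-ρ) ρ, ∀ t ∈ Icc 0 T,
    HasDerivAt (ν z) (deriv F (X z t) * ν z t + deriv (deriv F) (X z t) * U z t * η z t) t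

/-- The right hand side of a step of the symplectic Euler scheme for the Euler-Lagrange equations
and their linearization, backward in time. -/
noncomputable def stepField (F : ℝ → ℝ) (a b : ℝ × ℝ × ℝ × ℝ) : ℝ × ℝ × ℝ × ℝ :=
  (-(F a.1 + b.2.1), deriv F a.1 * b.2.1, -(deriv F a.1 * a.2.2.1 + b.2.2.2),
    deriv F a.1 * b.2.2.2 + deriv (deriv F) a.1 * b.2.1 * a.2.2.1)

theorem contDiff_deriv_of_contDiff {F : ℝ → ℝ} (hF : ContDiff ℝ ∞ F) : ContDiff ℝ ∞ (deriv F) :=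
  (contDiff_infty_iff_deriv.1 hF).2

theorem contDiff_stepField {F : ℝ → ℝ} (hF : ContDiff ℝ ∞ F) :
    ContDiff ℝ ∞ (Function.uncurry (stepField F)) := by
  have h1 := contDiff_deriv_of_contDiff hF
  have h2 := contDiff_deriv_of_contDiff h1
  unfold stepField Function.uncurry
  fun_prop

theorem exists_bound_derivs {F : ℝ → ℝ} (hF : ContDiff ℝ ∞ F) (hc : HasCompactSupport F) :
    ∃ L, 0 ≤ L ∧ (∀ x, |F x| ≤ L) ∧ (∀ x, |deriv F x| ≤ L) ∧ (∀ x, |deriv (deriv F) x| ≤ L) ∧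
      ∀ x, |deriv (deriv (deriv F)) x| ≤ L := by
  have h1 := contDiff_deriv_of_contDiff hF
  have h2 := contDiff_deriv_of_contDiff h1
  have h3 := contDiff_deriv_of_contDiff h2
  obtain ⟨a, ha⟩ := hc.exists_bound_of_continuous hF.continuous
  obtain ⟨b, hb⟩ := hc.deriv.exists_bound_of_continuous h1.continuous
  obtain ⟨c, hc'⟩ := hc.deriv.deriv.exists_bound_of_continuous h2.continuous
  obtain ⟨d, hd⟩ := hc.deriv.deriv.deriv.exists_bound_of_continuous h3.continuous
  refine ⟨max (max a b) (max c d), ?_, fun x => ?_, fun x => ?_, fun x => ?_, fun x => ?_⟩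
  · exact (norm_nonneg _).trans ((ha 0).trans (by simp))
  · exact (ha x).trans (by simp)
  · exact (hb x).trans (by simp)
  · exact (hc' x).trans (by simp)
  · exact (hd x).trans (by simp)

/-- The field is quadratic or worse in the full phase space, but triangular: the equation of `U` is
linear with bounded coefficient, then `X` has bounded speed, then `(η, ν)` solves a linear system
with bounded coefficients. A bump function with values in `[0, 1]` does not spoil these a priori
bounds, so the flow of the cut-off field never reaches the region where the cutoff acts. -/
theorem exists_isExtremalField {F g : ℝ → ℝ} (hF : ContDiff ℝ ∞ F) (hFc : HasCompactSupport F)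
    (hg : ContDiff ℝ ∞ g) (σ : ℝ) {ρ T : ℝ} (hρ : 0 ≤ ρ) (hT : 0 < T) :
    ∃ X U η ν, IsExtremalField F g σ ρ T X U η ν := by
  obtain ⟨L, hL, hF0, hF1, hF2, -⟩ := exists_bound_derivs hF hFc
  have hg1 := contDiff_deriv_of_contDiff hg
  have hg2 := contDiff_deriv_of_contDiff hg1
  set Y₀ : ℝ → ℝ × ℝ × ℝ × ℝ := fun z => (z, -σ ^ 2 * deriv g z, 1, -σ ^ 2 * deriv (deriv g) z)
  have hY₀ : Continuous Y₀ := by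
    have := hg1.continuous
    have := hg2.continuous
    fun_prop
  obtain ⟨r, hr⟩ := (isCompact_Icc (a := -ρ) (b := ρ)).exists_bound_of_continuousOn
    hY₀.continuousOn
  have hr0 : 0 ≤ r := (norm_nonneg _).trans (hr 0 (by simp [hρ]))
  -- Bounds for `U`, `X` and `(η, ν)` respectively, valid for any cutoff bounded by 1; they fix the
  -- radius `P` before the cutoff is chosen.
  set P₁ := gronwallBound r L 0 T
  have hP₁ : 0 ≤ P₁ := by simp only [P₁, gronwallBound_ε0]; positivity
  set P₂ := gronwallBound r 0 (L + P₁) T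
  set P₃ := gronwallBound r (L + 1 + L * P₁) 0 T
  set P := max (max P₁ P₂) P₃ + 1
  have hP : 0 < P := by
    have : P₁ ≤ max (max P₁ P₂) P₃ := by simp
    simp only [P]; linarith
  let χ : ContDiffBump (0 : ℝ × ℝ × ℝ × ℝ) := ⟨P, P + 1, hP, by linarith⟩
  have hV : ContDiff ℝ ∞ fun y => stepField F y y :=
    (contDiff_stepField hF).comp (contDiff_id.prodMk contDiff_id)
  obtain ⟨α, hα, hα'⟩ := exists_flow_of_hasCompactSupport
    (w := fun y => χ y • stepField F y y) ((χ.contDiff.smul hV).of_le (by simp))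
    χ.hasCompactSupport.smul_right hr0 hT
  have hχ : ∀ y, |χ y| ≤ 1 := fun y => by rw [abs_of_nonneg χ.nonneg]; exact χ.le_one
  have hball : ∀ z ∈ Icc (-ρ) ρ, Y₀ z ∈ Metric.closedBall (0 : ℝ × ℝ × ℝ × ℝ) r := fun z hz => by
    simpa using hr z hz
  have main : ∀ z ∈ Icc (-ρ) ρ, ∀ t ∈ Icc 0 T,
      HasDerivAt (α (Y₀ z)) (stepField F (α (Y₀ z) t) (α (Y₀ z) t)) t := by
    intro z hz
    obtain ⟨h0, hd⟩ := hα' (Y₀ z) (hball z hz)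
    set Y := α (Y₀ z)
    have n0 : ‖Y 0‖ ≤ r := by rw [h0]; exact hr z hz
    have d1 : ∀ t ∈ Icc 0 T, HasDerivAt (fun t => (Y t).1)
        (χ (Y t) * -(F (Y t).1 + (Y t).2.1)) t := fun t ht => (hd t ht).fst
    have d2 : ∀ t ∈ Icc 0 T, HasDerivAt (fun t => (Y t).2.1)
        (χ (Y t) * (deriv F (Y t).1 * (Y t).2.1)) t := fun t ht => (hd t ht).snd.fst
    have d3 : ∀ t ∈ Icc 0 T, HasDerivAt (fun t => (Y t).2.2)
        (χ (Y t) • (-(deriv F (Y t).1 * (Y t).2.2.1 + (Y t).2.2.2),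
          deriv F (Y t).1 * (Y t).2.2.2 + deriv (deriv F) (Y t).1 * (Y t).2.1 * (Y t).2.2.1)) t :=
      fun t ht => (hd t ht).snd.snd
    have b2 : ∀ t ∈ Icc 0 T, ‖(Y t).2.1‖ ≤ P₁ := by
      refine norm_le_gronwallBound_of_hasDerivAt hr0 hL le_rfl d2
        ((norm_fst_le _).trans ((norm_snd_le _).trans n0)) fun t _ => ?_
      rw [norm_mul, norm_mul, add_zero]
      calc _ ≤ 1 * (L * ‖(Y t).2.1‖) := by
            gcongr
            · exact hχ _
            · exact hF1 _
        _ = _ := one_mul _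
    have b1 : ∀ t ∈ Icc 0 T, ‖(Y t).1‖ ≤ P₂ := by
      refine norm_le_gronwallBound_of_hasDerivAt hr0 le_rfl (by positivity) d1
        ((norm_fst_le _).trans n0) fun t ht => ?_
      rw [norm_mul, norm_neg, zero_mul, zero_add]
      calc _ ≤ 1 * (L + P₁) := by
            gcongr
            · exact hχ _
            · exact (norm_add_le _ _).trans (add_le_add (hF0 _) (b2 t ht))
        _ = _ := one_mul _
    have b3 : ∀ t ∈ Icc 0 T, ‖(Y t).2.2‖ ≤ P₃ := by
      refine norm_le_gronwallBound_of_hasDerivAt hr0 (by positivity) le_rfl d3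
        ((norm_snd_le _).trans ((norm_snd_le _).trans n0)) fun t ht => ?_
      rw [norm_smul, add_zero]
      have e1 : ‖(Y t).2.2.1‖ ≤ ‖(Y t).2.2‖ := norm_fst_le _
      have e2 : ‖(Y t).2.2.2‖ ≤ ‖(Y t).2.2‖ := norm_snd_le _
      have hn : 0 ≤ ‖(Y t).2.2‖ := norm_nonneg _
      have f1 : ‖deriv F (Y t).1‖ ≤ L := hF1 _
      have f2 : ‖deriv (deriv F) (Y t).1‖ ≤ L := hF2 _
      have f3 := b2 t ht
      have g1 : ‖deriv F (Y t).1 * (Y t).2.2.1‖ ≤ L * ‖(Y t).2.2‖ := by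
        rw [norm_mul]; gcongr
      have g2 : ‖deriv F (Y t).1 * (Y t).2.2.2‖ ≤ L * ‖(Y t).2.2‖ := by
        rw [norm_mul]; gcongr
      have g3 : ‖deriv (deriv F) (Y t).1 * (Y t).2.1 * (Y t).2.2.1‖ ≤ L * P₁ * ‖(Y t).2.2‖ := by
        rw [norm_mul, norm_mul]; gcongr
      have hLP : 0 ≤ L * P₁ * ‖(Y t).2.2‖ := by positivity
      calc _ ≤ 1 * ((L + 1 + L * P₁) * ‖(Y t).2.2‖) := by
            gcongr
            · exact hχ _
            · rw [Prod.norm_def]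
              refine max_le ?_ ?_
              · rw [norm_neg]
                refine (norm_add_le _ _).trans ?_
                nlinarith
              · refine (norm_add_le _ _).trans ?_
                nlinarith
        _ = _ := one_mul _
    intro t ht
    have hin : Y t ∈ Metric.closedBall (0 : ℝ × ℝ × ℝ × ℝ) P := by
      rw [mem_closedBall_zero_iff, Prod.norm_def, Prod.norm_def]
      have c1 := b1 t ht
      have c2 := b2 t ht
      have c3 := b3 t ht
      refine max_le ?_ (max_le ?_ ?_)
      · exact c1.trans (by simp only [P]; linarith [le_max_left (max P₁ P₂) P₃, le_max_right P₁ P₂])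
      · exact c2.trans (by simp only [P]; linarith [le_max_left (max P₁ P₂) P₃, le_max_left P₁ P₂])
      · exact c3.trans (by simp only [P]; linarith [le_max_right (max P₁ P₂) P₃])
    have h1 : χ (Y t) = 1 := χ.one_of_mem_closedBall hin
    have := hd t ht
    rw [h1, one_smul] at this
    exact this
  -- Clamping both parameters makes the family continuous on the whole plane without changing it
  -- where the equations are required.
  set cz : ℝ → ℝ := fun z => max (-ρ) (min z ρ)
  set ct : ℝ → ℝ := fun t => max (-1) (min t (T + 1))
  have hcz : ∀ z, cz z ∈ Icc (-ρ) ρ := fun z => ⟨le_max_left _ _, max_le (by linarith) (by simp)⟩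
  have hct : ∀ t, ct t ∈ Icc (-1) (T + 1) := fun t =>
    ⟨le_max_left _ _, max_le (by linarith) (by simp)⟩
  have hcz' : ∀ z ∈ Icc (-ρ) ρ, cz z = z := fun z hz => by
    simp only [cz]; rw [min_eq_left hz.2, max_eq_right hz.1]
  have hct' : ∀ t ∈ Icc (-1) (T + 1), ct t = t := fun t hz => by
    simp only [ct]; rw [min_eq_left hz.2, max_eq_right hz.1]
  have hcont : Continuous fun p : ℝ × ℝ => α (Y₀ (cz p.1)) (ct p.2) := by
    have : Continuous fun p : ℝ × ℝ => (Y₀ (cz p.1), ct p.2) := by fun_prop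
    exact hα.comp_continuous this fun p => ⟨hball _ (hcz _), hct _⟩
  have h0 : ∀ z ∈ Icc (-ρ) ρ, α (Y₀ (cz z)) (ct 0) = Y₀ z := fun z hz => by
    rw [hcz' z hz, hct' 0 (by constructor <;> linarith)]
    exact (hα' _ (hball z hz)).1
  have hd : ∀ z ∈ Icc (-ρ) ρ, ∀ t ∈ Icc 0 T, HasDerivAt (fun t => α (Y₀ (cz z)) (ct t))
      (stepField F (α (Y₀ (cz z)) (ct t)) (α (Y₀ (cz z)) (ct t))) t := fun z hz t ht => by
    rw [hct' t ⟨by linarith [ht.1], by linarith [ht.2]⟩]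
    simp only [hcz' z hz]
    refine (main z hz t ht).congr_of_eventuallyEq ?_
    filter_upwards [Icc_mem_nhds (show -1 < t by linarith [ht.1])
      (show t < T + 1 by linarith [ht.2])] with s hs
    rw [hct' s hs]
  refine ⟨fun z t => (α (Y₀ (cz z)) (ct t)).1, fun z t => (α (Y₀ (cz z)) (ct t)).2.1,
    fun z t => (α (Y₀ (cz z)) (ct t)).2.2.1, fun z t => (α (Y₀ (cz z)) (ct t)).2.2.2,
    hcont.fst, hcont.snd.fst, hcont.snd.snd.fst, hcont.snd.snd.snd,
    fun z hz => ?_, fun z hz => ?_, fun z hz => ?_, fun z hz => ?_,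
    fun z hz t ht => (hd z hz t ht).fst, fun z hz t ht => (hd z hz t ht).snd.fst,
    fun z hz t ht => (hd z hz t ht).snd.snd.fst, fun z hz t ht => (hd z hz t ht).snd.snd.snd⟩ <;>
  simp only [h0 z hz, Y₀]

theorem hasDerivAt_deriv_of_contDiff {F : ℝ → ℝ} (hF : ContDiff ℝ ∞ F) (x : ℝ) :
    HasDerivAt F (deriv F x) x :=
  ((hF.differentiable (by simp)) x).hasDerivAt

theorem abs_sub_le_of_abs_deriv_le {F : ℝ → ℝ} (hF : ContDiff ℝ ∞ F) {L : ℝ} {s : Set ℝ}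
    (hs : Convex ℝ s) (hL : ∀ x ∈ s, |deriv F x| ≤ L) {x y : ℝ} (hx : x ∈ s) (hy : y ∈ s) :
    |F x - F y| ≤ L * |x - y| :=
  hs.norm_image_sub_le_of_norm_hasDerivWithin_le
    (fun z _ => (hasDerivAt_deriv_of_contDiff hF z).hasDerivWithinAt) hL hy hx

namespace IsExtremalField

variable {F g : ℝ → ℝ} {σ ρ T : ℝ} {X U η ν : ℝ → ℝ → ℝ}

theorem exists_bound (H : IsExtremalField F g σ ρ T X U η ν) :
    ∃ P, 0 ≤ P ∧ ∀ z ∈ Icc (-ρ) ρ, ∀ t ∈ Icc 0 T,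
      |X z t| ≤ P ∧ |U z t| ≤ P ∧ |η z t| ≤ P ∧ |ν z t| ≤ P := by
  have hK : IsCompact (Icc (-ρ) ρ ×ˢ Icc 0 T) := isCompact_Icc.prod isCompact_Icc
  obtain ⟨a, ha⟩ := hK.exists_bound_of_continuousOn H.continuous_X.continuousOn
  obtain ⟨b, hb⟩ := hK.exists_bound_of_continuousOn H.continuous_U.continuousOn
  obtain ⟨c, hc⟩ := hK.exists_bound_of_continuousOn H.continuous_η.continuousOn
  obtain ⟨d, hd⟩ := hK.exists_bound_of_continuousOn H.continuous_ν.continuousOn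
  refine ⟨max 0 (max (max a b) (max c d)), le_max_left _ _, fun z hz t ht => ?_⟩
  have m : (z, t) ∈ Icc (-ρ) ρ ×ˢ Icc 0 T := ⟨hz, ht⟩
  exact ⟨(ha _ m).trans (by simp), (hb _ m).trans (by simp), (hc _ m).trans (by simp),
    (hd _ m).trans (by simp)⟩

theorem exists_lipschitz_time (H : IsExtremalField F g σ ρ T X U η ν) (hF : ContDiff ℝ ∞ F)
    (hFc : HasCompactSupport F) :
    ∃ C, 0 ≤ C ∧ ∀ z ∈ Icc (-ρ) ρ, ∀ t ∈ Icc 0 T, ∀ s ∈ Icc 0 T,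
      |X z t - X z s| ≤ C * |t - s| ∧ |U z t - U z s| ≤ C * |t - s| := by
  obtain ⟨L, hL, hF0, hF1, -, -⟩ := exists_bound_derivs hF hFc
  obtain ⟨P, hP, hb⟩ := H.exists_bound
  refine ⟨L + P + L * P, by positivity, fun z hz t ht s hs => ⟨?_, ?_⟩⟩
  · refine (convex_Icc 0 T).norm_image_sub_le_of_norm_hasDerivWithin_le
      (fun r hr => (H.hasDerivAt_X z hz r hr).hasDerivWithinAt) (fun r hr => ?_) hs ht
    rw [norm_neg]
    refine (norm_add_le _ _).trans ?_
    have := hF0 (X z r)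
    have := (hb z hz r hr).2.1
    have : 0 ≤ L * P := by positivity
    simp only [Real.norm_eq_abs]; linarith
  · refine (convex_Icc 0 T).norm_image_sub_le_of_norm_hasDerivWithin_le
      (fun r hr => (H.hasDerivAt_U z hz r hr).hasDerivWithinAt) (fun r hr => ?_) hs ht
    rw [norm_mul]
    have : ‖deriv F (X z r)‖ * ‖U z r‖ ≤ L * P := by
      gcongr
      · exact hF1 _
      · exact (hb z hz r hr).2.1
    linarith

/-- Gronwall for the difference of two extremals. Their initial controls differ by at most a
constant times `|z' - z|`, since `g''` is bounded on `[-ρ, ρ]`. -/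
theorem exists_lipschitz (H : IsExtremalField F g σ ρ T X U η ν) (hF : ContDiff ℝ ∞ F)
    (hFc : HasCompactSupport F) (hg : ContDiff ℝ ∞ g) :
    ∃ C, 0 ≤ C ∧ ∀ z ∈ Icc (-ρ) ρ, ∀ z' ∈ Icc (-ρ) ρ, ∀ t ∈ Icc 0 T,
      |X z' t - X z t| ≤ C * |z' - z| ∧ |U z' t - U z t| ≤ C * |z' - z| := by
  obtain ⟨L, hL, hF0, hF1, hF2, -⟩ := exists_bound_derivs hF hFc
  obtain ⟨P, hP, hb⟩ := H.exists_bound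
  have hg1 := contDiff_deriv_of_contDiff hg
  have hg2 := contDiff_deriv_of_contDiff hg1
  obtain ⟨G, hG⟩ := (isCompact_Icc (a := -ρ) (b := ρ)).exists_bound_of_continuousOn
    hg2.continuous.continuousOn
  set K := L + 1 + L * P
  have hK : 0 ≤ K := by positivity
  refine ⟨(1 + σ ^ 2 * |G|) * Real.exp (K * T), by positivity, fun z hz z' hz' t ht => ?_⟩
  have key := norm_le_gronwallBound_of_hasDerivAt
    (f := fun t => (X z' t - X z t, U z' t - U z t))
    (f' := fun t => (-(F (X z' t) + U z' t) - -(F (X z t) + U z t),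
      deriv F (X z' t) * U z' t - deriv F (X z t) * U z t))
    (δ := (1 + σ ^ 2 * |G|) * |z' - z|) (K := K) (ε := 0) (T := T) (by positivity) hK le_rfl
    (fun t ht => ((H.hasDerivAt_X z' hz' t ht).sub (H.hasDerivAt_X z hz t ht)).prodMk
      ((H.hasDerivAt_U z' hz' t ht).sub (H.hasDerivAt_U z hz t ht)))
    (by
      simp only [H.X_zero z hz, H.X_zero z' hz', H.U_zero z hz, H.U_zero z' hz']
      rw [Prod.norm_def]
      refine max_le ?_ ?_
      · have : 0 ≤ σ ^ 2 * |G| * |z' - z| := by positivity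
        simp only [Real.norm_eq_abs]; linarith
      · have := abs_sub_le_of_abs_deriv_le hg1 (convex_Icc (-ρ) ρ)
          (fun x hx => (hG x hx).trans (le_abs_self G)) hz' hz
        rw [← mul_sub, norm_mul, norm_neg, Real.norm_eq_abs, Real.norm_eq_abs,
          abs_of_nonneg (sq_nonneg σ)]
        have h3 : σ ^ 2 * |deriv g z' - deriv g z| ≤ σ ^ 2 * (|G| * |z' - z|) := by gcongr
        have : 0 ≤ |z' - z| := abs_nonneg _
        linarith)
    (fun t ht => by
      have e1 : |X z' t - X z t| ≤ ‖(X z' t - X z t, U z' t - U z t)‖ :=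
        norm_fst_le (X z' t - X z t, U z' t - U z t)
      have e2 : |U z' t - U z t| ≤ ‖(X z' t - X z t, U z' t - U z t)‖ :=
        norm_snd_le (X z' t - X z t, U z' t - U z t)
      set m := ‖(X z' t - X z t, U z' t - U z t)‖
      have hm : 0 ≤ m := norm_nonneg _
      have a1 := abs_sub_le_of_abs_deriv_le hF convex_univ (fun x _ => hF1 x)
        (mem_univ (X z' t)) (mem_univ (X z t))
      have a2 := abs_sub_le_of_abs_deriv_le (contDiff_deriv_of_contDiff hF) convex_univ
        (fun x _ => hF2 x) (mem_univ (X z' t)) (mem_univ (X z t))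
      have b1 : |F (X z' t) - F (X z t)| ≤ L * m := a1.trans (by gcongr)
      have b2 : |deriv F (X z' t) - deriv F (X z t)| ≤ L * m := a2.trans (by gcongr)
      have b3 := (hb z hz t ht).2.1
      have hLP : 0 ≤ L * P * m := by positivity
      have hLm : 0 ≤ L * m := by positivity
      rw [Prod.norm_def, add_zero]
      refine max_le ?_ ?_
      · calc ‖-(F (X z' t) + U z' t) - -(F (X z t) + U z t)‖
            = |(F (X z' t) - F (X z t)) + (U z' t - U z t)| := by
              rw [← norm_neg, Real.norm_eq_abs]; congr 1; ring
          _ ≤ L * m + m := (abs_add_le _ _).trans (add_le_add b1 e2)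
          _ ≤ K * m := by simp only [K]; nlinarith
      · calc ‖deriv F (X z' t) * U z' t - deriv F (X z t) * U z t‖
            = |deriv F (X z' t) * (U z' t - U z t)
                + (deriv F (X z' t) - deriv F (X z t)) * U z t| := by
              rw [Real.norm_eq_abs]; congr 1; ring
          _ ≤ L * m + L * m * P := by
              refine (abs_add_le _ _).trans ?_
              rw [abs_mul, abs_mul]
              gcongr
              exact hF1 _
          _ ≤ K * m := by simp only [K]; nlinarith) t ht
  rw [gronwallBound_ε0] at key
  have e : (1 + σ ^ 2 * |G|) * Real.exp (K * T) * |z' - z| =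
    (1 + σ ^ 2 * |G|) * |z' - z| * Real.exp (K * T) := by ring
  rw [e]
  exact ⟨(norm_fst_le _).trans key, (norm_snd_le _).trans key⟩

/-- This identifies `η` as the derivative of `X` in the end point, with a uniform quadratic
remainder. The remainders of `X` and `U` solve the linearized system up to a forcing that is
quadratic in `z' - z`, by Taylor's formula and the Lipschitz bound, so Gronwall applies directly. -/
theorem exists_abs_sub_le_sq (H : IsExtremalField F g σ ρ T X U η ν) (hF : ContDiff ℝ ∞ F)
    (hFc : HasCompactSupport F) (hg : ContDiff ℝ ∞ g) :
    ∃ C, 0 ≤ C ∧ ∀ z ∈ Icc (-ρ) ρ, ∀ z' ∈ Icc (-ρ) ρ, ∀ t ∈ Icc 0 T,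
      |X z' t - X z t - η z t * (z' - z)| ≤ C * (z' - z) ^ 2 := by
  obtain ⟨L, hL, hF0, hF1, hF2, hF3⟩ := exists_bound_derivs hF hFc
  obtain ⟨P, hP, hb⟩ := H.exists_bound
  obtain ⟨A, hA, hlip⟩ := H.exists_lipschitz hF hFc hg
  have hF' := contDiff_deriv_of_contDiff hF
  have hF'' := contDiff_deriv_of_contDiff hF'
  have hg1 := contDiff_deriv_of_contDiff hg
  have hg2 := contDiff_deriv_of_contDiff hg1
  have hg3 := contDiff_deriv_of_contDiff hg2
  obtain ⟨G, hG⟩ := (isCompact_Icc (a := -ρ) (b := ρ)).exists_bound_of_continuousOn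
    hg3.continuous.continuousOn
  set K := L + 1 + L * P
  have hK : 0 ≤ K := by positivity
  set C' := L * A ^ 2 + L * A ^ 2 * P with hC'
  refine ⟨|gronwallBound (σ ^ 2 * |G|) K C' T|, abs_nonneg _, fun z hz z' hz' t ht => ?_⟩
  set δ := z' - z with hδ
  have key := norm_le_gronwallBound_of_hasDerivAt
    (f := fun t => (X z' t - X z t - η z t * δ, U z' t - U z t - ν z t * δ))
    (f' := fun t => (-(F (X z' t) + U z' t) - -(F (X z t) + U z t)
        - -(deriv F (X z t) * η z t + ν z t) * δ,
      deriv F (X z' t) * U z' t - deriv F (X z t) * U z t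
        - (deriv F (X z t) * ν z t + deriv (deriv F) (X z t) * U z t * η z t) * δ))
    (δ := (σ ^ 2 * |G|) * δ ^ 2) (K := K) (ε := C' * δ ^ 2) (T := T) (by positivity) hK
    (by positivity)
    (fun t ht => (((H.hasDerivAt_X z' hz' t ht).sub (H.hasDerivAt_X z hz t ht)).sub
        ((H.hasDerivAt_η z hz t ht).mul_const δ)).prodMk
      (((H.hasDerivAt_U z' hz' t ht).sub (H.hasDerivAt_U z hz t ht)).sub
        ((H.hasDerivAt_ν z hz t ht).mul_const δ)))
    (by
      simp only [H.X_zero z hz, H.X_zero z' hz', H.U_zero z hz, H.U_zero z' hz', H.η_zero z hz,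
        H.ν_zero z hz]
      rw [Prod.norm_def]
      refine max_le ?_ ?_
      · have : 0 ≤ σ ^ 2 * |G| * δ ^ 2 := by positivity
        simpa [hδ] using this
      · have := abs_sub_sub_mul_le (convex_Icc (-ρ) ρ) (hasDerivAt_deriv_of_contDiff hg1)
          (hasDerivAt_deriv_of_contDiff hg2) (fun x hx => (hG x hx).trans (le_abs_self G)) hz hz'
        calc _ = |-σ ^ 2 * (deriv g z' - deriv g z - deriv (deriv g) z * (z' - z))| := by
              rw [Real.norm_eq_abs]; congr 1; simp only [hδ]; ring
          _ = σ ^ 2 * |deriv g z' - deriv g z - deriv (deriv g) z * (z' - z)| := by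
              rw [abs_mul, abs_neg, abs_of_nonneg (sq_nonneg σ)]
          _ ≤ σ ^ 2 * (|G| * (z' - z) ^ 2) := by gcongr
          _ = _ := by ring)
    (fun t ht => by
      have e1 : |X z' t - X z t - η z t * δ| ≤
        ‖(X z' t - X z t - η z t * δ, U z' t - U z t - ν z t * δ)‖ :=
        norm_fst_le (X z' t - X z t - η z t * δ, U z' t - U z t - ν z t * δ)
      have e2 : |U z' t - U z t - ν z t * δ| ≤
        ‖(X z' t - X z t - η z t * δ, U z' t - U z t - ν z t * δ)‖ :=
        norm_snd_le (X z' t - X z t - η z t * δ, U z' t - U z t - ν z t * δ)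
      set m := ‖(X z' t - X z t - η z t * δ, U z' t - U z t - ν z t * δ)‖
      have hm : 0 ≤ m := norm_nonneg _
      obtain ⟨l1, l2⟩ := hlip z hz z' hz' t ht
      have hsq : (X z' t - X z t) ^ 2 ≤ A ^ 2 * δ ^ 2 := by
        rw [← mul_pow]
        exact sq_le_sq.2 (by rwa [abs_mul, abs_of_nonneg hA])
      have a1 := abs_sub_sub_mul_le convex_univ (hasDerivAt_deriv_of_contDiff hF)
        (hasDerivAt_deriv_of_contDiff hF') (fun x _ => hF2 x) (mem_univ (X z t))
        (mem_univ (X z' t))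
      have a2 := abs_sub_sub_mul_le convex_univ (hasDerivAt_deriv_of_contDiff hF')
        (hasDerivAt_deriv_of_contDiff hF'') (fun x _ => hF3 x) (mem_univ (X z t))
        (mem_univ (X z' t))
      have a3 := abs_sub_le_of_abs_deriv_le hF' convex_univ
        (fun x _ => hF2 x) (mem_univ (X z' t)) (mem_univ (X z t))
      have b1 : |F (X z' t) - F (X z t) - deriv F (X z t) * (X z' t - X z t)|
        ≤ L * (A ^ 2 * δ ^ 2) := a1.trans (by gcongr)
      have b2 : |deriv F (X z' t) - deriv F (X z t) - deriv (deriv F) (X z t) * (X z' t - X z t)|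
        ≤ L * (A ^ 2 * δ ^ 2) := a2.trans (by gcongr)
      have b4 : |(deriv F (X z' t) - deriv F (X z t)) * (U z' t - U z t)|
          ≤ L * (A ^ 2 * δ ^ 2) := by
        rw [abs_mul]
        calc _ ≤ (L * (A * |δ|)) * (A * |δ|) := by
              gcongr
              exact a3.trans (by gcongr)
          _ = _ := by rw [← sq_abs δ]; ring
      have b3 := (hb z hz t ht).2.1
      have hLP : 0 ≤ L * P * m := by positivity
      have hLm : 0 ≤ L * m := by positivity
      have hLA : 0 ≤ L * A ^ 2 * P * δ ^ 2 := by positivity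
      have c1 : |deriv F (X z t) * (X z' t - X z t - η z t * δ)| ≤ L * m := by
        rw [abs_mul]; gcongr; exact hF1 _
      have c2 : |deriv F (X z t) * (U z' t - U z t - ν z t * δ)| ≤ L * m := by
        rw [abs_mul]; gcongr; exact hF1 _
      have c3 : |deriv (deriv F) (X z t) * U z t * (X z' t - X z t - η z t * δ)| ≤ L * P * m := by
        rw [abs_mul, abs_mul]; gcongr; exact hF2 _
      have c4 : |U z t * (deriv F (X z' t) - deriv F (X z t)
          - deriv (deriv F) (X z t) * (X z' t - X z t))| ≤ P * (L * (A ^ 2 * δ ^ 2)) := by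
        rw [abs_mul]; gcongr
      rw [Prod.norm_def]
      refine max_le ?_ ?_
      · calc _ = |(F (X z' t) - F (X z t) - deriv F (X z t) * (X z' t - X z t))
                + deriv F (X z t) * (X z' t - X z t - η z t * δ)
                + (U z' t - U z t - ν z t * δ)| := by
              rw [← norm_neg, Real.norm_eq_abs]; congr 1; ring
          _ ≤ L * (A ^ 2 * δ ^ 2) + L * m + m := (abs_add_three _ _ _).trans (by gcongr)
          _ ≤ K * m + C' * δ ^ 2 := by simp only [K, hC']; nlinarith
      -- Expansion of the product `F'(X) U`: a cross term and a Taylor remainder, both quadratic,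
      -- plus the terms linear in the remainders themselves.
      · calc _ = |(deriv F (X z' t) - deriv F (X z t)) * (U z' t - U z t)
                + (U z t * (deriv F (X z' t) - deriv F (X z t)
                  - deriv (deriv F) (X z t) * (X z' t - X z t)))
                + (deriv F (X z t) * (U z' t - U z t - ν z t * δ)
                + deriv (deriv F) (X z t) * U z t * (X z' t - X z t - η z t * δ))| := by
              rw [Real.norm_eq_abs]; congr 1; ring
          _ ≤ L * (A ^ 2 * δ ^ 2) + P * (L * (A ^ 2 * δ ^ 2)) + (L * m + L * P * m) :=
              (abs_add_three _ _ _).trans (by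
                gcongr
                exact (abs_add_le _ _).trans (by gcongr))
          _ ≤ K * m + C' * δ ^ 2 := by simp only [K, hC']; nlinarith) t ht
  -- The Gronwall bound is linear in initial size and forcing jointly, so `δ²` factors out.
  have hlin : gronwallBound (σ ^ 2 * |G| * δ ^ 2) K (C' * δ ^ 2) T =
      gronwallBound (σ ^ 2 * |G|) K C' T * δ ^ 2 := by
    unfold gronwallBound
    split_ifs <;> ring
  rw [hlin] at key
  exact (norm_fst_le _).trans (key.trans (by gcongr; exact le_abs_self _))

end IsExtremalField

/-! ### Discrete extremals and their convergence. -/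

/-- The solution `(q, p)` of the discrete Euler-Lagrange equations on `M` steps of size `h`, and
the solution `(e, n)` of their linearization, normalized at the end point. -/
structure IsDiscreteExtremal (F g : ℝ → ℝ) (σ h : ℝ) (M : ℕ) (q p e n : ℕ → ℝ) : Prop where
  p_last : p M = -σ ^ 2 * deriv g (q M)
  e_last : e M = 1
  n_last : n M = -σ ^ 2 * deriv (deriv g) (q M)
  q_step : ∀ k < M, q (k + 1) = q k + h * (F (q k) + p (k + 1))
  p_step : ∀ k < M, p k = p (k + 1) * (1 + h * deriv F (q k))
  e_step : ∀ k < M, e (k + 1) = e k * (1 + h * deriv F (q k)) + h * n (k + 1)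
  n_step : ∀ k < M, n k = n (k + 1) * (1 + h * deriv F (q k)) +
    h * (deriv (deriv F) (q k) * p (k + 1) * e k)

/-- The same triangular structure as in continuous time, run backward from the end point: first `p`,
whose recursion is linear with factor `1 + h F'`, then `(e, n)`. These bounds put the scheme into a
fixed ball, where the step field is Lipschitz. -/
theorem IsDiscreteExtremal.exists_bound {F g : ℝ → ℝ} (hF : ContDiff ℝ ∞ F)
    (hFc : HasCompactSupport F) (hg : ContDiff ℝ ∞ g) (σ : ℝ) {ρ : ℝ} (hρ : 0 ≤ ρ) (T : ℝ) :
    ∃ P h₀, 0 ≤ P ∧ 0 < h₀ ∧ ∀ h, 0 < h → h ≤ h₀ → ∀ M : ℕ, M * h ≤ T → ∀ q p e n,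
      IsDiscreteExtremal F g σ h M q p e n → (∀ k ≤ M, |q k| ≤ ρ) →
      ∀ k ≤ M, |p k| ≤ P ∧ |e k| ≤ P ∧ |n k| ≤ P := by
  obtain ⟨L, hL, hF0, hF1, hF2, -⟩ := exists_bound_derivs hF hFc
  have hg1 := contDiff_deriv_of_contDiff hg
  have hg2 := contDiff_deriv_of_contDiff hg1
  obtain ⟨G, hG⟩ := (isCompact_Icc (a := -ρ) (b := ρ)).exists_bound_of_continuousOn
    hg1.continuous.continuousOn
  obtain ⟨G', hG'⟩ := (isCompact_Icc (a := -ρ) (b := ρ)).exists_bound_of_continuousOn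
    hg2.continuous.continuousOn
  have hG0 : 0 ≤ G := (norm_nonneg _).trans (hG 0 (by simp [hρ]))
  have hG0' : 0 ≤ G' := (norm_nonneg _).trans (hG' 0 (by simp [hρ]))
  set P₁ := σ ^ 2 * G * Real.exp (L * T)
  have hP₁ : 0 ≤ P₁ := by positivity
  set K := L + 1 + L * P₁ with hKdef
  have hK : 1 ≤ K := by
    have : 0 ≤ L * P₁ := by positivity
    linarith
  set P₂ := (1 + σ ^ 2 * G') * Real.exp (4 * K * T)
  have hP₂ : 0 ≤ P₂ := by positivity
  refine ⟨P₁ + P₂, 1 / (2 * K), by positivity, by positivity, ?_⟩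
  intro h hh hh₀ M hM q p e n H hq
  have hhK : h * K ≤ 1 / 2 := by
    calc h * K ≤ 1 / (2 * K) * K := by gcongr
      _ = 1 / 2 := by field_simp
  have hqM : q M ∈ Icc (-ρ) ρ := abs_le.1 (hq M le_rfl)
  have bp : ∀ j ≤ M, |p (M - j)| ≤ P₁ := by
    intro j hj
    have := le_exp_of_le_one_add_mul (a := fun j => |p (M - j)|) (b := fun _ => 0) (c := h * L)
      (M := M) (by positivity) (fun _ => le_rfl) (abs_nonneg _) (fun j hj => by
        have := H.p_step (M - (j + 1)) (by omega)
        rw [show M - (j + 1) + 1 = M - j by omega] at this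
        simp only [this, abs_mul, add_zero]
        rw [mul_comm]
        gcongr
        refine (abs_add_le _ _).trans ?_
        rw [abs_one, abs_mul, abs_of_pos hh]
        gcongr
        exact hF1 _) j hj
    refine this.trans ?_
    simp only [Nat.sub_zero, Finset.sum_const_zero, add_zero, H.p_last, P₁]
    rw [abs_mul, abs_neg, abs_of_nonneg (sq_nonneg σ)]
    have e1 : h * L * j ≤ L * T := by
      have : (j : ℝ) * h ≤ T := le_trans (by gcongr) hM
      nlinarith
    gcongr
    exact hG _ hqM
  have step : ∀ j < M, max |e (M - (j + 1))| |n (M - (j + 1))| ≤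
      (1 + 4 * (h * K)) * max |e (M - j)| |n (M - j)| + 0 := by
    intro j hj
    have s1 := H.e_step (M - (j + 1)) (by omega)
    have s2 := H.n_step (M - (j + 1)) (by omega)
    have hp := bp j (by omega)
    rw [show M - (j + 1) + 1 = M - j by omega] at s1 s2
    set k := M - (j + 1)
    set m' := max |e k| |n k|
    set m := max |e (M - j)| |n (M - j)|
    have hm : 0 ≤ m := (abs_nonneg _).trans (le_max_left _ _)
    have hm' : 0 ≤ m' := (abs_nonneg _).trans (le_max_left _ _)
    have f1 : |deriv F (q k)| ≤ L := hF1 _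
    have f2 : |deriv (deriv F) (q k)| ≤ L := hF2 _
    have i1 : |e (M - j)| ≤ m := le_max_left _ _
    have i2 : |n (M - j)| ≤ m := le_max_right _ _
    have i3 : |e k| ≤ m' := le_max_left _ _
    have hLP : 0 ≤ L * P₁ := by positivity
    -- The unknown `e k` occurs on both sides of a backward step; its contribution is absorbed since
    -- `h K ≤ 1/2`.
    have key : m' ≤ (1 + h * K) * m + h * K * m' := by
      refine max_le ?_ ?_
      · have : e k = e (M - j) - h * n (M - j) - h * (deriv F (q k) * e k) := by rw [s1]; ring
        calc |e k| ≤ m + h * m + h * (L * m') := by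
              rw [this]
              refine (abs_sub _ _).trans (add_le_add ((abs_sub _ _).trans (add_le_add i1 ?_)) ?_)
              · rw [abs_mul, abs_of_pos hh]; gcongr
              · rw [abs_mul, abs_mul, abs_of_pos hh]; gcongr
          _ ≤ _ := by
              have : h * m * 1 ≤ h * m * K := by gcongr
              have : h * m' * L ≤ h * m' * K := by gcongr; linarith
              nlinarith
      · calc |n k| ≤ m * (1 + h * L) + h * (L * P₁ * m') := by
              rw [s2]
              refine (abs_add_le _ _).trans (add_le_add ?_ ?_)
              · rw [abs_mul]
                gcongr
                refine (abs_add_le _ _).trans ?_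
                rw [abs_one, abs_mul, abs_of_pos hh]
                gcongr
              · rw [abs_mul, abs_mul, abs_mul, abs_of_pos hh]; gcongr
          _ ≤ _ := by
              have : h * m * L ≤ h * m * K := by gcongr; linarith
              have : h * m' * (L * P₁) ≤ h * m' * K := by gcongr; linarith
              nlinarith
    have hK0 : 0 ≤ h * K := by positivity
    have k1 : m' * (1 - h * K) ≤ ((1 + 4 * (h * K)) * m) * (1 - h * K) := by
      have : 0 ≤ m * (h * K * (1 - 2 * (h * K))) :=
        mul_nonneg hm (mul_nonneg hK0 (by linarith))
      nlinarith
    rw [add_zero]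
    exact le_of_mul_le_mul_right k1 (by linarith)
  have ben : ∀ j ≤ M, max |e (M - j)| |n (M - j)| ≤ P₂ := by
    intro j hj
    have := le_exp_of_le_one_add_mul (a := fun j => max |e (M - j)| |n (M - j)|)
      (b := fun _ => 0) (c := 4 * (h * K))
      (M := M) (by positivity) (fun _ => le_rfl) ((abs_nonneg _).trans (le_max_left _ _)) step j hj
    refine this.trans ?_
    simp only [Nat.sub_zero, Finset.sum_const_zero, add_zero, H.e_last, H.n_last, P₂]
    rw [abs_mul, abs_neg, abs_of_nonneg (sq_nonneg σ), abs_one]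
    have e1 : 4 * (h * K) * j ≤ 4 * K * T := by
      have : (j : ℝ) * h ≤ T := le_trans (by gcongr) hM
      nlinarith
    have e2 := hG' _ hqM
    rw [Real.norm_eq_abs] at e2
    have e3 : σ ^ 2 * |deriv (deriv g) (q M)| ≤ σ ^ 2 * G' := by gcongr
    have e4 : 0 ≤ σ ^ 2 * |deriv (deriv g) (q M)| := by positivity
    gcongr
    exact max_le (by linarith) (by linarith)
  intro k hk
  have h1 := bp (M - k) (by omega)
  have h2 := ben (M - k) (by omega)
  rw [show M - (M - k) = k by omega] at h1 h2
  exact ⟨h1.trans (by linarith), (le_max_left _ _).trans (h2.trans (by linarith)),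
    (le_max_right _ _).trans (h2.trans (by linarith))⟩

/-- After the index reversal `j = M - k` the discrete equations are the semi-implicit scheme for
`stepField`, with exactly the initial data of the extremal through `q M`. The end point is thus
matched exactly, and `one_step_error` applies. -/
theorem IsExtremalField.exists_discretization_error {F g : ℝ → ℝ} {σ ρ T : ℝ}
    {X U η ν : ℝ → ℝ → ℝ} (H : IsExtremalField F g σ ρ T X U η ν) (hF : ContDiff ℝ ∞ F)
    (hFc : HasCompactSupport F) (hg : ContDiff ℝ ∞ g) (hρ : 0 ≤ ρ) (hT : 0 < T) :
    ∃ C h₀, 0 ≤ C ∧ 0 < h₀ ∧ ∀ h, 0 < h → h ≤ h₀ → ∀ M : ℕ, M * h ≤ T → ∀ q p e n,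
      IsDiscreteExtremal F g σ h M q p e n → (∀ k ≤ M, |q k| ≤ ρ) →
      ∀ k ≤ M, |q k - X (q M) ((M - k) * h)| ≤ C * h ∧ |p k - U (q M) ((M - k) * h)| ≤ C * h ∧
        |e k - η (q M) ((M - k) * h)| ≤ C * h ∧ |n k - ν (q M) ((M - k) * h)| ≤ C * h := by
  obtain ⟨P, h₁, hP, hh₁, hPb⟩ := IsDiscreteExtremal.exists_bound hF hFc hg σ hρ T
  obtain ⟨P', hP', hPb'⟩ := H.exists_bound
  set S := Metric.closedBall (0 : ℝ × ℝ × ℝ × ℝ) (P + P' + ρ)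
  have hmem : ∀ a b c d : ℝ, |a| ≤ P + P' + ρ → |b| ≤ P + P' + ρ → |c| ≤ P + P' + ρ →
      |d| ≤ P + P' + ρ → (a, b, c, d) ∈ S := by
    intro a b c d ha hb hc hd
    rw [mem_closedBall_zero_iff]
    simp only [Prod.norm_def]
    exact max_le ha (max_le hb (max_le hc hd))
  obtain ⟨L, hL⟩ := (contDiff_stepField hF).contDiffOn.exists_lipschitzOnWith (by simp)
    ((convex_closedBall (0 : ℝ × ℝ × ℝ × ℝ) (P + P' + ρ)).prod
      (convex_closedBall (0 : ℝ × ℝ × ℝ × ℝ) (P + P' + ρ)))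
    ((isCompact_closedBall _ _).prod (isCompact_closedBall _ _))
  obtain ⟨B, hB⟩ := (isCompact_closedBall (0 : ℝ × ℝ × ℝ × ℝ) (P + P' + ρ)).exists_bound_of_continuousOn
    (f := fun a => stepField F a a)
    ((contDiff_stepField hF).comp (contDiff_id.prodMk contDiff_id)).continuous.continuousOn
  have hB0 : 0 ≤ B := (norm_nonneg _).trans (hB 0 (by simp; positivity))
  refine ⟨4 * L * B * T * Real.exp (4 * L * T), min h₁ (1 / (2 * (L + 1))), by positivity,
    lt_min hh₁ (by positivity), ?_⟩
  intro h hh hh₀ M hM q p e n E hq k hk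
  have hb := hPb h hh (hh₀.trans (min_le_left _ _)) M hM q p e n E hq
  have hLh : L * h ≤ 1 / 2 := by
    have : h ≤ 1 / (2 * (L + 1)) := hh₀.trans (min_le_right _ _)
    calc L * h ≤ (L + 1) * (1 / (2 * (L + 1))) := by gcongr; simp
      _ = 1 / 2 := by field_simp
  have hqM : q M ∈ Icc (-ρ) ρ := abs_le.1 (hq M le_rfl)
  have := one_step_error (Φ := stepField F) (S := S) (L := L) (B := B) (T := T) (h := h) (M := M)
    (Y := fun t => (X (q M) t, U (q M) t, η (q M) t, ν (q M) t))
    (y := fun j => (q (M - j), p (M - j), e (M - j), n (M - j))) L.2 hB0 hh.le hLh hM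
    (fun a ha b hb a' ha' b' hb' => by
      refine (hL.norm_sub_le (x := (a, b)) ⟨ha, hb⟩ (y := (a', b')) ⟨ha', hb'⟩).trans ?_
      gcongr
      rw [Prod.mk_sub_mk, Prod.norm_def]
      exact max_le (by simp) (by simp))
    (fun a ha => hB a ha)
    (fun t ht => (H.hasDerivAt_X _ hqM t ht).prodMk ((H.hasDerivAt_U _ hqM t ht).prodMk
      ((H.hasDerivAt_η _ hqM t ht).prodMk (H.hasDerivAt_ν _ hqM t ht))))
    (fun t ht => by
      obtain ⟨b1, b2, b3, b4⟩ := hPb' _ hqM t ht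
      exact hmem _ _ _ _ (by linarith) (by linarith) (by linarith) (by linarith))
    (fun j hj => by
      obtain ⟨b2, b3, b4⟩ := hb (M - j) (by omega)
      have b1 := hq (M - j) (by omega)
      exact hmem _ _ _ _ (by linarith) (by linarith) (by linarith) (by linarith))
    (fun j hj => by
      have s1 := E.q_step (M - (j + 1)) (by omega)
      have s2 := E.p_step (M - (j + 1)) (by omega)
      have s3 := E.e_step (M - (j + 1)) (by omega)
      have s4 := E.n_step (M - (j + 1)) (by omega)
      rw [show M - (j + 1) + 1 = M - j by omega] at s1 s2 s3 s4
      simp only [stepField, Prod.smul_mk, Prod.mk_add_mk, smul_eq_mul, Prod.mk.injEq]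
      exact ⟨by rw [s1]; ring, by rw [s2]; ring, by rw [s3]; ring, by rw [s4]; ring⟩)
    (by simp [H.X_zero _ hqM, H.U_zero _ hqM, H.η_zero _ hqM, H.ν_zero _ hqM, E.p_last, E.e_last,
      E.n_last])
    (M - k) (by omega)
  rw [show M - (M - k) = k by omega, Nat.cast_sub hk] at this
  have n1 := (norm_fst_le (_ : ℝ × ℝ × ℝ × ℝ)).trans this
  have n2 := (norm_snd_le (_ : ℝ × ℝ × ℝ × ℝ)).trans this
  have n3 := (norm_snd_le (_ : ℝ × ℝ × ℝ)).trans n2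
  exact ⟨n1, (norm_fst_le (_ : ℝ × ℝ × ℝ)).trans n2, (norm_fst_le (_ : ℝ × ℝ)).trans n3,
    (norm_snd_le (_ : ℝ × ℝ)).trans n3⟩

/-! ### First and second derivatives of the discrete action. -/

theorem discretePath_add_smul {M : ℕ} (x₀ : ℝ) (y w : Fin M → ℝ) (r : ℝ) (i : Fin (M + 1)) :
    discretePath x₀ (y + r • w) i = discretePath x₀ y i + r * discretePath 0 w i := by
  refine Fin.cases ?_ (fun i => ?_) i <;> simp [discretePath]

theorem discretePath_of_seq {M : ℕ} (u : ℕ → ℝ) (i : Fin (M + 1)) :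
    discretePath (u 0) (fun j : Fin M => u (j + 1)) i = u i := by
  refine Fin.cases ?_ (fun i => ?_) i <;> simp [discretePath]

theorem exists_seq_eq_discretePath {M : ℕ} (x₀ : ℝ) (y : Fin M → ℝ) :
    ∃ x : ℕ → ℝ, ∀ i : Fin (M + 1), discretePath x₀ y i = x i :=
  ⟨fun k => if hk : k < M + 1 then discretePath x₀ y ⟨k, hk⟩ else 0, fun i => (dif_pos i.2).symm⟩

theorem contDiff_discretePath {M : ℕ} (x₀ : ℝ) (i : Fin (M + 1)) :
    ContDiff ℝ ∞ fun y : Fin M → ℝ => discretePath x₀ y i := by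
  refine Fin.cases ?_ (fun i => ?_) i
  · simpa [discretePath] using contDiff_const
  · simpa [discretePath] using contDiff_apply ℝ ℝ i

section

variable {f g : ℝ → ℝ} {σ h x₀ : ℝ} {M : ℕ}

theorem discreteAction_eq_sum_range {y : Fin M → ℝ} {x : ℕ → ℝ}
    (hx : ∀ i : Fin (M + 1), discretePath x₀ y i = x i) :
    discreteAction f g σ h x₀ y = h / (2 * σ ^ 2) *
      (∑ k ∈ Finset.range M, ((x (k + 1) - x k) / h - f (x k)) ^ 2) + g (x M) := by
  simp [discreteAction, hx, Finset.sum_range]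

theorem contDiff_discreteAction (hf : ContDiff ℝ ∞ f) (hg : ContDiff ℝ ∞ g) :
    ContDiff ℝ ∞ (discreteAction f g σ h x₀ (M := M)) := by
  have hp := contDiff_discretePath (M := M) x₀
  unfold discreteAction
  refine ContDiff.add (contDiff_const.mul (ContDiff.sum fun k _ => ?_)) (hg.comp (hp _))
  exact ((((hp _).sub (hp _)).div_const _).sub (hf.comp (hp _))).pow 2

theorem fderiv_discreteAction (hf : ContDiff ℝ ∞ f) (hg : ContDiff ℝ ∞ g) (y w : Fin M → ℝ) :
    fderiv ℝ (discreteAction f g σ h x₀) y w = h / σ ^ 2 *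
      (∑ k : Fin M, ((discretePath x₀ y k.succ - discretePath x₀ y k.castSucc) / h -
          f (discretePath x₀ y k.castSucc)) *
        ((discretePath 0 w k.succ - discretePath 0 w k.castSucc) / h -
          deriv f (discretePath x₀ y k.castSucc) * discretePath 0 w k.castSucc)) +
      deriv g (discretePath x₀ y (Fin.last M)) * discretePath 0 w (Fin.last M) := by
  have hline : HasDerivAt (fun r : ℝ => y + r • w) w 0 := by
    simpa using ((hasDerivAt_id (0 : ℝ)).smul_const w).const_add y
  have h1 : HasDerivAt (fun r : ℝ => discreteAction f g σ h x₀ (y + r • w))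
      (fderiv ℝ (discreteAction f g σ h x₀) y w) 0 := by
    have hd : HasFDerivAt (discreteAction f g σ h x₀)
      (fderiv ℝ (discreteAction f g σ h x₀) y) (y + (0 : ℝ) • w) := by
      rw [zero_smul, add_zero]
      exact ((contDiff_discreteAction hf hg).differentiable (by simp) y).hasFDerivAt
    exact hd.comp_hasDerivAt 0 hline
  refine h1.unique ?_
  have hc : ∀ i : Fin (M + 1), HasDerivAt (fun r : ℝ => discretePath x₀ (y + r • w) i)
      (discretePath 0 w i) 0 := fun i => by
    simp only [discretePath_add_smul]
    simpa using ((hasDerivAt_id (0 : ℝ)).mul_const (discretePath 0 w i)).const_add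
      (discretePath x₀ y i)
  have hcf : ∀ {φ : ℝ → ℝ} (_ : ContDiff ℝ ∞ φ) (i : Fin (M + 1)),
      HasDerivAt (fun r : ℝ => φ (discretePath x₀ (y + r • w) i))
      (deriv φ (discretePath x₀ y i) * discretePath 0 w i) 0 := fun {φ} hφ i => by
    have h2 : HasDerivAt φ (deriv φ (discretePath x₀ y i)) (discretePath x₀ (y + (0 : ℝ) • w) i) := by
      rw [zero_smul, add_zero]
      exact (hφ.differentiable (by simp) _).hasDerivAt
    exact h2.comp 0 (hc i)
  have hs := ((HasDerivAt.fun_sum (u := Finset.univ) fun (k : Fin M) _ =>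
    ((((hc k.succ).sub (hc k.castSucc)).div_const h).sub (hcf hf k.castSucc)).pow 2).const_mul
      (h / (2 * σ ^ 2))).add (hcf hg (Fin.last M))
  refine hs.congr_deriv ?_
  congr 1
  rw [Finset.mul_sum, Finset.mul_sum]
  refine Finset.sum_congr rfl fun k _ => ?_
  simp only [zero_smul, add_zero, Pi.sub_apply]
  have : h / σ ^ 2 = h / (2 * σ ^ 2) * 2 := by rw [div_mul_eq_mul_div, mul_comm 2, mul_div_mul_right _ _ two_ne_zero]
  rw [this]
  push_cast
  ring

theorem fderiv_fderiv_discreteAction (hf : ContDiff ℝ ∞ f) (hg : ContDiff ℝ ∞ g)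
    (y w v : Fin M → ℝ) :
    fderiv ℝ (fun z => fderiv ℝ (discreteAction f g σ h x₀) z w) y v = h / σ ^ 2 *
      (∑ k : Fin M, (((discretePath 0 v k.succ - discretePath 0 v k.castSucc) / h -
          deriv f (discretePath x₀ y k.castSucc) * discretePath 0 v k.castSucc) *
        ((discretePath 0 w k.succ - discretePath 0 w k.castSucc) / h -
          deriv f (discretePath x₀ y k.castSucc) * discretePath 0 w k.castSucc) -
        ((discretePath x₀ y k.succ - discretePath x₀ y k.castSucc) / h -
          f (discretePath x₀ y k.castSucc)) * (deriv (deriv f) (discretePath x₀ y k.castSucc) *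
          discretePath 0 v k.castSucc * discretePath 0 w k.castSucc))) +
      deriv (deriv g) (discretePath x₀ y (Fin.last M)) * discretePath 0 v (Fin.last M) *
        discretePath 0 w (Fin.last M) := by
  have hf' : ContDiff ℝ ∞ (deriv f) := (contDiff_infty_iff_deriv.1 hf).2
  have hg' : ContDiff ℝ ∞ (deriv g) := (contDiff_infty_iff_deriv.1 hg).2
  have hline : HasDerivAt (fun r : ℝ => y + r • v) v 0 := by
    simpa using ((hasDerivAt_id (0 : ℝ)).smul_const v).const_add y
  have hF := contDiff_discreteAction (σ := σ) (h := h) (x₀ := x₀) (M := M) hf hg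
  have hF1 : ContDiff ℝ 1 (fun z => fderiv ℝ (discreteAction f g σ h x₀ (M := M)) z w) :=
    (hF.fderiv_right (m := 1) (by norm_cast)).clm_apply contDiff_const
  have h1 : HasDerivAt (fun r : ℝ => fderiv ℝ (discreteAction f g σ h x₀) (y + r • v) w)
      (fderiv ℝ (fun z => fderiv ℝ (discreteAction f g σ h x₀) z w) y v) 0 := by
    have hd : HasFDerivAt (fun z => fderiv ℝ (discreteAction f g σ h x₀) z w)
      (fderiv ℝ (fun z => fderiv ℝ (discreteAction f g σ h x₀) z w) y) (y + (0 : ℝ) • v) := by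
      rw [zero_smul, add_zero]
      exact (hF1.differentiable (by simp) y).hasFDerivAt
    exact hd.comp_hasDerivAt 0 hline
  refine h1.unique ?_
  simp only [fderiv_discreteAction hf hg]
  have hc : ∀ i : Fin (M + 1), HasDerivAt (fun r : ℝ => discretePath x₀ (y + r • v) i)
      (discretePath 0 v i) 0 := fun i => by
    simp only [discretePath_add_smul]
    simpa using ((hasDerivAt_id (0 : ℝ)).mul_const (discretePath 0 v i)).const_add
      (discretePath x₀ y i)
  have hcf : ∀ {φ : ℝ → ℝ} (_ : ContDiff ℝ ∞ φ) (i : Fin (M + 1)),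
      HasDerivAt (fun r : ℝ => φ (discretePath x₀ (y + r • v) i))
      (deriv φ (discretePath x₀ y i) * discretePath 0 v i) 0 := fun {φ} hφ i => by
    have h2 : HasDerivAt φ (deriv φ (discretePath x₀ y i)) (discretePath x₀ (y + (0 : ℝ) • v) i) := by
      rw [zero_smul, add_zero]
      exact (hφ.differentiable (by simp) _).hasDerivAt
    exact h2.comp 0 (hc i)
  have hs := ((HasDerivAt.fun_sum (u := Finset.univ) fun (k : Fin M) _ =>
    ((((hc k.succ).sub (hc k.castSucc)).div_const h).sub (hcf hf k.castSucc)).mul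
      (((hcf hf' k.castSucc).mul_const (discretePath 0 w k.castSucc)).const_sub
        ((discretePath 0 w k.succ - discretePath 0 w k.castSucc) / h))).const_mul
      (h / σ ^ 2)).add ((hcf hg' (Fin.last M)).mul_const (discretePath 0 w (Fin.last M)))
  refine hs.congr_deriv ?_
  congr 1
  congr 1
  refine Finset.sum_congr rfl fun k _ => ?_
  simp only [zero_smul, add_zero, Pi.sub_apply]
  ring

/-- Replaces matrix computations by the second variation as a bilinear form, for which summation by
parts is available. -/
theorem hessianMatrix_mulVec {G : (Fin M → ℝ) → ℝ} (hG : ContDiff ℝ ∞ G) (y w : Fin M → ℝ)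
    (i : Fin M) :
    (hessianMatrix G y).mulVec w i = fderiv ℝ (fun z => fderiv ℝ G z w) y (Pi.single i 1) := by
  have hG1 : DifferentiableAt ℝ (fderiv ℝ G) y :=
    (hG.fderiv_right (m := 1) (by norm_cast)).differentiable (by simp) y
  have key : ∀ u : Fin M → ℝ, fderiv ℝ (fun z => fderiv ℝ G z u) y (Pi.single i 1) =
      fderiv ℝ (fderiv ℝ G) y (Pi.single i 1) u := fun u => by
    rw [fderiv_clm_apply hG1 (differentiableAt_const u)]
    simp
  simp only [Matrix.mulVec, dotProduct, hessianMatrix, Matrix.of_apply, key]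
  conv_rhs => rw [pi_eq_sum_univ' w, map_sum]
  refine Finset.sum_congr rfl fun j _ => ?_
  rw [map_smul, smul_eq_mul, mul_comm]

end

/-! ### Discrete Euler-Lagrange equations and the inverse Hessian. -/

/-- Summation by parts: `μ k * t k` telescopes. It moves the end point term and the lower order
terms of a variation onto a costate `μ`. -/
theorem sum_range_mul_sub_of_recursion {M : ℕ} {μ t c b : ℕ → ℝ}
    (hμ : ∀ k < M, μ k = μ (k + 1) * c k + b k) :
    ∑ k ∈ Finset.range M, μ (k + 1) * (t (k + 1) - t k * c k) =
      μ M * t M - μ 0 * t 0 + ∑ k ∈ Finset.range M, b k * t k := by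
  rw [← Finset.sum_range_sub (fun k => μ k * t k), ← Finset.sum_add_distrib]
  refine Finset.sum_congr rfl fun k hk => ?_
  rw [hμ k (Finset.mem_range.1 hk)]
  ring

/-- A discrete fundamental lemma. With `t 0 = 0` the numbers `t (k + 1) - t k * c k` can be
prescribed freely; prescribing `d k` makes the sum `∑ d k ^ 2`. -/
theorem eq_zero_of_forall_sum_mul_eq_zero {M : ℕ} {d c : ℕ → ℝ}
    (h : ∀ t : ℕ → ℝ, t 0 = 0 → ∑ k ∈ Finset.range M, d k * (t (k + 1) - t k * c k) = 0) :
    ∀ k < M, d k = 0 := by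
  let t : ℕ → ℝ := fun k => Nat.rec 0 (fun k v => v * c k + d k) k
  have ht : ∀ k, t (k + 1) - t k * c k = d k := fun k => by simp [t]
  have := h t rfl
  simp only [ht] at this
  intro k hk
  rw [Finset.sum_eq_zero_iff_of_nonneg fun i _ => mul_self_nonneg _] at this
  exact mul_self_eq_zero.1 (this k (Finset.mem_range.2 hk))

section

variable {f g : ℝ → ℝ} {σ h x₀ : ℝ} {M : ℕ}

/-- With the costate `p`, summation by parts turns the vanishing first variation into orthogonality
of the residual minus `p (k + 1)` to every `t (k + 1) - t k * (1 + h f')`; the end value of `p` is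
the one that cancels the contribution of `g`. -/
theorem IsDiscreteOptimalPath.step_eq (hf : ContDiff ℝ ∞ f) (hg : ContDiff ℝ ∞ g) (hσ : 0 < σ)
    (hh : 0 < h) {y : Fin M → ℝ} (hy : IsDiscreteOptimalPath f g σ h x₀ y) {x p : ℕ → ℝ}
    (hx : ∀ i : Fin (M + 1), discretePath x₀ y i = x i) (hpM : p M = -σ ^ 2 * deriv g (x M))
    (hp : ∀ k < M, p k = p (k + 1) * (1 + h * deriv f (x k))) :
    ∀ k < M, x (k + 1) = x k + h * (f (x k) + p (k + 1)) := by
  have hcrit : fderiv ℝ (discreteAction f g σ h x₀) y = 0 :=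
    IsLocalMin.fderiv_eq_zero (Filter.Eventually.of_forall hy)
  have key : ∀ k < M, (x (k + 1) - x k) / h - f (x k) - p (k + 1) = 0 := by
    refine eq_zero_of_forall_sum_mul_eq_zero (c := fun k => 1 + h * deriv f (x k)) fun t ht => ?_
    have ht' : ∀ i : Fin (M + 1), discretePath 0 (fun j : Fin M => t (j + 1)) i = t i := fun i => by
      rw [← ht]; exact discretePath_of_seq t i
    have h1 := fderiv_discreteAction (σ := σ) (h := h) (x₀ := x₀) hf hg y
      (fun j : Fin M => t (j + 1))
    have h2 := sum_range_mul_sub_of_recursion (t := t) (c := fun k => 1 + h * deriv f (x k))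
      (b := fun _ => 0) (fun k hk => by simpa using hp k hk)
    simp only [hcrit, hx, ht', Fin.val_succ, Fin.val_castSucc, Fin.val_last,
      zero_apply] at h1
    rw [← Finset.sum_range (fun k => ((x (k + 1) - x k) / h - f (x k)) *
      ((t (k + 1) - t k) / h - deriv f (x k) * t k))] at h1
    have h3 : ∑ k ∈ Finset.range M, ((x (k + 1) - x k) / h - f (x k)) *
        (t (k + 1) - t k * (1 + h * deriv f (x k))) =
        h * ∑ k ∈ Finset.range M, ((x (k + 1) - x k) / h - f (x k)) *
      ((t (k + 1) - t k) / h - deriv f (x k) * t k) := by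
      rw [Finset.mul_sum]
      refine Finset.sum_congr rfl fun k _ => ?_
      field_simp
      ring
    simp only [sub_mul, Finset.sum_sub_distrib] at h2 h3 ⊢
    simp only [← sub_mul, ← Finset.sum_sub_distrib] at h2 h3 ⊢
    have h4 : ∑ k ∈ Finset.range M, ((x (k + 1) - x k) / h - f (x k) - p (k + 1)) *
        (t (k + 1) - t k * (1 + h * deriv f (x k))) =
        ∑ k ∈ Finset.range M, ((x (k + 1) - x k) / h - f (x k)) *
          (t (k + 1) - t k * (1 + h * deriv f (x k))) -
        ∑ k ∈ Finset.range M, p (k + 1) * (t (k + 1) - t k * (1 + h * deriv f (x k))) := by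
      rw [← Finset.sum_sub_distrib]
      exact Finset.sum_congr rfl fun k _ => by ring
    rw [h4, h3, h2, ht, hpM]
    simp only [zero_mul, Finset.sum_const_zero, mul_zero]
    have alg : ∀ S : ℝ, 0 = h / σ ^ 2 * S + deriv g (x M) * t M →
        h * S - (-σ ^ 2 * deriv g (x M) * t M - 0 + 0) = 0 := fun S hS => by
      field_simp at hS
      linarith
    exact alg _ h1
  intro k hk
  have := key k hk
  field_simp at this
  linarith

/-- Here `μ` is the linearized costate belonging to the direction `u`. It absorbs both the `f''`
terms and the `g''` term, so what is left tests only the linearized step equation for `u`. -/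
theorem fderiv_fderiv_discreteAction_eq_sum (hf : ContDiff ℝ ∞ f) (hg : ContDiff ℝ ∞ g)
    (hσ : 0 < σ) (hh : 0 < h) {y w v : Fin M → ℝ} {x p u t μ : ℕ → ℝ}
    (hx : ∀ i : Fin (M + 1), discretePath x₀ y i = x i)
    (hu : ∀ i : Fin (M + 1), discretePath 0 w i = u i)
    (ht : ∀ i : Fin (M + 1), discretePath 0 v i = t i)
    (hxp : ∀ k < M, x (k + 1) = x k + h * (f (x k) + p (k + 1)))
    (hμM : μ M = -σ ^ 2 * deriv (deriv g) (x M) * u M)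
    (hμ : ∀ k < M, μ k = μ (k + 1) * (1 + h * deriv f (x k)) +
      h * (deriv (deriv f) (x k) * p (k + 1) * u k)) :
    fderiv ℝ (fun z => fderiv ℝ (discreteAction f g σ h x₀) z w) y v =
      1 / σ ^ 2 * ∑ k ∈ Finset.range M, ((u (k + 1) - u k) / h - deriv f (x k) * u k - μ (k + 1)) *
        (t (k + 1) - t k * (1 + h * deriv f (x k))) := by
  have t0 : t 0 = 0 := by rw [← Fin.val_zero (M + 1), ← ht]; simp [discretePath]
  have h2 := sum_range_mul_sub_of_recursion (t := t) (c := fun k => 1 + h * deriv f (x k))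
      (b := fun k => h * (deriv (deriv f) (x k) * p (k + 1) * u k)) hμ
  rw [fderiv_fderiv_discreteAction hf hg]
  simp only [hx, hu, ht, Fin.val_succ, Fin.val_castSucc, Fin.val_last]
  rw [← Finset.sum_range (fun k => (((t (k + 1) - t k) / h - deriv f (x k) * t k) *
    ((u (k + 1) - u k) / h - deriv f (x k) * u k) -
    ((x (k + 1) - x k) / h - f (x k)) * (deriv (deriv f) (x k) * t k * u k)))]
  have h4 : ∑ k ∈ Finset.range M, ((u (k + 1) - u k) / h - deriv f (x k) * u k - μ (k + 1)) *
        (t (k + 1) - t k * (1 + h * deriv f (x k))) =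
      ∑ k ∈ Finset.range M, ((u (k + 1) - u k) / h - deriv f (x k) * u k) *
        (t (k + 1) - t k * (1 + h * deriv f (x k))) -
      ∑ k ∈ Finset.range M, μ (k + 1) * (t (k + 1) - t k * (1 + h * deriv f (x k))) := by
    rw [← Finset.sum_sub_distrib]
    exact Finset.sum_congr rfl fun k _ => by ring
  have h5 : h * ∑ k ∈ Finset.range M, (((t (k + 1) - t k) / h - deriv f (x k) * t k) *
    ((u (k + 1) - u k) / h - deriv f (x k) * u k) -
    ((x (k + 1) - x k) / h - f (x k)) * (deriv (deriv f) (x k) * t k * u k)) =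
      ∑ k ∈ Finset.range M, ((u (k + 1) - u k) / h - deriv f (x k) * u k) *
        (t (k + 1) - t k * (1 + h * deriv f (x k))) -
      ∑ k ∈ Finset.range M, h * (deriv (deriv f) (x k) * p (k + 1) * u k) * t k := by
    rw [← Finset.sum_sub_distrib, Finset.mul_sum]
    refine Finset.sum_congr rfl fun k hk => ?_
    rw [hxp k (Finset.mem_range.1 hk)]
    field_simp
    ring
  rw [h4, h2, t0, hμM, div_mul_eq_mul_div, h5]
  have alg : ∀ S₁ S₂ : ℝ, (S₁ - S₂) / σ ^ 2 + deriv (deriv g) (x M) * t M * u M =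
      1 / σ ^ 2 * (S₁ - (-σ ^ 2 * deriv (deriv g) (x M) * u M * t M - μ 0 * 0 + S₂)) :=
    fun S₁ S₂ => by field_simp; ring
  exact alg _ _

/-- A kernel vector, extended by zero at index 0, solves the linearized equations and so is a
multiple of `e`, as follows by going backward from the end. Since `e 0 ≠ 0` the multiple is zero.
For the inverse, `(e 1, …, e M)` satisfies every linearized equation except the first one, so the
Hessian maps it to a multiple `c` of the first basis vector and the corner entry of the inverse is
`e 1 / c`. -/
theorem hessianMatrix_discreteAction (hf : ContDiff ℝ ∞ f) (hg : ContDiff ℝ ∞ g)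
    (hσ : 0 < σ) (hh : 0 < h) (hM : 0 < M) {y : Fin M → ℝ} {x p e n : ℕ → ℝ}
    (hx : ∀ i : Fin (M + 1), discretePath x₀ y i = x i)
    (H : IsDiscreteExtremal f g σ h M x p e n) (hne : ∀ k < M, 1 + h * deriv f (x k) ≠ 0)
    (he : e 0 ≠ 0) :
    IsUnit (hessianMatrix (discreteAction f g σ h x₀) y).det ∧
      dlmVariance f g σ h hM x₀ y =
        σ ^ 2 * (1 + h * (n 1 / (e 0 * (1 + h * deriv f (x 0))))) := by
  have hF := contDiff_discreteAction (σ := σ) (h := h) (x₀ := x₀) (M := M) hf hg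
  set A := hessianMatrix (discreteAction f g σ h x₀) y with hA
  have hunit : IsUnit A.det := by
    rw [← Matrix.isUnit_iff_isUnit_det, ← Matrix.mulVec_injective_iff_isUnit]
    refine (injective_iff_map_eq_zero A.mulVecLin).2 fun w hw => ?_
    have hw0 : A.mulVec w = 0 := hw
    obtain ⟨u, hu⟩ := exists_seq_eq_discretePath 0 w
    have u0 : u 0 = 0 := by rw [← Fin.val_zero (M + 1), ← hu]; simp [discretePath]
    obtain ⟨μ, hμM, hμ⟩ := exists_backward_recursion M (-σ ^ 2 * deriv (deriv g) (x M) * u M)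
      (fun k m => m * (1 + h * deriv f (x k)) + h * (deriv (deriv f) (x k) * p (k + 1) * u k))
    have hzero : fderiv ℝ (fun z => fderiv ℝ (discreteAction f g σ h x₀) z w) y = 0 := by
      ext v
      rw [pi_eq_sum_univ' v, map_sum]
      refine Finset.sum_eq_zero fun j _ => ?_
      have := hessianMatrix_mulVec hF y w j
      rw [← hA, hw0] at this
      rw [map_smul]
      rw [← this]
      simp
    have key : ∀ k < M, (u (k + 1) - u k) / h - deriv f (x k) * u k - μ (k + 1) = 0 := by
      refine eq_zero_of_forall_sum_mul_eq_zero (c := fun k => 1 + h * deriv f (x k)) fun t ht => ?_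
      have ht' : ∀ i : Fin (M + 1), discretePath 0 (fun j : Fin M => t (j + 1)) i = t i :=
        fun i => by rw [← ht]; exact discretePath_of_seq t i
      have := fderiv_fderiv_discreteAction_eq_sum hf hg hσ hh hx hu ht' H.q_step hμM hμ
      rw [hzero] at this
      have hs : (1 / σ ^ 2) ≠ 0 := by positivity
      simpa [hs, hσ.ne'] using this
    have hrec : ∀ j ≤ M, u (M - j) = u M * e (M - j) ∧ μ (M - j) = u M * n (M - j) := by
      intro j
      induction j with
      | zero =>
        intro _
        simp only [Nat.sub_zero, H.e_last, H.n_last, hμM]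
        exact ⟨by ring, by ring⟩
      | succ j ih =>
        intro hj
        obtain ⟨i1, i2⟩ := ih (by omega)
        have k1 := key (M - (j + 1)) (by omega)
        have k2 := hμ (M - (j + 1)) (by omega)
        have k3 := H.e_step (M - (j + 1)) (by omega)
        have k4 := H.n_step (M - (j + 1)) (by omega)
        have k5 := hne (M - (j + 1)) (by omega)
        rw [show M - (j + 1) + 1 = M - j by omega] at k1 k2 k3 k4
        have r1 : u (M - (j + 1)) = u M * e (M - (j + 1)) := by
          refine mul_right_cancel₀ k5 ?_
          field_simp at k1
          rw [i1, i2, k3] at k1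
          linarith
        refine ⟨r1, ?_⟩
        rw [k2, k4, i2, r1]
        ring
    have hM0 := (hrec M le_rfl).1
    rw [Nat.sub_self, u0] at hM0
    have huM : u M = 0 := by
      rcases mul_eq_zero.1 hM0.symm with h0 | h0
      · exact h0
      · exact absurd h0 he
    ext j
    have hj := (hrec (M - (j + 1)) (by omega)).1
    rw [huM, zero_mul, show M - (M - ((j : ℕ) + 1)) = j + 1 by omega] at hj
    have := hu j.succ
    rw [Fin.val_succ, hj] at this
    simpa [discretePath] using this
  refine ⟨hunit, ?_⟩
  set c := 1 / σ ^ 2 * (e 0 * (1 + h * deriv f (x 0)) / h) with hc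
  have hc0 : c ≠ 0 := by
    have := hne 0 hM
    rw [hc]; positivity
  have hAe : A.mulVec (fun j : Fin M => e (j + 1)) = c • Pi.single ⟨0, hM⟩ 1 := by
    ext i
    rw [hA, hessianMatrix_mulVec hF]
    obtain ⟨t, ht⟩ := exists_seq_eq_discretePath 0 (Pi.single i 1 : Fin M → ℝ)
    have t0 : t 0 = 0 := by rw [← Fin.val_zero (M + 1), ← ht]; simp [discretePath]
    -- A Hessian direction fixes the initial point, so the value `e 0` is replaced by 0. This
    -- creates the only defect, in the step from 0 to 1, and the costate at index 0 is adjusted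
    -- because its `f''` term now vanishes.
    set u : ℕ → ℝ := fun k => if k = 0 then 0 else e k with hu
    have hu' : ∀ i : Fin (M + 1), discretePath 0 (fun j : Fin M => e (j + 1)) i = u i := fun i => by
      have := discretePath_of_seq u i
      simpa [hu] using this
    rw [fderiv_fderiv_discreteAction_eq_sum hf hg hσ hh hx hu' ht H.q_step
      (μ := fun k => if k = 0 then n 1 * (1 + h * deriv f (x 0)) else n k)
      (by simp [hu, hM.ne', H.n_last, H.e_last])
      (fun k hk => by
        rcases Nat.eq_zero_or_pos k with rfl | h0
        · simp [hu]
        · simp only [h0.ne', if_false, hu, Nat.succ_ne_zero]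
          exact H.n_step k hk)]
    rw [Finset.sum_eq_single_of_mem 0 (Finset.mem_range.2 hM)]
    · simp only [zero_add, t0, hu, if_true, one_ne_zero, if_false, H.e_step 0 hM, hc]
      have t1 : t 1 = (Pi.single i 1 : Fin M → ℝ) ⟨0, hM⟩ := by
        exact (ht (Fin.succ ⟨0, hM⟩)).symm.trans (by simp only [discretePath, Fin.cons_succ])
      rw [t1, Pi.smul_apply, smul_eq_mul, Pi.single_comm]
      field_simp
      ring
    · intro k hk hk0
      have := H.e_step k (Finset.mem_range.1 hk)
      simp only [hu, hk0, if_false, Nat.succ_ne_zero, this]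
      field_simp
      ring
  have hinv : A⁻¹ ⟨0, hM⟩ ⟨0, hM⟩ = e 1 / c := by
    have h1 : (fun j : Fin M => e (j + 1)) = c • A⁻¹.mulVec (Pi.single ⟨0, hM⟩ 1) := by
      rw [← Matrix.mulVec_smul, ← hAe, Matrix.mulVec_mulVec, Matrix.nonsing_inv_mul _ hunit,
        Matrix.one_mulVec]
    have h2 := congrFun h1 ⟨0, hM⟩
    simp only [Pi.smul_apply, smul_eq_mul, Matrix.mulVec_single_one] at h2
    rw [eq_div_iff hc0, mul_comm]
    simpa using h2.symm
  have h0 := hne 0 hM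
  unfold dlmVariance
  rw [hinv, hc, H.e_step 0 hM]
  field_simp

end

/-! ### A priori bounds and existence of discrete minimizers. -/

/-- Growth of `1 + x²` along a step: the one-sided condition controls `2 h x f(x)`, the action
controls the residual `u`, and only `h² f(x)²` needs a two-sided bound on `f`. Strong induction
supplies it, because all earlier points already lie in `[-ρ, ρ]`. -/
theorem exists_bound_discretePath {f : ℝ → ℝ} (hf : Continuous f) {σ K R B T ρ : ℝ} (hσ : 0 < σ)
    (hK : 0 ≤ K) (hgrowth : ∀ x, x * f x ≤ K * (1 + x ^ 2)) (hT : 0 < T)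
    (hρ : 0 ≤ ρ) (hB : 0 ≤ B)
    (hρ' : (2 + R ^ 2 + 4 * σ ^ 2 * B) * Real.exp ((2 * K + 1) * T) ≤ 1 + ρ ^ 2) :
    ∃ h₀, 0 < h₀ ∧ ∀ h, 0 < h → h ≤ h₀ → ∀ M : ℕ, M * h ≤ T → ∀ x : ℕ → ℝ, |x 0| ≤ R →
      h / (2 * σ ^ 2) * ∑ k ∈ Finset.range M, ((x (k + 1) - x k) / h - f (x k)) ^ 2 ≤ B →
      ∀ k ≤ M, |x k| ≤ ρ := by
  obtain ⟨L, hL⟩ := (isCompact_Icc (a := -ρ) (b := ρ)).exists_bound_of_continuousOn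
    hf.continuousOn
  -- No circularity: `ρ` is given, `L` bounds `f` on `[-ρ, ρ]`, and `h` is then so small that the
  -- terms `2 h² L²` sum to at most 1. This 1 and the one in `1 + x 0 ^ 2` make up the 2 in the
  -- hypothesis on `ρ`.
  refine ⟨min (1 / 2) (1 / (2 * L ^ 2 * T + 1)), by positivity, ?_⟩
  intro h hh hh₀ M hM x hx0 hA k
  have h1 : h ≤ 1 / 2 := hh₀.trans (min_le_left _ _)
  have h2 : 2 * h * L ^ 2 * T ≤ 1 := by
    have := hh₀.trans (min_le_right _ _)
    rw [le_div_iff₀ (by positivity)] at this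
    nlinarith
  set u : ℕ → ℝ := fun k => (x (k + 1) - x k) / h - f (x k) with hu
  have hA' : 2 * h * ∑ k ∈ Finset.range M, u k ^ 2 ≤ 4 * σ ^ 2 * B := by
    have : 2 * h * ∑ k ∈ Finset.range M, u k ^ 2 =
        4 * σ ^ 2 * (h / (2 * σ ^ 2) * ∑ k ∈ Finset.range M, u k ^ 2) := by
      field_simp; ring
    rw [this]
    gcongr
  induction k using Nat.strong_induction_on with
  | _ k ih =>
    intro hk
    have step : ∀ j < k, 1 + x (j + 1) ^ 2 ≤
        (1 + (2 * K + 1) * h) * (1 + x j ^ 2) + (2 * h * u j ^ 2 + 2 * h ^ 2 * L ^ 2) := by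
      intro j hj
      have hxj := ih j hj (by omega)
      have hfL : f (x j) ^ 2 ≤ L ^ 2 := by
        have := hL (x j) (abs_le.1 hxj)
        rw [Real.norm_eq_abs] at this
        exact sq_le_sq.2 (this.trans (le_abs_self L))
      have hx1 : x (j + 1) = x j + h * (f (x j) + u j) := by simp only [hu]; field_simp; ring
      have e1 := mul_le_mul_of_nonneg_left (hgrowth (x j)) hh.le
      have e2 : 0 ≤ h * (x j - u j) ^ 2 := by positivity
      have e3 : 0 ≤ h ^ 2 * (f (x j) - u j) ^ 2 := by positivity
      have e4 : h ^ 2 * f (x j) ^ 2 ≤ h ^ 2 * L ^ 2 := by gcongr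
      have e5 : h * (h * u j ^ 2) ≤ 1 / 2 * (h * u j ^ 2) := by gcongr
      rw [hx1]
      nlinarith
    have key := le_exp_of_le_one_add_mul (a := fun j => 1 + x j ^ 2) (c := (2 * K + 1) * h)
      (M := k) (by positivity) (fun j => by positivity) (by positivity) step k le_rfl
    have s1 : ∑ i ∈ Finset.range k, (2 * h * u i ^ 2 + 2 * h ^ 2 * L ^ 2) ≤ 4 * σ ^ 2 * B + 1 := by
      calc _ ≤ ∑ i ∈ Finset.range M, (2 * h * u i ^ 2 + 2 * h ^ 2 * L ^ 2) :=
            Finset.sum_le_sum_of_subset_of_nonneg (Finset.range_mono hk)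
              fun i _ _ => by positivity
        _ = 2 * h * ∑ i ∈ Finset.range M, u i ^ 2 + 2 * h * L ^ 2 * (M * h) := by
            rw [Finset.sum_add_distrib, Finset.mul_sum]
            simp; ring
        _ ≤ 4 * σ ^ 2 * B + 2 * h * L ^ 2 * T := by gcongr
        _ ≤ _ := by linarith
    have s2 : (2 * K + 1) * h * k ≤ (2 * K + 1) * T := by
      have : (k : ℝ) * h ≤ T := le_trans (by gcongr) hM
      nlinarith
    have s3 : x 0 ^ 2 ≤ R ^ 2 := sq_le_sq.2 (hx0.trans (le_abs_self R))
    have : 1 + x k ^ 2 ≤ 1 + ρ ^ 2 := by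
      refine key.trans (le_trans ?_ hρ')
      exact mul_le_mul (by linarith) (Real.exp_le_exp.2 s2) (Real.exp_pos _).le (by positivity)
    exact abs_le_of_sq_le_sq (by linarith) hρ

/-- The sublevel set of the competitor `y₀` lies in a compact ball; a minimum over the ball is then
global. -/
theorem exists_isDiscreteOptimalPath {f g : ℝ → ℝ} (hf : ContDiff ℝ ∞ f) (hg : ContDiff ℝ ∞ g)
    {σ h x₀ ρ : ℝ} {M : ℕ} (y₀ : Fin M → ℝ)
    (hy₀ : ∀ y : Fin M → ℝ, discreteAction f g σ h x₀ y ≤ discreteAction f g σ h x₀ y₀ → ∀ i, |y i| ≤ ρ)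
    (hρ : 0 ≤ ρ) :
    ∃ y : Fin M → ℝ, IsDiscreteOptimalPath f g σ h x₀ y := by
  have mem : ∀ y : Fin M → ℝ, discreteAction f g σ h x₀ y ≤ discreteAction f g σ h x₀ y₀ →
      y ∈ Metric.closedBall (0 : Fin M → ℝ) ρ := fun y hy => by
    rw [mem_closedBall_zero_iff, pi_norm_le_iff_of_nonneg hρ]
    exact hy₀ y hy
  obtain ⟨y, hy, hmin⟩ := (isCompact_closedBall (0 : Fin M → ℝ) ρ).exists_isMinOn
    ⟨y₀, mem y₀ le_rfl⟩
    (contDiff_discreteAction (σ := σ) (h := h) (x₀ := x₀) hf hg).continuous.continuousOn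
  refine ⟨y, fun z => ?_⟩
  rcases le_total (discreteAction f g σ h x₀ z) (discreteAction f g σ h x₀ y₀) with hz | hz
  · exact hmin (mem z hz)
  · exact (hmin (mem y₀ le_rfl)).trans hz

theorem discreteAction_const {f g : ℝ → ℝ} {σ h x₀ : ℝ} {M : ℕ} :
    discreteAction f g σ h x₀ (fun _ : Fin M => x₀) =
      M * h / (2 * σ ^ 2) * f x₀ ^ 2 + g x₀ := by
  rw [discreteAction_eq_sum_range (x := fun _ => x₀)
    (fun i => discretePath_of_seq (M := M) (fun _ => x₀) i)]
  simp
  ring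

/-! ### Euler-Lagrange equations of continuous minimizers. -/

section

variable {t T : ℝ} {φ w : ℝ → ℝ}

theorem deriv_eq_of_hasDerivWithinAt_Icc
    (hφ : ∀ s ∈ Icc t T, HasDerivWithinAt φ (w s) (Icc t T) s) {s : ℝ} (hs : s ∈ Ioo t T) :
    deriv φ s = w s :=
  ((hφ s (Ioo_subset_Icc_self hs)).hasDerivAt (Icc_mem_nhds hs.1 hs.2)).deriv

theorem isActionPath_of_hasDerivWithinAt (htT : t ≤ T) (hw : Continuous w)
    (hφ : ∀ s ∈ Icc t T, HasDerivWithinAt φ (w s) (Icc t T) s) : IsActionPath t T φ := by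
  refine ⟨?_, ?_⟩
  · obtain ⟨B, hB⟩ := (isCompact_Icc (a := t) (b := T)).exists_bound_of_continuousOn
      hw.continuousOn
    have hlip : LipschitzOnWith B.toNNReal φ (uIcc t T) := by
      rw [uIcc_of_le htT]
      refine (convex_Icc t T).lipschitzOnWith_of_nnnorm_hasDerivWithin_le hφ fun s hs => ?_
      rw [← NNReal.coe_le_coe, coe_nnnorm, Real.coe_toNNReal']
      exact (hB s hs).trans (le_max_left _ _)
    exact hlip.absolutelyContinuousOnInterval
  · refine ((hw.pow 2).intervalIntegrable t T).congr_uIoo fun s hs => ?_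
    rw [uIoo_of_le htT] at hs
    simp only [deriv_eq_of_hasDerivWithinAt_Icc hφ hs, Pi.pow_apply]

theorem action_eq_of_hasDerivWithinAt (f g : ℝ → ℝ) (σ : ℝ) (htT : t ≤ T)
    (hφ : ∀ s ∈ Icc t T, HasDerivWithinAt φ (w s) (Icc t T) s) :
    action f g σ t T φ = 1 / (2 * σ ^ 2) * (∫ s in t..T, (w s - f (φ s)) ^ 2) + g (φ T) := by
  unfold action
  congr 2
  refine intervalIntegral.integral_congr_Ioo_of_le htT fun s hs => ?_
  simp only [deriv_eq_of_hasDerivWithinAt_Icc hφ hs]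

theorem exists_continuous_deriv_of_contDiffOn (htT : t < T) (hφ : ContDiffOn ℝ 2 φ (Icc t T)) :
    ∃ w : ℝ → ℝ, Continuous w ∧ ∀ s ∈ Icc t T, HasDerivWithinAt φ (w s) (Icc t T) s := by
  have hc : ContinuousOn (derivWithin φ (Icc t T)) (Icc t T) :=
    hφ.continuousOn_derivWithin (uniqueDiffOn_Icc htT) (by norm_num)
  refine ⟨IccExtend htT.le ((Icc t T).domRestrict (derivWithin φ (Icc t T))),
    hc.domRestrict.Icc_extend', fun s hs => ?_⟩
  rw [IccExtend_of_mem _ _ hs]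
  exact (hφ.differentiableOn (by norm_num) s hs).hasDerivWithinAt

theorem exists_continuous_eqOn_Icc (htT : t ≤ T) (hφ : ContinuousOn φ (Icc t T)) :
    ∃ ψ : ℝ → ℝ, Continuous ψ ∧ ∀ s ∈ Icc t T, φ s = ψ s :=
  ⟨IccExtend htT ((Icc t T).domRestrict φ), hφ.domRestrict.Icc_extend', fun s hs => by
    rw [IccExtend_of_mem _ _ hs]; rfl⟩

theorem hasDerivAt_integral_of_continuous {G G' : ℝ → ℝ → ℝ} (hG : Continuous (Function.uncurry G))
    (hG' : Continuous (Function.uncurry G')) (hd : ∀ r s, HasDerivAt (fun r => G r s) (G' r s) r)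
    (a b r₀ : ℝ) :
    HasDerivAt (fun r => ∫ s in a..b, G r s) (∫ s in a..b, G' r₀ s) r₀ := by
  obtain ⟨B, hB⟩ := ((isCompact_closedBall r₀ 1).prod
    (isCompact_uIcc (a := a) (b := b))).exists_bound_of_continuousOn hG'.continuousOn
  have hs : ∀ r, Continuous (G r) := fun r => hG.comp (Continuous.prodMk_right r)
  have hs' : ∀ r, Continuous (G' r) := fun r => hG'.comp (Continuous.prodMk_right r)
  refine (intervalIntegral.hasDerivAt_integral_of_dominated_loc_of_deriv_le
    (s := Metric.closedBall r₀ 1) (bound := fun _ => B) (Metric.closedBall_mem_nhds r₀ one_pos)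
    (Filter.Eventually.of_forall fun r => (hs r).aestronglyMeasurable)
    ((hs r₀).intervalIntegrable a b) (hs' r₀).aestronglyMeasurable
    (Filter.Eventually.of_forall fun s hs r hr => hB (r, s) ⟨hr, uIoc_subset_uIcc hs⟩)
    (by simp) (Filter.Eventually.of_forall fun s _ r _ => hd r s)).2

/-- The du Bois-Reymond argument: one test direction suffices, namely the primitive of the quantity
`D` that should vanish. After integration by parts the first variation in that direction is `σ⁻² ∫
D²`. The resulting integral equation shows that `U` is differentiable and gives its end value. -/
theorem IsOptimalPath.exists_control {f g : ℝ → ℝ} {σ x₀ : ℝ} (hf : ContDiff ℝ ∞ f)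
    (hg : ContDiff ℝ ∞ g) (hσ : 0 < σ) (htT : t < T) (hopt : IsOptimalPath f g σ T x₀ t φ)
    (hreg : ContDiffOn ℝ 2 φ (Icc t T)) :
    ∃ U : ℝ → ℝ, Continuous U ∧
      (∀ s ∈ Icc t T, HasDerivWithinAt φ (f (φ s) + U s) (Icc t T) s) ∧
      (∀ s ∈ Icc t T, HasDerivWithinAt U (-(deriv f (φ s) * U s)) (Icc t T) s) ∧
      U T = -σ ^ 2 * deriv g (φ T) := by
  obtain ⟨v, hv, hφv⟩ := exists_continuous_deriv_of_contDiffOn htT hreg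
  obtain ⟨ψ, hψ, hφψ⟩ := exists_continuous_eqOn_Icc htT.le hreg.continuousOn
  have hfc := hf.continuous
  have hf'c := (contDiff_deriv_of_contDiff hf).continuous
  set U : ℝ → ℝ := fun s => v s - f (ψ s) with hU
  have hUc : Continuous U := hv.sub (hfc.comp hψ)
  set q : ℝ → ℝ := fun s => deriv f (ψ s) * U s with hq
  have hqc : Continuous q := (hf'c.comp hψ).mul hUc
  set Q : ℝ → ℝ := fun s => ∫ r in s..T, q r with hQ
  have hQd : ∀ s, HasDerivAt Q (-q s) s := fun s =>
    intervalIntegral.integral_hasDerivAt_left (hqc.intervalIntegrable _ _)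
      (hqc.stronglyMeasurableAtFilter _ _) hqc.continuousAt
  have hQc : Continuous Q := continuous_iff_continuousAt.2 fun s => (hQd s).continuousAt
  set D : ℝ → ℝ := fun s => U s - Q s + σ ^ 2 * deriv g (φ T) with hD
  have hDc : Continuous D := (hUc.sub hQc).add continuous_const
  set η : ℝ → ℝ := fun s => ∫ r in t..s, D r with hη
  have hηd : ∀ s, HasDerivAt η (D s) s := fun s =>
    intervalIntegral.integral_hasDerivAt_right (hDc.intervalIntegrable _ _)
      (hDc.stronglyMeasurableAtFilter _ _) hDc.continuousAt
  have hηc : Continuous η := continuous_iff_continuousAt.2 fun s => (hηd s).continuousAt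
  have hηt : η t = 0 := by simp [hη]
  set J : ℝ → ℝ := fun r => 1 / (2 * σ ^ 2) *
    (∫ s in t..T, (v s + r * D s - f (ψ s + r * η s)) ^ 2) + g (φ T + r * η T) with hJ
  have hact : ∀ r, action f g σ t T (fun s => φ s + r * η s) = J r := fun r => by
    rw [action_eq_of_hasDerivWithinAt (φ := fun s => φ s + r * η s)
      (w := fun s => v s + r * D s) f g σ htT.le fun s hs =>
      (hφv s hs).add ((hηd s).const_mul r).hasDerivWithinAt]
    simp only [hJ]
    congr 2
    refine intervalIntegral.integral_congr fun s hs => ?_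
    rw [uIcc_of_le htT.le] at hs
    simp only [hφψ s hs]
  have hmin : ∀ r, J 0 ≤ J r := fun r => by
    rw [← hact, ← hact]
    simp only [zero_mul, add_zero]
    refine hopt.2.2 _ (isActionPath_of_hasDerivWithinAt (w := fun s => v s + r * D s) htT.le
      (by fun_prop) fun s hs => (hφv s hs).add ((hηd s).const_mul r).hasDerivWithinAt) ?_
    simp [hηt, hopt.2.1]
  have hJd : HasDerivAt J (1 / (2 * σ ^ 2) *
      (∫ s in t..T, 2 * U s * (D s - deriv f (ψ s) * η s)) + deriv g (φ T) * η T) 0 := by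
    have h1 := hasDerivAt_integral_of_continuous
      (G := fun r s => (v s + r * D s - f (ψ s + r * η s)) ^ 2)
      (G' := fun r s => 2 * (v s + r * D s - f (ψ s + r * η s)) *
        (D s - deriv f (ψ s + r * η s) * η s))
      (by simp only [Function.uncurry_def]; fun_prop)
      (by simp only [Function.uncurry_def]; fun_prop)
      (fun r s => by
        have e1 : HasDerivAt (fun r => v s + r * D s) (D s) r := by
          simpa using ((hasDerivAt_id r).mul_const (D s)).const_add (v s)
        have e2 : HasDerivAt (fun r => ψ s + r * η s) (η s) r := by
          simpa using ((hasDerivAt_id r).mul_const (η s)).const_add (ψ s)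
        have e3 := (hasDerivAt_deriv_of_contDiff hf (ψ s + r * η s)).comp r e2
        refine ((e1.sub e3).pow 2).congr_deriv ?_
        simp) t T 0
    have h2 : HasDerivAt (fun r => φ T + r * η T) (η T) 0 := by
      simpa using ((hasDerivAt_id (0 : ℝ)).mul_const (η T)).const_add (φ T)
    have h3 := (hasDerivAt_deriv_of_contDiff hg (φ T + 0 * η T)).comp 0 h2
    have h4 := (h1.const_mul (1 / (2 * σ ^ 2))).add h3
    simp only [zero_mul, add_zero] at h4
    exact h4
  have hcrit := IsLocalMin.hasDerivAt_eq_zero (Filter.Eventually.of_forall hmin) hJd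
  -- Both boundary terms vanish: `Q` is zero at `T` and `η` is zero at `t`.
  have hparts : ∫ s in t..T, q s * η s = ∫ s in t..T, Q s * D s := by
    have := intervalIntegral.integral_mul_deriv_eq_deriv_mul (a := t) (b := T)
      (u := Q) (v := η) (u' := fun s => -q s) (v' := D) (fun s _ => hQd s) (fun s _ => hηd s)
      (hqc.neg.intervalIntegrable _ _) (hDc.intervalIntegrable _ _)
    rw [this, hηt]
    simp [hQ]
  have hsq : ∫ s in t..T, D s ^ 2 = 0 := by
    have i1 : IntervalIntegrable (fun s => U s * D s) volume t T :=
      (hUc.mul hDc).intervalIntegrable _ _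
    have i2 : IntervalIntegrable (fun s => Q s * D s) volume t T :=
      (hQc.mul hDc).intervalIntegrable _ _
    have i3 : IntervalIntegrable (fun s => q s * η s) volume t T :=
      (hqc.mul hηc).intervalIntegrable _ _
    have i4 : IntervalIntegrable (fun s => σ ^ 2 * deriv g (φ T) * D s) volume t T :=
      (hDc.const_mul _).intervalIntegrable _ _
    have e1 : ∫ s in t..T, 2 * U s * (D s - deriv f (ψ s) * η s) =
        2 * ((∫ s in t..T, U s * D s) - ∫ s in t..T, q s * η s) := by
      rw [← intervalIntegral.integral_sub i1 i3, ← intervalIntegral.integral_const_mul]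
      refine intervalIntegral.integral_congr fun s _ => ?_
      simp only [hq]; ring
    have e2 : ∫ s in t..T, D s ^ 2 = (∫ s in t..T, U s * D s) - (∫ s in t..T, Q s * D s) +
        σ ^ 2 * deriv g (φ T) * η T := by
      rw [hη]
      simp only
      rw [← intervalIntegral.integral_const_mul, ← intervalIntegral.integral_sub i1 i2,
        ← intervalIntegral.integral_add (i1.sub i2) i4]
      refine intervalIntegral.integral_congr fun s _ => ?_
      simp only [hD]; ring
    rw [e1, hparts] at hcrit
    rw [e2]
    have hσ2 : σ ^ 2 ≠ 0 := by positivity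
    field_simp at hcrit
    linarith
  have hD0 : ∀ s ∈ Icc t T, D s = 0 := by
    intro s hs
    by_contra hne
    have := intervalIntegral.integral_pos htT (f := fun s => D s ^ 2) (by fun_prop)
      (fun s _ => by positivity) ⟨s, hs, by positivity⟩
    linarith
  have hUQ : ∀ s ∈ Icc t T, U s = Q s - σ ^ 2 * deriv g (φ T) := fun s hs => by
    have := hD0 s hs
    simp only [hD] at this
    linarith
  refine ⟨U, hUc, fun s hs => ?_, fun s hs => ?_, ?_⟩
  · have : f (φ s) + U s = v s := by simp [hU, hφψ s hs]
    rw [this]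
    exact hφv s hs
  · rw [hφψ s hs]
    exact (((hQd s).sub_const (σ ^ 2 * deriv g (φ T))).hasDerivWithinAt).congr hUQ (hUQ s hs)
  · rw [hUQ T (right_mem_Icc.2 htT.le)]
    simp [hQ]

end

/-! ### Optimal paths as members of the extremal field; absence of conjugate points. -/

section

variable {f g F : ℝ → ℝ} {σ t T x₀ ρ : ℝ} {φ U₀ : ℝ → ℝ}

/-- The continuous counterpart of `exists_bound_discretePath`, with the same condition on `ρ`. With
`α = 2K + 1`, the function `e^(-α(s-t)) (1 + φ²) - ∫ U₀²` is nonincreasing, and `g ≥ 0` bounds the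
total control energy by the action. -/
theorem abs_le_of_action_le (hg0 : ∀ x, 0 ≤ g x) {K R B : ℝ} (hσ : 0 < σ)
    (hK : 0 ≤ K) (hgrowth : ∀ x, x * f x ≤ K * (1 + x ^ 2)) (ht : 0 ≤ t) (htT : t ≤ T)
    (hρ : 0 ≤ ρ) (hB : 0 ≤ B)
    (hρ' : (2 + R ^ 2 + 4 * σ ^ 2 * B) * Real.exp ((2 * K + 1) * T) ≤ 1 + ρ ^ 2)
    (hU : Continuous U₀)
    (hφ : ∀ s ∈ Icc t T, HasDerivWithinAt φ (f (φ s) + U₀ s) (Icc t T) s)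
    (h0 : |φ t| ≤ R) (hact : action f g σ t T φ ≤ B) :
    ∀ s ∈ Icc t T, |φ s| ≤ ρ := by
  rw [action_eq_of_hasDerivWithinAt f g σ htT hφ] at hact
  simp only [add_sub_cancel_left] at hact
  have hint : ∫ s in t..T, U₀ s ^ 2 ≤ 2 * σ ^ 2 * B := by
    have := hg0 (φ T)
    have h1 : 1 / (2 * σ ^ 2) * (∫ s in t..T, U₀ s ^ 2) ≤ B := by linarith
    rw [div_mul_eq_mul_div, one_mul, div_le_iff₀ (by positivity)] at h1
    linarith
  set α := 2 * K + 1 with hα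
  have hId : ∀ s, HasDerivAt (fun s => ∫ r in t..s, U₀ r ^ 2) (U₀ s ^ 2) s := fun s =>
    intervalIntegral.integral_hasDerivAt_right ((hU.pow 2).intervalIntegrable _ _)
      ((hU.pow 2).stronglyMeasurableAtFilter _ _) (hU.pow 2).continuousAt
  have hE : ∀ s, HasDerivAt (fun s => Real.exp (-(α * (s - t))))
      (Real.exp (-(α * (s - t))) * -α) s := fun s => by
    have : HasDerivAt (fun s => α * (s - t)) α s := by
      simpa using ((hasDerivAt_id s).sub_const t).const_mul α
    exact this.fun_neg.exp
  have hanti : AntitoneOn (fun s => Real.exp (-(α * (s - t))) * (1 + φ s ^ 2)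
      - ∫ r in t..s, U₀ r ^ 2) (Icc t T) := by
    refine antitoneOn_of_hasDerivWithinAt_nonpos (convex_Icc t T) (f' := fun s =>
      Real.exp (-(α * (s - t))) * -α * (1 + φ s ^ 2)
      + Real.exp (-(α * (s - t))) * (2 * φ s * (f (φ s) + U₀ s)) - U₀ s ^ 2) ?_ ?_ ?_
    · have hφc : ContinuousOn φ (Icc t T) := fun s hs => (hφ s hs).continuousWithinAt
      have hIc : Continuous (fun s => ∫ r in t..s, U₀ r ^ 2) :=
        continuous_iff_continuousAt.2 fun s => (hId s).continuousAt
      fun_prop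
    · intro s hs
      have hs' := interior_subset hs
      have h1 := (((hφ s hs').mono interior_subset).pow 2).const_add 1
      refine (((hE s).hasDerivWithinAt.mul h1).sub (hId s).hasDerivWithinAt).congr_deriv ?_
      simp
    · intro s hs
      have hs' := interior_subset hs
      have hle : Real.exp (-(α * (s - t))) ≤ 1 := by
        rw [Real.exp_le_one_iff]
        have : 0 ≤ α * (s - t) := mul_nonneg (by positivity) (by linarith [hs'.1])
        linarith
      have hpos := (Real.exp_pos (-(α * (s - t)))).le
      have h1 := hgrowth (φ s)
      have h2 : -α * (1 + φ s ^ 2) + 2 * φ s * (f (φ s) + U₀ s) ≤ U₀ s ^ 2 := by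
        nlinarith [sq_nonneg (φ s - U₀ s)]
      have h3 := mul_le_mul_of_nonneg_left h2 hpos
      have h4 : Real.exp (-(α * (s - t))) * U₀ s ^ 2 ≤ 1 * U₀ s ^ 2 := by gcongr
      nlinarith
  intro s hs
  have h1 := hanti (left_mem_Icc.2 htT) hs hs.1
  simp only [sub_self, mul_zero, neg_zero, Real.exp_zero, intervalIntegral.integral_same,
    sub_zero, one_mul] at h1
  have h2 : ∫ r in t..s, U₀ r ^ 2 ≤ ∫ r in t..T, U₀ r ^ 2 :=
    intervalIntegral.integral_mono_interval le_rfl hs.1 hs.2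
      (Filter.Eventually.of_forall fun r => sq_nonneg _) ((hU.pow 2).intervalIntegrable _ _)
  have h3 : φ t ^ 2 ≤ R ^ 2 := sq_le_sq.2 (h0.trans (le_abs_self R))
  have h4 : Real.exp (-(α * (s - t))) * (1 + φ s ^ 2) ≤ 2 + R ^ 2 + 4 * σ ^ 2 * B := by
    have : 0 ≤ σ ^ 2 * B := by positivity
    linarith
  have h5 : 1 + φ s ^ 2 = Real.exp (α * (s - t)) *
      (Real.exp (-(α * (s - t))) * (1 + φ s ^ 2)) := by
    rw [← mul_assoc, ← Real.exp_add]; simp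
  have h6 : Real.exp (α * (s - t)) ≤ Real.exp (α * T) := by
    refine Real.exp_le_exp.2 (mul_le_mul_of_nonneg_left (by linarith [hs.2]) (by positivity))
  have h7 : 1 + φ s ^ 2 ≤ 1 + ρ ^ 2 := by
    rw [h5]
    refine le_trans ?_ hρ'
    rw [mul_comm]
    exact mul_le_mul h4 h6 (Real.exp_pos _).le (by positivity)
  exact abs_le_of_sq_le_sq (by linarith) hρ

theorem isActionPath_const (t T x : ℝ) (htT : t ≤ T) : IsActionPath t T fun _ => x :=
  isActionPath_of_hasDerivWithinAt (w := fun _ => 0) htT continuous_const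
    fun _ _ => hasDerivWithinAt_const _ _ _

theorem action_const (f g : ℝ → ℝ) (σ x : ℝ) (htT : t ≤ T) :
    action f g σ t T (fun _ => x) = (T - t) / (2 * σ ^ 2) * f x ^ 2 + g x := by
  rw [action_eq_of_hasDerivWithinAt (w := fun _ => 0) f g σ htT
    fun _ _ => hasDerivWithinAt_const _ _ _]
  simp
  ring

namespace IsExtremalField

variable {X U η ν : ℝ → ℝ → ℝ}

theorem hasDerivAt_comp_sub {Y : ℝ → ℝ} {y s : ℝ} (h : HasDerivAt Y y (T - s)) :
    HasDerivAt (fun s => Y (T - s)) (-y) s := by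
  have := h.scomp s ((hasDerivAt_id s).const_sub T)
  simpa [Function.comp_def] using this

theorem continuous_X_left (H : IsExtremalField F g σ ρ T X U η ν) (z : ℝ) : Continuous (X z) :=
  H.continuous_X.comp (Continuous.prodMk_right z)

theorem continuous_U_left (H : IsExtremalField F g σ ρ T X U η ν) (z : ℝ) : Continuous (U z) :=
  H.continuous_U.comp (Continuous.prodMk_right z)

theorem continuous_η_left (H : IsExtremalField F g σ ρ T X U η ν) (z : ℝ) : Continuous (η z) :=
  H.continuous_η.comp (Continuous.prodMk_right z)

theorem continuous_ν_left (H : IsExtremalField F g σ ρ T X U η ν) (z : ℝ) : Continuous (ν z) :=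
  H.continuous_ν.comp (Continuous.prodMk_right z)

theorem hasDerivWithinAt_shift (H : IsExtremalField F g σ ρ T X U η ν) (ht : 0 ≤ t) {z : ℝ}
    (hz : z ∈ Icc (-ρ) ρ) (c : ℝ) : ∀ s ∈ Icc t T, HasDerivWithinAt (fun s => X z (T - s) + c)
      (F (X z (T - s)) + U z (T - s)) (Icc t T) s := fun s hs => by
  have := hasDerivAt_comp_sub (H.hasDerivAt_X z hz (T - s)
    ⟨by linarith [hs.2], by linarith [hs.1]⟩)
  rw [neg_neg] at this
  exact (this.add_const c).hasDerivWithinAt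

theorem isActionPath_shift (H : IsExtremalField F g σ ρ T X U η ν) (hF : Continuous F)
    (ht : 0 ≤ t) (htT : t ≤ T) {z : ℝ} (hz : z ∈ Icc (-ρ) ρ) (c : ℝ) :
    IsActionPath t T fun s => X z (T - s) + c := by
  have := H.continuous_X_left z
  have := H.continuous_U_left z
  exact isActionPath_of_hasDerivWithinAt (w := fun s => F (X z (T - s)) + U z (T - s)) htT
    (by fun_prop) (H.hasDerivWithinAt_shift ht hz c)

theorem action_shift (H : IsExtremalField F g σ ρ T X U η ν) (f : ℝ → ℝ)
    (ht : 0 ≤ t) (htT : t ≤ T) {z : ℝ} (hz : z ∈ Icc (-ρ) ρ) (c : ℝ) :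
    action f g σ t T (fun s => X z (T - s) + c) = 1 / (2 * σ ^ 2) *
      (∫ r in (0 : ℝ)..(T - t), (F (X z r) + U z r - f (X z r + c)) ^ 2) + g (z + c) := by
  rw [action_eq_of_hasDerivWithinAt f g σ htT (H.hasDerivWithinAt_shift ht hz c)]
  rw [intervalIntegral.integral_comp_sub_left
    (fun r => (F (X z r) + U z r - f (X z r + c)) ^ 2), sub_self, H.X_zero z hz]

/-- Inside `[-ρ, ρ]` the pair `(φ, U₀)` and the extremal through `φ T` solve the same locally
Lipschitz system and agree at time `T`; uniqueness backward in time does the rest. -/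
theorem eqOn_of_control (H : IsExtremalField F g σ ρ T X U η ν) (hF : ContDiff ℝ ∞ F)
    (hfF : ∀ x, |x| ≤ ρ → F x = f x) (hfF' : ∀ x, |x| ≤ ρ → deriv F x = deriv f x)
    (ht : 0 ≤ t) (hU : Continuous U₀)
    (hφ : ∀ s ∈ Icc t T, HasDerivWithinAt φ (f (φ s) + U₀ s) (Icc t T) s)
    (hUd : ∀ s ∈ Icc t T, HasDerivWithinAt U₀ (-(deriv f (φ s) * U₀ s)) (Icc t T) s)
    (hUT : U₀ T = -σ ^ 2 * deriv g (φ T)) (hφρ : ∀ s ∈ Icc t T, |φ s| ≤ ρ) (htT : t ≤ T) :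
    ∀ s ∈ Icc t T, φ s = X (φ T) (T - s) ∧ U₀ s = U (φ T) (T - s) := by
  have hz : φ T ∈ Icc (-ρ) ρ := abs_le.1 (hφρ T (right_mem_Icc.2 htT))
  obtain ⟨P, hP, hPb⟩ := H.exists_bound
  obtain ⟨P', hPb'⟩ := (isCompact_Icc (a := t) (b := T)).exists_bound_of_continuousOn
    hU.continuousOn
  set S := Metric.closedBall (0 : ℝ × ℝ) (P + |P'| + |ρ|)
  have hF' := contDiff_deriv_of_contDiff hF
  obtain ⟨L, hL⟩ := ContDiffOn.exists_lipschitzOnWith (n := ∞) (s := S)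
    (f := fun y : ℝ × ℝ => (F y.1 + y.2, -(deriv F y.1 * y.2)))
    (ContDiff.contDiffOn (by fun_prop)) (by simp) (convex_closedBall _ _)
    (isCompact_closedBall _ _)
  have hmem : ∀ a b : ℝ, |a| ≤ P + |P'| + |ρ| → |b| ≤ P + |P'| + |ρ| → (a, b) ∈ S := by
    intro a b ha hb
    rw [mem_closedBall_zero_iff, Prod.norm_def]
    exact max_le ha hb
  have a0 := abs_nonneg P'
  have a1 := abs_nonneg ρ
  have hsub : ∀ s ∈ Icc t T, T - s ∈ Icc 0 T := fun s hs =>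
    ⟨by linarith [hs.2], by linarith [hs.1]⟩
  have hφd : ∀ s ∈ Icc t T, HasDerivWithinAt (fun s => (φ s, U₀ s))
      (F (φ s) + U₀ s, -(deriv F (φ s) * U₀ s)) (Icc t T) s := fun s hs => by
    rw [hfF _ (hφρ s hs), hfF' _ (hφρ s hs)]
    exact (hφ s hs).prodMk (hUd s hs)
  have hXd : ∀ s ∈ Icc t T, HasDerivAt (fun s => (X (φ T) (T - s), U (φ T) (T - s)))
      (F (X (φ T) (T - s)) + U (φ T) (T - s),
        -(deriv F (X (φ T) (T - s)) * U (φ T) (T - s))) s := fun s hs => by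
    have h1 := hasDerivAt_comp_sub (H.hasDerivAt_X _ hz _ (hsub s hs))
    rw [neg_neg] at h1
    exact h1.prodMk (hasDerivAt_comp_sub (H.hasDerivAt_U _ hz _ (hsub s hs)))
  have key := ODE_solution_unique_of_mem_Icc_left (a := t) (b := T) (K := L)
    (v := fun _ y => (F y.1 + y.2, -(deriv F y.1 * y.2))) (s := fun _ => S)
    (f := fun s => (φ s, U₀ s)) (g := fun s => (X (φ T) (T - s), U (φ T) (T - s)))
    (fun _ _ => hL) (fun s hs => (hφd s hs).continuousWithinAt)
    (fun s hs => (hφd s (Ioc_subset_Icc_self hs)).mono_of_mem_nhdsWithin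
      (Icc_mem_nhdsLE_of_mem hs))
    (fun s hs => hmem _ _ ((hφρ s (Ioc_subset_Icc_self hs)).trans
      (by linarith [le_abs_self ρ])) ((hPb' s (Ioc_subset_Icc_self hs)).trans
      (by linarith [le_abs_self P'])))
    (fun s hs => (hXd s hs).continuousAt.continuousWithinAt)
    (fun s hs => (hXd s (Ioc_subset_Icc_self hs)).hasDerivWithinAt)
    (fun s hs => by
      obtain ⟨b1, b2, -⟩ := hPb _ hz _ (hsub s (Ioc_subset_Icc_self hs))
      exact hmem _ _ (b1.trans (by linarith)) (b2.trans (by linarith)))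
    (by simp [H.X_zero _ hz, H.U_zero _ hz, hUT])
  intro s hs
  have := key hs
  simpa using this

/-- Jacobi's argument. If `η` vanished at the initial time, it would be an admissible direction.
Along it the integrand of the second variation is the derivative of `η ν`, so only the value at `T`
remains, and this cancels the `g''` term: the second variation would be zero. -/
theorem η_ne_zero (H : IsExtremalField F g σ ρ T X U η ν) (hF : ContDiff ℝ ∞ F)
    (hfF : ∀ x, |x| ≤ ρ → F x = f x)
    (hfF' : ∀ x, |x| ≤ ρ → deriv F x = deriv f x)
    (hfF'' : ∀ x, |x| ≤ ρ → deriv (deriv F) x = deriv (deriv f) x)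
    (hσ : 0 < σ) (ht : 0 ≤ t) (htT : t ≤ T) {z : ℝ} (hz : z ∈ Icc (-ρ) ρ)
    (hφ : ∀ s ∈ Icc t T, φ s = X z (T - s)) (hφρ : ∀ s ∈ Icc t T, |φ s| ≤ ρ)
    (hnd : IsNondegeneratePath f g σ t T φ) : η z (T - t) ≠ 0 := by
  intro h0
  have hXc := H.continuous_X_left z
  have hηc := H.continuous_η_left z
  have hνc := H.continuous_ν_left z
  have hUc := H.continuous_U_left z
  have hF1 := (contDiff_deriv_of_contDiff hF).continuous
  have hF2 := (contDiff_deriv_of_contDiff (contDiff_deriv_of_contDiff hF)).continuous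
  have hsub : ∀ s ∈ Icc t T, T - s ∈ Icc 0 T := fun s hs =>
    ⟨by linarith [hs.2], by linarith [hs.1]⟩
  have hηd : ∀ s ∈ Icc t T, HasDerivAt (fun s => η z (T - s))
      (deriv F (X z (T - s)) * η z (T - s) + ν z (T - s)) s := fun s hs => by
    have := hasDerivAt_comp_sub (H.hasDerivAt_η z hz _ (hsub s hs))
    rwa [neg_neg] at this
  have hηT : η z (T - T) = 1 := by rw [sub_self, H.η_zero z hz]
  have hpos := hnd (fun s => η z (T - s))
    (isActionPath_of_hasDerivWithinAt
      (w := fun s => deriv F (X z (T - s)) * η z (T - s) + ν z (T - s)) htT (by fun_prop)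
      fun s hs => (hηd s hs).hasDerivWithinAt) h0
    ⟨T, right_mem_Icc.2 htT, by rw [hηT]; exact one_ne_zero⟩
  have hφd : ∀ s ∈ Icc t T, HasDerivWithinAt φ
      (F (X z (T - s)) + U z (T - s)) (Icc t T) s := fun s hs => by
    have := H.hasDerivWithinAt_shift ht hz 0 s hs
    simp only [add_zero] at this
    exact this.congr hφ (hφ s hs)
  have hint : ∫ s in t..T, ((deriv (fun s => η z (T - s)) s - deriv f (φ s) * η z (T - s)) ^ 2 -
      (deriv φ s - f (φ s)) * deriv (deriv f) (φ s) * η z (T - s) ^ 2) =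
      -σ ^ 2 * deriv (deriv g) z := by
    have e1 : ∫ s in t..T, ((deriv (fun s => η z (T - s)) s - deriv f (φ s) * η z (T - s)) ^ 2 -
      (deriv φ s - f (φ s)) * deriv (deriv f) (φ s) * η z (T - s) ^ 2) =
      ∫ s in t..T, (ν z (T - s) ^ 2 -
        deriv (deriv F) (X z (T - s)) * U z (T - s) * η z (T - s) ^ 2) := by
      refine intervalIntegral.integral_congr_Ioo_of_le htT fun s hs => ?_
      have hs' := Ioo_subset_Icc_self hs
      have hφs := hφρ s hs'
      rw [(hηd s hs').deriv, deriv_eq_of_hasDerivWithinAt_Icc hφd hs, ← hfF _ hφs, ← hfF' _ hφs,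
        ← hfF'' _ hφs, hφ s hs']
      ring
    rw [e1, intervalIntegral.integral_eq_sub_of_hasDerivAt
      (f := fun s => η z (T - s) * ν z (T - s))]
    · simp only [h0, sub_self, H.η_zero z hz, H.ν_zero z hz]
      ring
    · intro s hs
      rw [uIcc_of_le htT] at hs
      refine ((hηd s hs).mul (hasDerivAt_comp_sub (H.hasDerivAt_ν z hz _ (hsub s hs)))).congr_deriv
        ?_
      ring
    · exact Continuous.intervalIntegrable (by fun_prop) _ _
  unfold secondVariation at hpos
  beta_reduce at hpos
  rw [hint, hηT, hφ T (right_mem_Icc.2 htT), sub_self, H.X_zero z hz] at hpos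
  have : 1 / σ ^ 2 * (-σ ^ 2 * deriv (deriv g) z) + deriv (deriv g) z * 1 ^ 2 = 0 := by
    field_simp
    ring
  linarith

end IsExtremalField

end

/-! ### Near-optimality and compactness. -/

/-- The action of the extremal with end point `z` over a time `τ`. -/
noncomputable def extremalAction (g : ℝ → ℝ) (σ : ℝ) (U : ℝ → ℝ → ℝ) (τ z : ℝ) : ℝ :=
  1 / (2 * σ ^ 2) * (∫ r in (0 : ℝ)..τ, U z r ^ 2) + g z

/-- The action of the extremal with end point `w`, translated so that it starts at `x` when the
time to go is `τ`. -/
noncomputable def shiftedAction (f F g : ℝ → ℝ) (σ : ℝ) (X U : ℝ → ℝ → ℝ) (τ x w : ℝ) : ℝ :=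
  1 / (2 * σ ^ 2) * (∫ r in (0 : ℝ)..τ,
    (F (X w r) + U w r - f (X w r + (x - X w τ))) ^ 2) + g (w + (x - X w τ))

/-- Up to an error `ε`, the extremal with end point `z` starts at `x` when the time to go is `τ`,
stays in `[-ρ, ρ]`, and has at most the action of the translated extremals. -/
structure IsNearlyOptimal (f F g : ℝ → ℝ) (σ ρ R T : ℝ) (X U : ℝ → ℝ → ℝ) (ε τ x z : ℝ) :
    Prop where
  mem_time : τ ∈ Icc 0 T
  abs_start : |x| ≤ R
  mem_end : z ∈ Icc (-ρ) ρ
  abs_path : ∀ q ∈ Icc (0 : ℝ) 1, |X z (q * τ)| ≤ ρ + ε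
  start : |X z τ - x| ≤ ε
  action_le : ∀ w ∈ Icc (-ρ) ρ, extremalAction g σ U τ z ≤ shiftedAction f F g σ X U τ x w + ε

theorem IsNearlyOptimal.mono {f F g : ℝ → ℝ} {σ ρ R T : ℝ} {X U : ℝ → ℝ → ℝ} {ε ε' τ x z : ℝ}
    (h : IsNearlyOptimal f F g σ ρ R T X U ε τ x z) (hε : ε ≤ ε') :
    IsNearlyOptimal f F g σ ρ R T X U ε' τ x z :=
  ⟨h.mem_time, h.abs_start, h.mem_end, fun q hq => (h.abs_path q hq).trans (by linarith),
    h.start.trans hε, fun w hw => (h.action_le w hw).trans (by linarith)⟩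

namespace IsExtremalField

variable {f F g : ℝ → ℝ} {σ ρ R T : ℝ} {X U η ν : ℝ → ℝ → ℝ}

/-- Near-optimality is an intersection of weak inequalities between continuous functions of `(ε, τ,
x, z)`. The path bound uses the rescaled time `q ∈ [0, 1]`, and the competitors are translated to
start exactly at `x`, so both index sets are independent of the point. -/
theorem isClosed_isNearlyOptimal (H : IsExtremalField F g σ ρ T X U η ν) (hF : Continuous F)
    (hf : Continuous f) (hg : Continuous g) :
    IsClosed {p : ℝ × ℝ × ℝ × ℝ |
      IsNearlyOptimal f F g σ ρ R T X U p.1 p.2.1 p.2.2.1 p.2.2.2} := by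
  have hX := H.continuous_X
  have hU := H.continuous_U
  have hX2 : ∀ {a b : ℝ × ℝ × ℝ × ℝ → ℝ}, Continuous a → Continuous b →
      Continuous fun p => X (a p) (b p) := fun ha hb => hX.comp (ha.prodMk hb)
  have hA : Continuous fun p : ℝ × ℝ × ℝ × ℝ => extremalAction g σ U p.2.1 p.2.2.2 := by
    unfold extremalAction
    refine (continuous_const.mul ?_).add (by fun_prop)
    refine intervalIntegral.continuous_parametric_intervalIntegral_of_continuous
      (f := fun (p : ℝ × ℝ × ℝ × ℝ) r => U p.2.2.2 r ^ 2) ?_ (by fun_prop)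
    exact (hU.comp (by fun_prop : Continuous fun q : (ℝ × ℝ × ℝ × ℝ) × ℝ =>
      (q.1.2.2.2, q.2))).pow 2
  have hB : ∀ w, Continuous fun p : ℝ × ℝ × ℝ × ℝ =>
      shiftedAction f F g σ X U p.2.1 p.2.2.1 w := fun w => by
    have hXw := H.continuous_X_left w
    have hUw := H.continuous_U_left w
    unfold shiftedAction
    refine (continuous_const.mul ?_).add (by fun_prop)
    refine intervalIntegral.continuous_parametric_intervalIntegral_of_continuous
      (f := fun (p : ℝ × ℝ × ℝ × ℝ) r =>
        (F (X w r) + U w r - f (X w r + (p.2.2.1 - X w p.2.1))) ^ 2) ?_ (by fun_prop)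
    simp only [Function.uncurry_def]
    fun_prop
  have e : {p : ℝ × ℝ × ℝ × ℝ |
      IsNearlyOptimal f F g σ ρ R T X U p.1 p.2.1 p.2.2.1 p.2.2.2} =
      {p | p.2.1 ∈ Icc 0 T} ∩ {p | |p.2.2.1| ≤ R} ∩ {p | p.2.2.2 ∈ Icc (-ρ) ρ} ∩
      (⋂ q ∈ Icc (0 : ℝ) 1, {p | |X p.2.2.2 (q * p.2.1)| ≤ ρ + p.1}) ∩
      {p | |X p.2.2.2 p.2.1 - p.2.2.1| ≤ p.1} ∩
      ⋂ w ∈ Icc (-ρ) ρ, {p | extremalAction g σ U p.2.1 p.2.2.2 ≤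
        shiftedAction f F g σ X U p.2.1 p.2.2.1 w + p.1} := by
    ext p
    simp only [mem_inter_iff, mem_iInter, mem_ofPred_eq]
    exact ⟨fun h => ⟨⟨⟨⟨⟨h.1, h.2⟩, h.3⟩, h.4⟩, h.5⟩, h.6⟩,
      fun h => ⟨h.1.1.1.1.1, h.1.1.1.1.2, h.1.1.1.2, h.1.1.2, h.1.2, h.2⟩⟩
  rw [e]
  have k1 : Continuous fun p : ℝ × ℝ × ℝ × ℝ => p.1 := by fun_prop
  have k2 : Continuous fun p : ℝ × ℝ × ℝ × ℝ => p.2.1 := by fun_prop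
  have k3 : Continuous fun p : ℝ × ℝ × ℝ × ℝ => p.2.2.1 := by fun_prop
  have k4 : Continuous fun p : ℝ × ℝ × ℝ × ℝ => p.2.2.2 := by fun_prop
  refine (((((isClosed_Icc.preimage k2).inter (isClosed_le k3.abs continuous_const)).inter
    (isClosed_Icc.preimage k4)).inter ?_).inter ?_).inter ?_
  · exact isClosed_biInter fun q _ => isClosed_le
      (hX2 k4 (continuous_const.mul k2)).abs (continuous_const.add k1)
  · exact isClosed_le ((hX2 k4 k2).sub k3).abs k1
  · exact isClosed_biInter fun w _ => isClosed_le hA ((hB w).add k1)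

/-- Two compactness arguments: the hypotheses at error zero persist for small errors as a lower
bound on `|η|` and as closeness of any two nearly optimal end points. On such a short interval the
linear term `η (z' - z)` dominates the quadratic remainder, so `X` is expanding there. -/
theorem exists_uniform_nondegeneracy (H : IsExtremalField F g σ ρ T X U η ν)
    (hF : ContDiff ℝ ∞ F) (hFc : HasCompactSupport F) (hf : Continuous f) (hg : ContDiff ℝ ∞ g)
    (h1 : ∀ τ x z, IsNearlyOptimal f F g σ ρ R T X U 0 τ x z → η z τ ≠ 0)
    (h2 : ∀ τ x z z', IsNearlyOptimal f F g σ ρ R T X U 0 τ x z →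
      IsNearlyOptimal f F g σ ρ R T X U 0 τ x z' → z = z') :
    ∃ ε c, 0 < ε ∧ 0 < c ∧
      (∀ τ x z, IsNearlyOptimal f F g σ ρ R T X U ε τ x z → c ≤ |η z τ|) ∧
      ∀ τ x z z', IsNearlyOptimal f F g σ ρ R T X U ε τ x z →
        IsNearlyOptimal f F g σ ρ R T X U ε τ x z' → c * |z' - z| ≤ |X z' τ - X z τ| := by
  have hcl := H.isClosed_isNearlyOptimal (R := R) hF.continuous hf hg.continuous
  have part1 : ∃ ε c, 0 < ε ∧ 0 < c ∧
      ∀ τ x z, IsNearlyOptimal f F g σ ρ R T X U ε τ x z → c ≤ |η z τ| := by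
    have hK : IsCompact ((Icc (0 : ℝ) 1 ×ˢ Icc 0 T ×ˢ Icc (-R) R ×ˢ Icc (-ρ) ρ) ∩
        {p : ℝ × ℝ × ℝ × ℝ |
          IsNearlyOptimal f F g σ ρ R T X U p.1 p.2.1 p.2.2.1 p.2.2.2}) :=
      (isCompact_Icc.prod (isCompact_Icc.prod (isCompact_Icc.prod isCompact_Icc))).inter_right hcl
    have hη : Continuous fun p : ℝ × ℝ × ℝ × ℝ => η p.2.2.2 p.2.1 :=
      H.continuous_η.comp (by fun_prop : Continuous fun p : ℝ × ℝ × ℝ × ℝ => (p.2.2.2, p.2.1))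
    -- The sum is positive everywhere on the compact set: either `ε > 0`, or `ε = 0` and `η ≠ 0`.
    -- Where `ε ≤ m / 2`, the other half of the minimum must come from `|η|`.
    obtain ⟨m, hm, hmin⟩ := hK.exists_forall_le' (f := fun p => p.1 + |η p.2.2.2 p.2.1|)
      (a := 0) (continuous_fst.add hη.abs).continuousOn (by
        rintro ⟨ε, τ, x, z⟩ ⟨⟨hε, -⟩, hp⟩
        simp only at hε hp ⊢
        rcases hε.1.eq_or_lt with h0 | h0
        · rw [← h0] at hp ⊢
          have := abs_pos.2 (h1 τ x z hp)
          linarith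
        · have := abs_nonneg (η z τ)
          linarith)
    refine ⟨min 1 (m / 2), m / 2, lt_min one_pos (by linarith), by linarith,
      fun τ x z hp => ?_⟩
    have := hmin (min 1 (m / 2), τ, x, z) ⟨⟨⟨le_min zero_le_one (by linarith), min_le_left _ _⟩,
      hp.mem_time, abs_le.1 hp.abs_start, hp.mem_end⟩, hp⟩
    simp only at this
    linarith [min_le_right 1 (m / 2)]
  have part2 : ∀ δ > 0, ∃ ε, 0 < ε ∧ ∀ τ x z z', IsNearlyOptimal f F g σ ρ R T X U ε τ x z →
        IsNearlyOptimal f F g σ ρ R T X U ε τ x z' → |z' - z| ≤ δ := by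
    intro δ hδ
    have hK : IsCompact ((Icc (0 : ℝ) 1 ×ˢ Icc 0 T ×ˢ Icc (-R) R ×ˢ Icc (-ρ) ρ ×ˢ Icc (-ρ) ρ) ∩
        {p : ℝ × ℝ × ℝ × ℝ × ℝ |
          IsNearlyOptimal f F g σ ρ R T X U p.1 p.2.1 p.2.2.1 p.2.2.2.1 ∧
          IsNearlyOptimal f F g σ ρ R T X U p.1 p.2.1 p.2.2.1 p.2.2.2.2 ∧
          δ ≤ |p.2.2.2.2 - p.2.2.2.1|}) := by
      refine (isCompact_Icc.prod (isCompact_Icc.prod (isCompact_Icc.prod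
        (isCompact_Icc.prod isCompact_Icc)))).inter_right ?_
      refine (hcl.preimage (by fun_prop : Continuous fun p : ℝ × ℝ × ℝ × ℝ × ℝ =>
        (p.1, p.2.1, p.2.2.1, p.2.2.2.1))).inter ((hcl.preimage (by fun_prop : Continuous
        fun p : ℝ × ℝ × ℝ × ℝ × ℝ => (p.1, p.2.1, p.2.2.1, p.2.2.2.2))).inter
        (isClosed_le continuous_const (by fun_prop : Continuous fun p : ℝ × ℝ × ℝ × ℝ × ℝ =>
          |p.2.2.2.2 - p.2.2.2.1|)))
    obtain ⟨m, hm, hmin⟩ := hK.exists_forall_le' (f := fun p => p.1)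
      (a := 0) (by fun_prop) (by
        rintro ⟨ε, τ, x, z, z'⟩ ⟨⟨hε, -⟩, hp, hp', hd⟩
        simp only at hε hp hp' hd ⊢
        rcases hε.1.eq_or_lt with h0 | h0
        · rw [← h0] at hp hp'
          rw [h2 τ x z z' hp hp', sub_self, abs_zero] at hd
          linarith
        · exact h0)
    refine ⟨min 1 (m / 2), lt_min one_pos (by linarith), fun τ x z z' hp hp' => ?_⟩
    by_contra hlt
    have := hmin (min 1 (m / 2), τ, x, z, z') ⟨⟨⟨le_min zero_le_one (by linarith),
      min_le_left _ _⟩, hp.mem_time, abs_le.1 hp.abs_start, hp.mem_end, hp'.mem_end⟩, hp, hp',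
      (not_le.1 hlt).le⟩
    simp only at this
    linarith [min_le_right 1 (m / 2)]
  obtain ⟨ε₁, c, hε₁, hc, hη⟩ := part1
  obtain ⟨C, hC, hsq⟩ := H.exists_abs_sub_le_sq hF hFc hg
  -- At this distance `C |z' - z| ≤ c / 2`, so the remainder consumes at most half of the linear
  -- growth.
  obtain ⟨ε₂, hε₂, hz⟩ := part2 (c / (2 * (C + 1))) (by positivity)
  refine ⟨min ε₁ ε₂, c / 2, lt_min hε₁ hε₂, by linarith,
    fun τ x z hp => (by linarith : c / 2 ≤ c).trans (hη τ x z (hp.mono (min_le_left _ _))),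
    fun τ x z z' hp hp' => ?_⟩
  have a1 := hη τ x z (hp.mono (min_le_left _ _))
  have a2 := hz τ x z z' (hp.mono (min_le_right _ _)) (hp'.mono (min_le_right _ _))
  have a3 := hsq z hp.mem_end z' hp'.mem_end τ hp.mem_time
  have a4 : C * (z' - z) ^ 2 ≤ c / 2 * |z' - z| := by
    rw [← sq_abs, sq, ← mul_assoc]
    gcongr
    calc C * |z' - z| ≤ (C + 1) * (c / (2 * (C + 1))) := by gcongr; linarith
      _ = c / 2 := by field_simp
  have a5 : |η z τ * (z' - z)| ≤ |X z' τ - X z τ| + C * (z' - z) ^ 2 := by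
    have := abs_sub_abs_le_abs_sub (η z τ * (z' - z)) (X z' τ - X z τ)
    rw [abs_sub_comm (η z τ * (z' - z))] at this
    linarith
  rw [abs_mul] at a5
  have a6 : c * |z' - z| ≤ |η z τ| * |z' - z| := by gcongr
  linarith

end IsExtremalField

/-! ### Comparison of discrete and continuous actions. -/

namespace IsExtremalField

variable {f F g : ℝ → ℝ} {σ ρ R T : ℝ} {X U η ν : ℝ → ℝ → ℝ}

/-- The competitor is the translated extremal sampled on the grid. By the mean value theorem each
difference quotient is a value of `F(X) + U` inside its cell, so the discrete action is a perturbed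
Riemann sum. The translate may leave `[-ρ, ρ]`, which is why both `f` and `F` appear. -/
theorem exists_discreteAction_sub_shiftedAction_le (H : IsExtremalField F g σ ρ T X U η ν)
    (hF : ContDiff ℝ ∞ F) (hFc : HasCompactSupport F) (hf : ContDiff ℝ ∞ f) (R : ℝ) :
    ∃ C, 0 ≤ C ∧ ∀ h, 0 < h → ∀ M : ℕ, M * h ≤ T → ∀ x, |x| ≤ R → ∀ w ∈ Icc (-ρ) ρ,
      ∃ y : Fin M → ℝ,
        |discreteAction f g σ h x y - shiftedAction f F g σ X U (M * h) x w| ≤ C * h := by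
  obtain ⟨L, hL, hF0, hF1, -⟩ := exists_bound_derivs hF hFc
  obtain ⟨P, hP, hPb⟩ := H.exists_bound
  obtain ⟨Ct, hCt, hlip⟩ := H.exists_lipschitz_time hF hFc
  have hf' := contDiff_deriv_of_contDiff hf
  set Q := 2 * P + |R| with hQ
  obtain ⟨A₀, hA₀⟩ := (isCompact_Icc (a := -Q) (b := Q)).exists_bound_of_continuousOn
    hf.continuous.continuousOn
  obtain ⟨A₁, hA₁⟩ := (isCompact_Icc (a := -Q) (b := Q)).exists_bound_of_continuousOn
    hf'.continuous.continuousOn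
  simp only [Real.norm_eq_abs] at hA₀ hA₁
  have hQ0 : 0 ≤ Q := by positivity
  have h0Q : (0 : ℝ) ∈ Icc (-Q) Q := ⟨by linarith, hQ0⟩
  have hA₀0 : 0 ≤ A₀ := (abs_nonneg _).trans (hA₀ 0 h0Q)
  have hA₁0 : 0 ≤ A₁ := (abs_nonneg _).trans (hA₁ 0 h0Q)
  refine ⟨1 / (2 * σ ^ 2) * (2 * (L + P + A₀) * ((L + 1 + A₁) * Ct) * |T|), by positivity,
    fun h hh M hM x hx w hw => ?_⟩
  have hXc := H.continuous_X_left w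
  have hUc := H.continuous_U_left w
  have hM0 : (0 : ℝ) ≤ M * h := by positivity
  have hPX : ∀ r ∈ Icc 0 T, |X w r| ≤ P := fun r hr => (hPb w hw r hr).1
  have hPU : ∀ r ∈ Icc 0 T, |U w r| ≤ P := fun r hr => (hPb w hw r hr).2.1
  set c := x - X w (M * h) with hc
  have hcQ : |c| ≤ P + |R| := by
    have := abs_sub x (X w (M * h))
    have := hPX (M * h) ⟨hM0, hM⟩
    have := le_abs_self R
    linarith
  have hmem : ∀ r ∈ Icc 0 T, X w r + c ∈ Icc (-Q) Q := fun r hr => by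
    have := abs_add_le (X w r) c
    have := hPX r hr
    exact abs_le.1 (by linarith)
  let v : ℕ → ℝ := fun k => X w ((M - k) * h) + c
  have hv0 : v 0 = x := by simp [v, hc]
  have hvM : v M = w + c := by simp [v, H.X_zero w hw]
  refine ⟨fun j => v (j + 1), ?_⟩
  rw [discreteAction_eq_sum_range (x := v) fun i => by rw [← hv0]; exact discretePath_of_seq v i]
  -- Steps are counted by time to go, so the step starts at `(j + 1) h`, which is where the explicit
  -- scheme evaluates `f`.
  let a : ℕ → ℝ := fun j => (X w (j * h) - X w ((j + 1 : ℕ) * h)) / h -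
    f (X w ((j + 1 : ℕ) * h) + c)
  have hsum : ∑ k ∈ Finset.range M, ((v (k + 1) - v k) / h - f (v k)) ^ 2 =
      ∑ j ∈ Finset.range M, a j ^ 2 := by
    rw [← Finset.sum_range_reflect]
    refine Finset.sum_congr rfl fun j hj => ?_
    have hj' := Finset.mem_range.1 hj
    have e1 : ((M : ℝ) - ((M - 1 - j : ℕ) : ℝ)) = (j + 1 : ℕ) := by
      rw [sub_eq_iff_eq_add]; norm_cast; omega
    have e2 : ((M : ℝ) - ((M - 1 - j + 1 : ℕ) : ℝ)) = j := by
      rw [sub_eq_iff_eq_add]; norm_cast; omega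
    simp only [v, a, e1, e2]
    ring
  have hcell : ∀ j < M, ∀ r ∈ Icc ((j : ℝ) * h) ((j + 1 : ℕ) * h), r ∈ Icc 0 T := by
    intro j hj r hr
    have h1 : ((j + 1 : ℕ) : ℝ) * h ≤ M * h := by gcongr; exact_mod_cast hj
    have h2 : (0 : ℝ) ≤ j * h := by positivity
    exact ⟨h2.trans hr.1, hr.2.trans (h1.trans hM)⟩
  have hlen : ∀ j : ℕ, ((j + 1 : ℕ) : ℝ) * h = j * h + h := fun j => by push_cast; ring
  have hmvt : ∀ j < M, ∃ ξ ∈ Icc ((j : ℝ) * h) ((j + 1 : ℕ) * h),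
      a j = F (X w ξ) + U w ξ - f (X w ((j + 1 : ℕ) * h) + c) := by
    intro j hj
    obtain ⟨ξ, hξ, hξ'⟩ := exists_hasDerivAt_eq_slope (X w) (fun r => -(F (X w r) + U w r))
      (a := j * h) (b := (j + 1 : ℕ) * h) (by rw [hlen]; linarith) hXc.continuousOn
      fun r hr => H.hasDerivAt_X w hw r (hcell j hj r (Ioo_subset_Icc_self hr))
    refine ⟨ξ, Ioo_subset_Icc_self hξ, ?_⟩
    have : ((j + 1 : ℕ) : ℝ) * h - j * h = h := by rw [hlen]; ring
    rw [this] at hξ'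
    simp only [a]
    rw [← neg_sub (X w ((j + 1 : ℕ) * h)), neg_div, ← hξ', neg_neg]
  have hright : ∀ j : ℕ, ((j + 1 : ℕ) : ℝ) * h ∈ Icc ((j : ℝ) * h) ((j + 1 : ℕ) * h) :=
    fun j => ⟨by rw [hlen]; linarith, le_rfl⟩
  have hdist : ∀ j : ℕ, ∀ r ∈ Icc ((j : ℝ) * h) ((j + 1 : ℕ) * h),
      ∀ s ∈ Icc ((j : ℝ) * h) ((j + 1 : ℕ) * h), |r - s| ≤ h := by
    intro j r hr s hs
    rw [hlen] at hr hs
    exact abs_le.2 ⟨by linarith [hr.1, hs.2], by linarith [hr.2, hs.1]⟩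
  have key := abs_sum_sub_integral_le (M := M) (K := L + P + A₀) (a := a)
    (G := fun r => F (X w r) + U w r - f (X w r + c)) (δ := (L + 1 + A₁) * (Ct * h)) hh.le
    (by have := hF.continuous; have := hf.continuous; fun_prop)
    (fun r hr => by
      have hr' : r ∈ Icc 0 T := ⟨hr.1, hr.2.trans hM⟩
      have b1 := abs_sub (F (X w r) + U w r) (f (X w r + c))
      have b2 := abs_add_le (F (X w r)) (U w r)
      linarith [hF0 (X w r), hPU r hr', hA₀ _ (hmem r hr')])
    (fun j hj => by
      obtain ⟨ξ, hξ, e⟩ := hmvt j hj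
      have b1 := abs_sub (F (X w ξ) + U w ξ) (f (X w ((j + 1 : ℕ) * h) + c))
      have b2 := abs_add_le (F (X w ξ)) (U w ξ)
      rw [e]
      linarith [hF0 (X w ξ), hPU ξ (hcell j hj ξ hξ),
        hA₀ _ (hmem _ (hcell j hj _ (hright j)))])
    (fun j hj r hr => by
      obtain ⟨ξ, hξ, e⟩ := hmvt j hj
      have hr' := hcell j hj r hr
      have hξ' := hcell j hj ξ hξ
      have hs' := hcell j hj _ (hright j)
      obtain ⟨c1, c2⟩ := hlip w hw ξ hξ' r hr'
      have c3 := (hlip w hw _ hs' r hr').1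
      have d1 : Ct * |ξ - r| ≤ Ct * h := by gcongr; exact hdist j ξ hξ r hr
      have d2 : Ct * |((j + 1 : ℕ) : ℝ) * h - r| ≤ Ct * h := by
        gcongr; exact hdist j _ (hright j) r hr
      have e1 : |F (X w ξ) - F (X w r)| ≤ L * |X w ξ - X w r| :=
        abs_sub_le_of_abs_deriv_le hF convex_univ (fun x _ => hF1 x) (mem_univ _) (mem_univ _)
      have e2 : |f (X w ((j + 1 : ℕ) * h) + c) - f (X w r + c)| ≤
          A₁ * |X w ((j + 1 : ℕ) * h) + c - (X w r + c)| :=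
        abs_sub_le_of_abs_deriv_le hf (convex_Icc (-Q) Q) hA₁ (hmem _ hs') (hmem _ hr')
      rw [add_sub_add_right_eq_sub] at e2
      have e3 : L * |X w ξ - X w r| ≤ L * (Ct * h) := by gcongr; linarith
      have e4 : A₁ * |X w ((j + 1 : ℕ) * h) - X w r| ≤ A₁ * (Ct * h) := by gcongr; linarith
      have e5 := abs_sub (F (X w ξ) - F (X w r) + (U w ξ - U w r))
        (f (X w ((j + 1 : ℕ) * h) + c) - f (X w r + c))
      have e6 := abs_add_le (F (X w ξ) - F (X w r)) (U w ξ - U w r)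
      rw [e]
      calc _ = |F (X w ξ) - F (X w r) + (U w ξ - U w r) -
            (f (X w ((j + 1 : ℕ) * h) + c) - f (X w r + c))| := by ring_nf
        _ ≤ _ := by linarith)
  rw [hsum, hvM]
  unfold shiftedAction
  rw [← hc, add_sub_add_right_eq_sub, div_mul_eq_mul_div,
    show ∀ S : ℝ, S / (2 * σ ^ 2) = 1 / (2 * σ ^ 2) * S from fun S => by ring, ← mul_sub, abs_mul,
    abs_of_nonneg (by positivity : 0 ≤ 1 / (2 * σ ^ 2)), mul_assoc]
  gcongr
  refine key.trans ?_
  have : (M : ℝ) * h ≤ |T| := hM.trans (le_abs_self T)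
  calc 2 * (L + P + A₀) * ((L + 1 + A₁) * (Ct * h)) * (M * h)
      ≤ 2 * (L + P + A₀) * ((L + 1 + A₁) * (Ct * h)) * |T| := by gcongr
    _ = _ := by ring

theorem exists_discreteAction_sub_extremalAction_le (H : IsExtremalField F g σ ρ T X U η ν)
    (hF : ContDiff ℝ ∞ F) (hFc : HasCompactSupport F) (hg : ContDiff ℝ ∞ g) (hρ : 0 ≤ ρ)
    (hT : 0 < T) :
    ∃ C h₀, 0 ≤ C ∧ 0 < h₀ ∧ ∀ h, 0 < h → h ≤ h₀ → ∀ M : ℕ, M * h ≤ T → ∀ q p e n,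
      IsDiscreteExtremal F g σ h M q p e n → (∀ k ≤ M, |q k| ≤ ρ) →
      |h / (2 * σ ^ 2) * ∑ k ∈ Finset.range M, p (k + 1) ^ 2 + g (q M) -
        extremalAction g σ U (M * h) (q M)| ≤ C * h := by
  obtain ⟨P, h₁, hP, hh₁, hPb⟩ := IsDiscreteExtremal.exists_bound hF hFc hg σ hρ T
  obtain ⟨P', hP', hPb'⟩ := H.exists_bound
  obtain ⟨Ct, hCt, hlip⟩ := H.exists_lipschitz_time hF hFc
  obtain ⟨C, h₂, hC, hh₂, herr⟩ := H.exists_discretization_error hF hFc hg hρ hT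
  refine ⟨1 / (2 * σ ^ 2) * (2 * (P + P') * (C + Ct) * T), min h₁ h₂, by positivity,
    lt_min hh₁ hh₂, fun h hh hh0 M hM q p e n hq hqρ => ?_⟩
  have hz : q M ∈ Icc (-ρ) ρ := abs_le.1 (hqρ M le_rfl)
  have hUc := H.continuous_U_left (q M)
  have hsum : ∑ k ∈ Finset.range M, p (k + 1) ^ 2 = ∑ j ∈ Finset.range M, p (M - j) ^ 2 := by
    rw [← Finset.sum_range_reflect]
    refine Finset.sum_congr rfl fun j hj => ?_
    have hj' := Finset.mem_range.1 hj
    rw [show M - 1 - j + 1 = M - j by omega]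
  have key := abs_sum_sub_integral_le (M := M) (K := P + P') (a := fun j => p (M - j))
    (G := U (q M)) (δ := (C + Ct) * h) hh.le hUc
    (fun r hr => ((hPb' _ hz r ⟨hr.1, hr.2.trans hM⟩).2.1).trans (by linarith))
    (fun j hj => ((hPb h hh (hh0.trans (min_le_left _ _)) M hM q p e n hq hqρ (M - j)
      (Nat.sub_le _ _)).1).trans (by linarith))
    (fun j hj r hr => by
      have h1 : ((j + 1 : ℕ) : ℝ) * h ≤ M * h := by gcongr; exact_mod_cast hj
      have h2 : (0 : ℝ) ≤ j * h := by positivity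
      have h3 : ((j + 1 : ℕ) : ℝ) * h = j * h + h := by push_cast; ring
      have h4 := (herr h hh (hh0.trans (min_le_right _ _)) M hM q p e n hq hqρ (M - j)
        (Nat.sub_le _ _)).2.1
      rw [Nat.cast_sub hj.le, sub_sub_cancel] at h4
      have h5 := (hlip _ hz (j * h) ⟨h2, by linarith⟩ r
        ⟨h2.trans hr.1, by linarith [hr.2]⟩).2
      have h6 : Ct * |j * h - r| ≤ Ct * h := by
        gcongr
        exact abs_le.2 ⟨by linarith [hr.2], by linarith [hr.1]⟩
      have h7 := abs_sub_le (p (M - j)) (U (q M) (j * h)) (U (q M) r)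
      linarith)
  rw [hsum]
  unfold extremalAction
  rw [add_sub_add_right_eq_sub, div_mul_eq_mul_div,
    show ∀ S : ℝ, S / (2 * σ ^ 2) = 1 / (2 * σ ^ 2) * S from fun S => by ring, ← mul_sub, abs_mul,
    abs_of_nonneg (by positivity : 0 ≤ 1 / (2 * σ ^ 2)), mul_assoc]
  gcongr
  refine key.trans ?_
  calc 2 * (P + P') * ((C + Ct) * h) * (M * h) ≤ 2 * (P + P') * ((C + Ct) * h) * T := by gcongr
    _ = _ := by ring

/-- The extremal through the discrete end point inherits everything up to `O(h)`: start and
confinement from the discretization error, and the action inequality by minimality of `y` against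
the sampled competitors. -/
theorem exists_isNearlyOptimal (H : IsExtremalField F g σ ρ T X U η ν)
    (hF : ContDiff ℝ ∞ F) (hFc : HasCompactSupport F) (hf : ContDiff ℝ ∞ f) (hg : ContDiff ℝ ∞ g)
    (hfF : ∀ x, |x| ≤ ρ → F x = f x) (hρ : 0 ≤ ρ) (hT : 0 < T) (R : ℝ) :
    ∃ C h₀, 0 ≤ C ∧ 0 < h₀ ∧ ∀ h, 0 < h → h ≤ h₀ → ∀ M : ℕ, M * h ≤ T → ∀ q p e n,
      IsDiscreteExtremal F g σ h M q p e n → (∀ k ≤ M, |q k| ≤ ρ) → ∀ x, |x| ≤ R →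
      ∀ y : Fin M → ℝ, IsDiscreteOptimalPath f g σ h x y →
      (∀ i : Fin (M + 1), discretePath x y i = q i) →
      IsNearlyOptimal f F g σ ρ R T X U (C * h) (M * h) x (q M) := by
  obtain ⟨C₁, hC₁, hcomp⟩ := H.exists_discreteAction_sub_shiftedAction_le hF hFc hf R
  obtain ⟨C₂, h₂, hC₂, hh₂, hext⟩ := H.exists_discreteAction_sub_extremalAction_le hF hFc hg hρ hT
  obtain ⟨C₃, h₃, hC₃, hh₃, herr⟩ := H.exists_discretization_error hF hFc hg hρ hT
  obtain ⟨Ct, hCt, hlip⟩ := H.exists_lipschitz_time hF hFc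
  refine ⟨C₁ + C₂ + C₃ + Ct, min h₂ h₃, by positivity, lt_min hh₂ hh₃,
    fun h hh hh0 M hM q p e n hq hqρ x hx y hy hyq => ?_⟩
  have hz : q M ∈ Icc (-ρ) ρ := abs_le.1 (hqρ M le_rfl)
  have hM0 : (0 : ℝ) ≤ M * h := by positivity
  have herr' := fun k hk => (herr h hh (hh0.trans (min_le_right _ _)) M hM q p e n hq hqρ k hk).1
  have p1 := mul_nonneg hC₁ hh.le
  have p2 := mul_nonneg hC₂ hh.le
  have p3 := mul_nonneg hC₃ hh.le
  have p4 := mul_nonneg hCt hh.le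
  refine ⟨⟨hM0, hM⟩, hx, hz, fun s hs => ?_, ?_, fun w hw => ?_⟩
  · have hr0 : 0 ≤ s * (M * h) := mul_nonneg hs.1 hM0
    have hrM : s * (M * h) ≤ M * h := mul_le_of_le_one_left hM0 hs.2
    set r := s * (M * h) with hr
    -- The grid time just below `r`; the Lipschitz bound in time covers the remainder, which is less
    -- than `h`.
    set j := ⌊r / h⌋₊ with hj
    have j1 : j * h ≤ r := (le_div_iff₀ hh).1 (Nat.floor_le (by positivity))
    have j2 : r < (j + 1) * h := (div_lt_iff₀ hh).1 (Nat.lt_floor_add_one _)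
    have j3 : j ≤ M := by
      have : (j : ℝ) * h ≤ M * h := j1.trans hrM
      exact_mod_cast le_of_mul_le_mul_right this hh
    have h4 := herr' (M - j) (Nat.sub_le _ _)
    rw [Nat.cast_sub j3, sub_sub_cancel] at h4
    have h5 := (hlip _ hz r ⟨hr0, hrM.trans hM⟩ (j * h) ⟨by positivity, by linarith⟩).1
    have h6 : Ct * |r - j * h| ≤ Ct * h := by
      gcongr
      exact abs_le.2 ⟨by linarith, by linarith⟩
    have h7 := hqρ (M - j) (Nat.sub_le _ _)
    have h8 := abs_sub_abs_le_abs_sub (X (q M) r) (q (M - j))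
    have h9 := abs_sub_le (X (q M) r) (X (q M) (j * h)) (q (M - j))
    rw [abs_sub_comm (X (q M) (j * h))] at h9
    linarith
  · have h1 := herr' 0 (Nat.zero_le _)
    have h2 : q 0 = x := by
      have := hyq 0
      simpa [discretePath] using this.symm
    rw [h2, Nat.cast_zero, sub_zero, abs_sub_comm] at h1
    linarith
  · obtain ⟨v, hv⟩ := hcomp h hh M hM x hx w hw
    have h1 := hy v
    have h2 := hext h hh (hh0.trans (min_le_left _ _)) M hM q p e n hq hqρ
    have h3 : discreteAction f g σ h x y =
        h / (2 * σ ^ 2) * ∑ k ∈ Finset.range M, p (k + 1) ^ 2 + g (q M) := by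
      rw [discreteAction_eq_sum_range hyq]
      congr 2
      refine Finset.sum_congr rfl fun k hk => ?_
      have hk' := Finset.mem_range.1 hk
      rw [hq.q_step k hk', hfF _ (hqρ k hk'.le)]
      field_simp
      ring
    rw [← h3] at h2
    have h4 := abs_le.1 h2
    have h5 := abs_le.1 hv
    linarith

end IsExtremalField

/-! ### Exact near-optimality is optimality. -/

theorem exists_compactSupport_eqOn {f : ℝ → ℝ} (hf : ContDiff ℝ ∞ f) {ρ : ℝ} (hρ : 0 ≤ ρ) :
    ∃ F : ℝ → ℝ, ContDiff ℝ ∞ F ∧ HasCompactSupport F ∧ (∀ x, |x| ≤ ρ → F x = f x) ∧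
      (∀ x, |x| ≤ ρ → deriv F x = deriv f x) ∧
      ∀ x, |x| ≤ ρ → deriv (deriv F) x = deriv (deriv f) x := by
  let χ : ContDiffBump (0 : ℝ) := ⟨ρ + 1, ρ + 2, by linarith, by linarith⟩
  have h : ∀ x, |x| ≤ ρ → (fun x => χ x * f x) =ᶠ[nhds x] f := fun x hx => by
    filter_upwards [Metric.isOpen_ball.mem_nhds
      (show x ∈ Metric.ball (0 : ℝ) (ρ + 1) by rw [mem_ball_zero_iff, Real.norm_eq_abs]; linarith)]
      with y hy
    rw [χ.one_of_mem_closedBall (Metric.ball_subset_closedBall hy), one_mul]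
  exact ⟨fun x => χ x * f x, χ.contDiff.mul hf, χ.hasCompactSupport.mul_right,
    fun x hx => (h x hx).eq_of_nhds, fun x hx => (h x hx).deriv_eq,
    fun x hx => (h x hx).deriv.deriv_eq⟩

namespace IsExtremalField

variable {f F g : ℝ → ℝ} {σ ρ R T t x z : ℝ} {X U η ν : ℝ → ℝ → ℝ} {φ : ℝ → ℝ}

theorem action_eq_extremalAction (H : IsExtremalField F g σ ρ T X U η ν)
    (hfF : ∀ x, |x| ≤ ρ → F x = f x) (ht : 0 ≤ t) (htT : t ≤ T) (hz : z ∈ Icc (-ρ) ρ)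
    (hφ : ∀ s ∈ Icc t T, φ s = X z (T - s)) (hφρ : ∀ s ∈ Icc t T, |φ s| ≤ ρ) :
    action f g σ t T φ = extremalAction g σ U (T - t) z := by
  have hd : ∀ s ∈ Icc t T, HasDerivWithinAt φ (F (X z (T - s)) + U z (T - s)) (Icc t T) s :=
    fun s hs => by
      have := H.hasDerivWithinAt_shift ht hz 0 s hs
      simp only [add_zero] at this
      exact this.congr hφ (hφ s hs)
  rw [action_eq_of_hasDerivWithinAt f g σ htT hd, hφ T (right_mem_Icc.2 htT), sub_self,
    H.X_zero z hz]
  unfold extremalAction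
  congr 2
  have e : ∫ s in t..T, (F (X z (T - s)) + U z (T - s) - f (φ s)) ^ 2 =
      ∫ s in t..T, U z (T - s) ^ 2 := by
    refine intervalIntegral.integral_congr_Ioo_of_le htT fun s hs => ?_
    have hs' := Ioo_subset_Icc_self hs
    rw [← hfF _ (hφρ s hs'), hφ s hs', add_sub_cancel_left]
  rw [e, intervalIntegral.integral_comp_sub_left (fun r => U z r ^ 2), sub_self]

/-- Comparison with the constant path bounds the action by `B`, hence the path by `ρ`; then the
Euler-Lagrange equations place it in the field. -/
theorem eqOn_of_isOptimalPath (H : IsExtremalField F g σ ρ T X U η ν) (hF : ContDiff ℝ ∞ F)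
    (hfF : ∀ x, |x| ≤ ρ → F x = f x) (hfF' : ∀ x, |x| ≤ ρ → deriv F x = deriv f x)
    (hf : ContDiff ℝ ∞ f) (hg : ContDiff ℝ ∞ g) (hg0 : ∀ x, 0 ≤ g x) (hσ : 0 < σ) {K B : ℝ}
    (hK : 0 ≤ K) (hgrowth : ∀ x, x * f x ≤ K * (1 + x ^ 2)) (hρ : 0 ≤ ρ) (hB0 : 0 ≤ B)
    (hB : ∀ x, |x| ≤ R → T / (2 * σ ^ 2) * f x ^ 2 + g x ≤ B)
    (hρ' : (2 + R ^ 2 + 4 * σ ^ 2 * B) * Real.exp ((2 * K + 1) * T) ≤ 1 + ρ ^ 2)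
    (ht : t ∈ Ico 0 T) (hx : |x| ≤ R) (hopt : IsOptimalPath f g σ T x t φ)
    (hreg : ContDiffOn ℝ 2 φ (Icc t T)) :
    (∀ s ∈ Icc t T, |φ s| ≤ ρ) ∧ (∀ s ∈ Icc t T, φ s = X (φ T) (T - s)) ∧
      derivWithin φ (Icc t T) t = f x + U (φ T) (T - t) := by
  obtain ⟨U₀, hU, hφ, hUd, hUT⟩ := hopt.exists_control hf hg hσ ht.2 hreg
  have htT := ht.2.le
  have hact : action f g σ t T φ ≤ B := by
    refine (hopt.2.2 _ (isActionPath_const t T x htT) rfl).trans ?_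
    rw [action_const f g σ x htT]
    refine le_trans ?_ (hB x hx)
    gcongr
    linarith [ht.1]
  have hφρ := abs_le_of_action_le hg0 hσ hK hgrowth ht.1 htT hρ hB0 hρ' hU hφ
    (by rwa [hopt.2.1]) hact
  have key := H.eqOn_of_control hF hfF hfF' ht.1 hU hφ hUd hUT hφρ htT
  refine ⟨hφρ, fun s hs => (key s hs).1, ?_⟩
  have hmem := left_mem_Icc.2 htT
  rw [(hφ t hmem).derivWithin (uniqueDiffOn_Icc ht.2 t hmem), (key t hmem).2, hopt.2.1]

theorem isNearlyOptimal_zero (H : IsExtremalField F g σ ρ T X U η ν) (hF : Continuous F)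
    (hfF : ∀ x, |x| ≤ ρ → F x = f x)
    (ht : t ∈ Ico 0 T) (hx : |x| ≤ R) (hopt : IsOptimalPath f g σ T x t φ)
    (hφρ : ∀ s ∈ Icc t T, |φ s| ≤ ρ) (hφ : ∀ s ∈ Icc t T, φ s = X (φ T) (T - s)) :
    IsNearlyOptimal f F g σ ρ R T X U 0 (T - t) x (φ T) := by
  have htT := ht.2.le
  have hz : φ T ∈ Icc (-ρ) ρ := abs_le.1 (hφρ T (right_mem_Icc.2 htT))
  refine ⟨⟨by linarith, by linarith [ht.1]⟩, hx, hz, fun q hq => ?_, ?_, fun w hw => ?_⟩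
  · have h0 : 0 ≤ q * (T - t) := mul_nonneg hq.1 (by linarith)
    have h1 : q * (T - t) ≤ T - t := mul_le_of_le_one_left (by linarith) hq.2
    have hs : T - q * (T - t) ∈ Icc t T := ⟨by linarith, by linarith⟩
    have h2 := hφρ _ hs
    rw [hφ _ hs, sub_sub_cancel] at h2
    linarith
  · rw [← hφ t (left_mem_Icc.2 htT), hopt.2.1, sub_self, abs_zero]
  · rw [add_zero, ← H.action_eq_extremalAction hfF ht.1 htT hz hφ hφρ]
    unfold shiftedAction
    rw [← H.action_shift f ht.1 htT hw (x - X w (T - t))]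
    exact hopt.2.2 _ (H.isActionPath_shift hF ht.1 htT hw _) (by ring)

/-- The end point of the true minimizer is itself an allowed competitor, and its translation is
trivial. So the extremal through `z` has at most the minimal action, and uniqueness applies. -/
theorem eq_of_isNearlyOptimal_zero (H : IsExtremalField F g σ ρ T X U η ν) (hF : Continuous F)
    (hfF : ∀ x, |x| ≤ ρ → F x = f x) (ht : t ∈ Ico 0 T)
    (hopt : IsUniqueOptimalPath f g σ T x t φ)
    (hφρ : ∀ s ∈ Icc t T, |φ s| ≤ ρ) (hφ : ∀ s ∈ Icc t T, φ s = X (φ T) (T - s))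
    (hN : IsNearlyOptimal f F g σ ρ R T X U 0 (T - t) x z) : z = φ T := by
  have htT := ht.2.le
  have hw : φ T ∈ Icc (-ρ) ρ := abs_le.1 (hφρ T (right_mem_Icc.2 htT))
  have hz := hN.mem_end
  have hXρ : ∀ s ∈ Icc t T, |X z (T - s)| ≤ ρ := fun s hs => by
    have hpos : 0 < T - t := by linarith [ht.2]
    have := hN.abs_path ((T - s) / (T - t)) ⟨div_nonneg (by linarith [hs.2]) hpos.le,
      (div_le_one hpos).2 (by linarith [hs.1])⟩
    rwa [div_mul_cancel₀ _ hpos.ne', add_zero] at this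
  have hle := hN.action_le _ hw
  have hwx : X (φ T) (T - t) = x := by rw [← hφ t (left_mem_Icc.2 htT), hopt.1.2.1]
  have hzx : X z (T - t) = x := sub_eq_zero.1 (abs_nonpos_iff.1 hN.start)
  have hshift : shiftedAction f F g σ X U (T - t) x (φ T) = action f g σ t T φ := by
    unfold shiftedAction
    rw [← H.action_shift f ht.1 htT hw, hwx, H.action_eq_extremalAction hfF ht.1 htT hw hφ hφρ,
      ← H.action_eq_extremalAction hfF ht.1 htT hw (φ := fun s => X (φ T) (T - s))
        (fun _ _ => rfl) fun s hs => by rw [← hφ s hs]; exact hφρ s hs]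
    simp
  rw [hshift, add_zero,
    ← H.action_eq_extremalAction hfF ht.1 htT hz (φ := fun s => X z (T - s))
      (fun _ _ => rfl) hXρ] at hle
  have hpath := H.isActionPath_shift hF ht.1 htT hz 0
  simp only [add_zero] at hpath
  have := hopt.2 _ ⟨hpath, hzx, fun ψ hψ hψt => hle.trans (hopt.1.2.2 ψ hψ hψt)⟩
    (right_mem_Icc.2 htT)
  rwa [sub_self, H.X_zero z hz] at this

end IsExtremalField

theorem IsDiscreteExtremal.congr {F f g : ℝ → ℝ} {σ h ρ : ℝ} {M : ℕ} {q p e n : ℕ → ℝ}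
    (hq : IsDiscreteExtremal F g σ h M q p e n) (hqρ : ∀ k ≤ M, |q k| ≤ ρ)
    (hfF : ∀ x, |x| ≤ ρ → F x = f x) (hfF' : ∀ x, |x| ≤ ρ → deriv F x = deriv f x)
    (hfF'' : ∀ x, |x| ≤ ρ → deriv (deriv F) x = deriv (deriv f) x) :
    IsDiscreteExtremal f g σ h M q p e n where
  p_last := hq.p_last
  e_last := hq.e_last
  n_last := hq.n_last
  q_step k hk := by rw [← hfF _ (hqρ k hk.le)]; exact hq.q_step k hk
  p_step k hk := by rw [← hfF' _ (hqρ k hk.le)]; exact hq.p_step k hk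
  e_step k hk := by rw [← hfF' _ (hqρ k hk.le)]; exact hq.e_step k hk
  n_step k hk := by
    rw [← hfF' _ (hqρ k hk.le), ← hfF'' _ (hqρ k hk.le)]; exact hq.n_step k hk

/-! ### Uniform consistency. -/

theorem IsDiscreteOptimalPath.exists_isDiscreteExtremal {f g : ℝ → ℝ} {σ h x₀ : ℝ} {M : ℕ}
    (hf : ContDiff ℝ ∞ f) (hg : ContDiff ℝ ∞ g) (hσ : 0 < σ) (hh : 0 < h) {y : Fin M → ℝ}
    (hy : IsDiscreteOptimalPath f g σ h x₀ y) {q : ℕ → ℝ}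
    (hq : ∀ i : Fin (M + 1), discretePath x₀ y i = q i)
    (hne : ∀ k < M, 1 + h * deriv f (q k) ≠ 0) :
    ∃ p e n, IsDiscreteExtremal f g σ h M q p e n := by
  obtain ⟨p, hpM, hp⟩ := exists_backward_recursion M (-σ ^ 2 * deriv g (q M))
    fun k v => v * (1 + h * deriv f (q k))
  obtain ⟨s, hsM, hs⟩ := exists_backward_recursion M
    ((1, -σ ^ 2 * deriv (deriv g) (q M)) : ℝ × ℝ)
    fun k v => ((v.1 - h * v.2) / (1 + h * deriv f (q k)), v.2 * (1 + h * deriv f (q k)) +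
      h * (deriv (deriv f) (q k) * p (k + 1) * ((v.1 - h * v.2) / (1 + h * deriv f (q k)))))
  refine ⟨p, fun k => (s k).1, fun k => (s k).2, hpM, by simp [hsM], by simp [hsM],
    hy.step_eq hf hg hσ hh hq hpM hp, hp, fun k hk => ?_, fun k hk => ?_⟩
  · rw [hs k hk]
    have := hne k hk
    field_simp
    ring
  · rw [hs k hk]

/-- The problem is autonomous, so only the time to go `M h` matters, and uniformity in the step
index becomes uniformity over all `M` with `M h ≤ T`. -/
theorem exists_uniform_consistency {f g : ℝ → ℝ} {σ T K R : ℝ}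
    (hf : ContDiff ℝ ∞ f) (hg : ContDiff ℝ ∞ g) (hg0 : ∀ x, 0 ≤ g x)
    (hσ : 0 < σ) (hT : 0 < T) (hK : 0 ≤ K) (hgrowth : ∀ x, x * f x ≤ K * (1 + x ^ 2))
    {φ : ℝ → ℝ → ℝ → ℝ}
    (hopt : ∀ x : ℝ, ∀ t ∈ Ico 0 T, IsUniqueOptimalPath f g σ T x t (φ x t))
    (hreg : ∀ x : ℝ, ∀ t ∈ Ico 0 T, ContDiffOn ℝ 2 (φ x t) (Icc t T))
    (hnondeg : ∀ x : ℝ, ∀ t ∈ Ico 0 T, IsNondegeneratePath f g σ t T (φ x t)) :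
    ∃ C h₀, 0 < h₀ ∧ ∀ h, 0 < h → h ≤ h₀ → ∀ M : ℕ, ∀ hM : 0 < M, M * h ≤ T →
      ∀ x, |x| ≤ R → (∃ y : Fin M → ℝ, IsDiscreteOptimalPath f g σ h x y) ∧
      ∀ y : Fin M → ℝ, IsDiscreteOptimalPath f g σ h x y →
        |(y ⟨0, hM⟩ - x) / h - derivWithin (φ x (T - M * h)) (Icc (T - M * h) T) (T - M * h)|
          ≤ C * h ∧
        IsUnit (hessianMatrix (discreteAction f g σ h x) y).det ∧
        |dlmVariance f g σ h hM x y - σ ^ 2| ≤ C * h := by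
  have hfc := hf.continuous
  have hgc := hg.continuous
  obtain ⟨B, hB0, hB⟩ : ∃ B, 0 ≤ B ∧ ∀ x, |x| ≤ R → T / (2 * σ ^ 2) * f x ^ 2 + g x ≤ B := by
    obtain ⟨B, hB⟩ := (isCompact_Icc (a := -R) (b := R)).exists_bound_of_continuousOn
      (f := fun x => T / (2 * σ ^ 2) * f x ^ 2 + g x) (by fun_prop)
    exact ⟨|B|, abs_nonneg B, fun x hx =>
      ((le_abs_self _).trans (hB x (abs_le.1 hx))).trans (le_abs_self B)⟩
  obtain ⟨ρ, hρ, hρ'⟩ : ∃ ρ : ℝ, 0 ≤ ρ ∧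
      (2 + R ^ 2 + 4 * σ ^ 2 * B) * Real.exp ((2 * K + 1) * T) ≤ 1 + ρ ^ 2 :=
    ⟨Real.sqrt ((2 + R ^ 2 + 4 * σ ^ 2 * B) * Real.exp ((2 * K + 1) * T)), Real.sqrt_nonneg _, by
      rw [Real.sq_sqrt (by positivity)]; linarith⟩
  obtain ⟨F, hF, hFc, hfF, hfF', hfF''⟩ := exists_compactSupport_eqOn hf hρ
  obtain ⟨X, U, η, ν, H⟩ := exists_isExtremalField hF hFc hg σ hρ hT
  have hpath : ∀ x, |x| ≤ R → ∀ t ∈ Ico 0 T, (∀ s ∈ Icc t T, |φ x t s| ≤ ρ) ∧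
      (∀ s ∈ Icc t T, φ x t s = X (φ x t T) (T - s)) ∧
      derivWithin (φ x t) (Icc t T) t = f x + U (φ x t T) (T - t) := fun x hx t ht =>
    H.eqOn_of_isOptimalPath hF hfF hfF' hf hg hg0 hσ hK hgrowth hρ hB0 hB hρ' ht hx
      (hopt x t ht).1 (hreg x t ht)
  have huniq : ∀ τ x z, 0 < τ → IsNearlyOptimal f F g σ ρ R T X U 0 τ x z →
      z = φ x (T - τ) T := fun τ x z hτ hN => by
    have ht : T - τ ∈ Ico 0 T := ⟨by linarith [hN.mem_time.2], by linarith⟩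
    obtain ⟨p1, p2, -⟩ := hpath x hN.abs_start _ ht
    exact H.eq_of_isNearlyOptimal_zero hF.continuous hfF ht (hopt x _ ht) p1 p2
      (by rwa [sub_sub_cancel])
  obtain ⟨ε, c, hε, hc, hηc, hXc⟩ := H.exists_uniform_nondegeneracy (R := R) hF hFc hfc hg
    (fun τ x z hN => by
      -- Zero time to go is a limit point of the compactness argument but is not covered by the
      -- hypotheses on paths; there `η = 1` and `X z 0 = z` settle the matter.
      rcases hN.mem_time.1.eq_or_lt with h0 | h0
      · rw [← h0, H.η_zero z hN.mem_end]
        exact one_ne_zero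
      · have ht : T - τ ∈ Ico 0 T := ⟨by linarith [hN.mem_time.2], by linarith⟩
        obtain ⟨p1, p2, -⟩ := hpath x hN.abs_start _ ht
        rw [← huniq τ x z h0 hN] at p2
        have := H.η_ne_zero hF hfF hfF' hfF'' hσ ht.1 ht.2.le hN.mem_end p2 p1 (hnondeg x _ ht)
        rwa [sub_sub_cancel] at this)
    (fun τ x z z' hN hN' => by
      rcases hN.mem_time.1.eq_or_lt with h0 | h0
      · have h1 := sub_eq_zero.1 (abs_nonpos_iff.1 hN.start)
        have h2 := sub_eq_zero.1 (abs_nonpos_iff.1 hN'.start)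
        rw [← h0, H.X_zero _ hN.mem_end] at h1
        rw [← h0, H.X_zero _ hN'.mem_end] at h2
        rw [h1, h2]
      · rw [huniq τ x z h0 hN, huniq τ x z' h0 hN'])
  obtain ⟨L, hL, -, hF1, -⟩ := exists_bound_derivs hF hFc
  obtain ⟨h₁, hh₁, hdisc⟩ := exists_bound_discretePath hfc hσ hK hgrowth hT hρ hB0 hρ'
  obtain ⟨Cn, h₂, hCn, hh₂, hnear⟩ := H.exists_isNearlyOptimal hF hFc hf hg hfF hρ hT R
  obtain ⟨Ce, h₃, hCe, hh₃, herr⟩ := H.exists_discretization_error hF hFc hg hρ hT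
  obtain ⟨P, h₄, hP, hh₄, hbdd⟩ := IsDiscreteExtremal.exists_bound hF hFc hg σ hρ T
  obtain ⟨Ct, hCt, htime⟩ := H.exists_lipschitz_time hF hFc
  obtain ⟨Cl, hCl, hlip⟩ := H.exists_lipschitz hF hFc hg
  -- The first constant is for the drift: scheme error, one step of time shift, and end point error
  -- `(Cn / c) h`. The second is for the variance, with `|n 1| ≤ P`, `|e 0| ≥ c / 2` and `1 + h f' ≥
  -- 1 / 2`. The last three bounds on `h` secure `1 + h f' ≥ 1 / 2`, near-optimality within `ε`, and
  -- `|e 0| ≥ c / 2`.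
  refine ⟨max (Ce + Ct + Cl * (Cn / c)) (σ ^ 2 * (P / (c / 2 * (1 / 2)))),
    min (min (min h₁ h₂) (min h₃ h₄)) (min (min (1 / (2 * (L + 1))) (ε / (Cn + 1)))
      (c / (2 * (Ce + 1)))), by positivity, fun h hh hle M hM hMT x hx => ?_⟩
  simp only [le_min_iff] at hle
  obtain ⟨⟨⟨hle₁, hle₂⟩, hle₃, hle₄⟩, ⟨hleL, hleε⟩, hlec⟩ := hle
  have hbound : ∀ y : Fin M → ℝ,
      discreteAction f g σ h x y ≤ discreteAction f g σ h x (fun _ : Fin M => x) → ∀ q : ℕ → ℝ,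
      (∀ i : Fin (M + 1), discretePath x y i = q i) → ∀ k ≤ M, |q k| ≤ ρ := by
    intro y hy q hq
    have hq0 : q 0 = x := by simpa [discretePath] using (hq 0).symm
    refine hdisc h hh hle₁ M hMT q (by rwa [hq0]) ?_
    rw [discreteAction_const, discreteAction_eq_sum_range hq] at hy
    have h1 : M * h / (2 * σ ^ 2) * f x ^ 2 ≤ T / (2 * σ ^ 2) * f x ^ 2 := by gcongr
    linarith [hB x hx, hg0 (q M)]
  refine ⟨exists_isDiscreteOptimalPath hf hg (fun _ => x) (fun y hy i => ?_) hρ,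
    fun y hy => ?_⟩
  · obtain ⟨q, hq⟩ := exists_seq_eq_discretePath x y
    have h1 := hbound y hy q hq (i + 1) i.2
    have h2 := hq i.succ
    rw [Fin.val_succ] at h2
    rw [← h2] at h1
    simpa [discretePath] using h1
  obtain ⟨q, hq⟩ := exists_seq_eq_discretePath x y
  have hqρ := hbound y (hy _) q hq
  have hq0 : q 0 = x := by simpa [discretePath] using (hq 0).symm
  have hq1 : q 1 = y ⟨0, hM⟩ := (hq (Fin.succ ⟨0, hM⟩)).symm
  have hstep : ∀ k ≤ M, 1 / 2 ≤ 1 + h * deriv f (q k) := fun k hk => by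
    rw [← hfF' _ (hqρ k hk)]
    have h1 := (abs_le.1 (hF1 (q k))).1
    have h2 : h * (2 * (L + 1)) ≤ 1 := (le_div_iff₀ (by positivity)).1 hleL
    have h3 : h * -L ≤ h * deriv F (q k) := by gcongr
    linarith
  obtain ⟨p, e, n, hE⟩ := hy.exists_isDiscreteExtremal hf hg hσ hh hq
    fun k hk => by linarith [hstep k hk.le]
  have hEF : IsDiscreteExtremal F g σ h M q p e n := hE.congr hqρ (fun x hx => (hfF x hx).symm)
    (fun x hx => (hfF' x hx).symm) (fun x hx => (hfF'' x hx).symm)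
  have hN := hnear h hh hle₂ M hMT q p e n hEF hqρ x hx y hy hq
  have hzM := hN.mem_end
  have hCnε : Cn * h ≤ ε := by
    have : h * (Cn + 1) ≤ ε := (le_div_iff₀ (by positivity)).1 hleε
    linarith
  have herr' := herr h hh hle₃ M hMT q p e n hEF hqρ
  have hMh : 0 < M * h := by positivity
  have hτ := hN.mem_time
  constructor
  · have ht : T - M * h ∈ Ico 0 T := ⟨by linarith, by linarith⟩
    obtain ⟨p1, p2, p3⟩ := hpath x hx _ ht
    have hN0 := H.isNearlyOptimal_zero (R := R) hF.continuous hfF ht hx (hopt x _ ht).1 p1 p2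
    rw [sub_sub_cancel] at hN0 p3
    rw [p3]
    set z := φ x (T - M * h) T
    -- The decisive step: the continuous and the discrete end points are both nearly optimal for the
    -- same `x`, so the expansion of `X` turns the starting error `Cn h` into an end point error.
    have d1 := hXc _ _ _ _ (hN0.mono hε.le) (hN.mono hCnε)
    have d2 : X z (M * h) = x := sub_eq_zero.1 (abs_nonpos_iff.1 hN0.start)
    rw [d2] at d1
    have d3 : |q M - z| ≤ Cn / c * h := by
      rw [div_mul_eq_mul_div, le_div_iff₀ hc]
      linarith [hN.start]
    have d4 := (hlip _ hN0.mem_end _ hzM _ hτ).2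
    have d5 := (herr' 1 hM).2.1
    have d6 : ((M : ℝ) - (1 : ℕ)) * h = M * h - h := by push_cast; ring
    have hM1 : (1 : ℝ) ≤ M := by exact_mod_cast hM
    have d7 : h ≤ M * h := le_mul_of_one_le_left hh.le hM1
    rw [d6] at d5
    have d8 := (htime _ hzM (M * h - h) ⟨by linarith, by linarith⟩ _ hτ).2
    rw [sub_sub_cancel_left, abs_neg, abs_of_pos hh] at d8
    have d9 : (y ⟨0, hM⟩ - x) / h = f x + p 1 := by
      rw [← hq1, hE.q_step 0 hM, hq0]
      field_simp
      ring
    rw [d9, add_sub_add_left_eq_sub]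
    have d10 := abs_sub_le (p 1) (U (q M) (M * h - h)) (U z (M * h))
    have d11 := abs_sub_le (U (q M) (M * h - h)) (U (q M) (M * h)) (U z (M * h))
    have d12 : Cl * |q M - z| ≤ Cl * (Cn / c * h) := by gcongr
    calc |p 1 - U z (M * h)| ≤ (Ce + Ct + Cl * (Cn / c)) * h := by linarith
      _ ≤ _ := by gcongr; exact le_max_left _ _
  · have e1 := hηc _ _ _ (hN.mono hCnε)
    have e2 := (herr' 0 (Nat.zero_le _)).2.2.1
    rw [Nat.cast_zero, sub_zero] at e2
    have e3 : c / 2 ≤ |e 0| := by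
      have h1 : h * (2 * (Ce + 1)) ≤ c := (le_div_iff₀ (by positivity)).1 hlec
      have h2 := abs_sub_abs_le_abs_sub (η (q M) (M * h)) (e 0)
      rw [abs_sub_comm (η (q M) (M * h))] at h2
      linarith
    have e4 := hstep 0 (Nat.zero_le _)
    obtain ⟨u1, u2⟩ := hessianMatrix_discreteAction hf hg hσ hh hM hq hE
      (fun k hk => by linarith [hstep k hk.le])
      (abs_pos.1 (lt_of_lt_of_le (by positivity) e3))
    refine ⟨u1, ?_⟩
    have e5 := (hbdd h hh hle₄ M hMT q p e n hEF hqρ 1 hM).2.2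
    have e6 : |n 1 / (e 0 * (1 + h * deriv f (q 0)))| ≤ P / (c / 2 * (1 / 2)) := by
      rw [abs_div, abs_mul]
      gcongr
      exact e4.trans (le_abs_self _)
    rw [u2, mul_add, mul_one, add_sub_cancel_left, abs_mul, abs_mul, abs_of_pos hh,
      abs_of_nonneg (sq_nonneg σ)]
    calc σ ^ 2 * (h * |n 1 / (e 0 * (1 + h * deriv f (q 0)))|)
        ≤ σ ^ 2 * (h * (P / (c / 2 * (1 / 2)))) := by gcongr
      _ = σ ^ 2 * (P / (c / 2 * (1 / 2))) * h := by ring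
      _ ≤ _ := by gcongr; exact le_max_right _ _

theorem mainTheorem1 (f g : ℝ → ℝ) (σ T : ℝ)
    (hf : ContDiff ℝ ∞ f) (hg : ContDiff ℝ ∞ g) (hg0 : ∀ x, 0 ≤ g x)
    (hσ : 0 < σ) (hT : 0 < T)
    (hgrowth : ∃ K : ℝ, ∀ x, x * f x ≤ K * (1 + x ^ 2))
    (φ : ℝ → ℝ → ℝ → ℝ)
    (hopt : ∀ x : ℝ, ∀ t ∈ Ico 0 T, IsUniqueOptimalPath f g σ T x t (φ x t))
    (hreg : ∀ x : ℝ, ∀ t ∈ Ico 0 T, ContDiffOn ℝ 2 (φ x t) (Icc t T))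
    (hnondeg : ∀ x : ℝ, ∀ t ∈ Ico 0 T, IsNondegeneratePath f g σ t T (φ x t)) :
    ∀ R : ℝ, ∃ C : ℝ, ∃ N₀ : ℕ, ∀ N ≥ N₀, ∀ n : ℕ, ∀ hn : n < N, ∀ x : ℝ, |x| ≤ R →
      (∃ y : Fin (N - n) → ℝ, IsDiscreteOptimalPath f g σ (T / N) x y) ∧
      ∀ y : Fin (N - n) → ℝ, IsDiscreteOptimalPath f g σ (T / N) x y →
        |(y ⟨0, Nat.sub_pos_of_lt hn⟩ - x) / (T / N) -
            derivWithin (φ x (n * (T / N))) (Icc (n * (T / N)) T) (n * (T / N))|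
          ≤ C * (T / N) ∧
        IsUnit (hessianMatrix (discreteAction f g σ (T / N) x) y).det ∧
        |dlmVariance f g σ (T / N) (Nat.sub_pos_of_lt hn) x y - σ ^ 2| ≤ C * (T / N) := by
  intro R
  obtain ⟨K, hK⟩ := hgrowth
  obtain ⟨C, h₀, hh₀, key⟩ := exists_uniform_consistency (K := |K|) (R := R) hf hg hg0 hσ hT
    (abs_nonneg K) (fun x => (hK x).trans (by gcongr; exact le_abs_self K)) hopt hreg hnondeg
  refine ⟨C, ⌈T / h₀⌉₊, fun N hN n hn x hx => ?_⟩
  have hN0 : (0 : ℝ) < N := by exact_mod_cast (Nat.zero_le n).trans_lt hn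
  have hle : T / N ≤ h₀ := by
    have h1 : T / h₀ ≤ N := (Nat.le_ceil _).trans (by exact_mod_cast hN)
    rw [div_le_iff₀ hh₀] at h1
    rw [div_le_iff₀ hN0]
    linarith
  have e1 : T - (N - n : ℕ) * (T / N) = n * (T / N) := by
    rw [Nat.cast_sub hn.le]
    field_simp
    ring
  have h2 := key (T / N) (by positivity) hle (N - n) (Nat.sub_pos_of_lt hn) (by
    have : (0 : ℝ) ≤ n * (T / N) := by positivity
    linarith) x hx
  rwa [e1] at h2
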